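/- Conventions. An abstract polytope of rank $n$ ($n$-polytope) is a partially ordered set with a least and a greatest face and a strictly monotone rank function with range $\{-1,0,\dots,n\}$, all of whose flags (maximal chains) have exactly $n+2$ elements, which is strongly flag-connected, and in which there are exactly two $j$-faces between any incident $(j-1)$-face and $(j+1)$-face. $\Gamma(\mathcal P)$ is the group of order automorphisms of $\mathcal P$; $\mathcal P$ is asymmetric if $\Gamma(\mathcal P)$ is trivial, equifacetted if its facets are mutually isomorphic, semi-regular if its facets are regular (flag-transitive) and $\Gamma(\mathcal P)$ is vertex-transitive, simplicial if its facets are isomorphic to simplices, and vertex-describable if its faces are determined by their vertex-sets, so that $\mathcal P$ is represented by these vertex-sets ordered by inclusion. An $m$-polytope is equivelar of type $\{p_1,\dots,p_{m-1}\}$ if for every flag $\{G_{-1},\dots,G_m\}$ and every $1\le j\le m-1$ the section $G_{j+1}/G_{j-2}$ is a $p_j$-gon. For a finite vertex-describable polytope $\mathcal K$ with vertex-set $V$, the faces of $2^{\mathcal K}$ are the empty set and the sets $F(\varepsilon)=\{\eta\in\{0,1\}^V : \eta_i=\varepsilon_i \text{ for all } i\notin F\}$ ($F$ a face of $\mathcal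 K$, identified with its vertex-set, $\varepsilon\in\{0,1\}^V$), ordered by inclusion. For a finite polytope $\mathcal L$ and a flag $\Phi$ of $\mathcal L$, let $\mathcal K(\mathcal L,\Phi)$ be the poset of simplices (including the empty one, and with a greatest face adjoined) of the complex obtained from the order complex of $\mathcal L$ (the chains of proper faces of $\mathcal L$) by replacing the facet given by $\Phi$ by the simplices $\{z\}\cup\tau$, where $z$ is a new vertex and $\tau$ runs over the proper subsets of that facet. Theorem. Let $n\ge 4$. (1) For every $N$ there is a finite equifacetted semi-regular $n$-polytope $\mathcal P$ that has at least $N$ flag orbits under $\Gamma(\mathcal P)$ and, simultaneously for all $j=1,\dots,n-1$, at least $N$ orbits of $j$-faces under $\Gamma(\mathcal P)$. (2) Let $\mathcal L$ be any finite equivelar $(n-1)$-polytope of type $\{p_1,\dots,p_{n-2}\}$ with mutually distinct entries $p_j\ge 3$, and let $\Phi$ be a flag of $\mathcal L$. Then $\mathcal K=\mathcal K(\mathcal L,\Phi)$ is an asymmetric, vertex-describable, simplicial $(n-1)$-polytope, and $\mathcal P=2^{\mathcal K}$ is an equifacetted semi-regular $n$-polytope. The number of flag orbits of $\mathcal P$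 under $\Gamma(\mathcal P)$ is the number of flags of $\mathcal K$, and for $1\le j\le n-1$ the number of $j$-face orbits of $\mathcal P$ under $\Gamma(\mathcal P)$ is the number of $(j-1)$-faces of $\mathcal K$. (3) For every $N$ there is a finite polytope $\mathcal L$ as in (2) such that for every flag $\Phi$ of $\mathcal L$ the polytope $\mathcal K(\mathcal L,\Phi)$ has at least $N$ flags and at least $N$ $i$-faces for each $i=0,\dots,n-2$. If $n=4$, then $\mathcal L$ can be taken to be a toroidal map of type $\{3,6\}$. -/

import Mathlib

universe u

namespace AbstractPolytope

section Polytopes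

variable (P : Type u) [PartialOrder P]

/-- The rank of a face: the length of the longest chain of faces descending from it, minus one
(so that a least face has rank `-1`).  In a polytope, where all flags have the same finite
number of faces and there is a least face, this is the only strictly monotone rank function
with values in `{-1, ..., n}`. -/
noncomputable def faceRank {P : Type u} [PartialOrder P] (F : P) : ℤ :=
  ((Order.height F).toNat : ℤ) - 1

/-- The set of `j`-faces. -/
def Face (j : ℤ) : Set P := {F | faceRank F = j}

/-- Two flags (maximal chains) are adjacent if they differ in exactly one face. -/
def Adjacent {P : Type u} [PartialOrder P] (Φ Ψ : Flag P) : Prop :=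
  ((Φ : Set P) \ (Ψ : Set P)).encard = 1 ∧ ((Ψ : Set P) \ (Φ : Set P)).encard = 1

/-- The partially ordered set `P` is an (abstract) polytope of rank `n`. -/
structure IsPolytope (n : ℕ) : Prop where
  exists_least : ∃ F : P, IsBot F
  exists_greatest : ∃ F : P, IsTop F
  rank_strictMono : StrictMono (faceRank : P → ℤ)
  rank_range : Set.range (faceRank : P → ℤ) = Set.Icc (-1) (n : ℤ)
  flag_encard : ∀ Φ : Flag P, (Φ : Set P).encard = n + 2
  /-- Strong flag-connectedness: any two flags are joined by a sequence of successively adjacent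
  flags, all of them containing the intersection of the two. -/
  stronglyFlagConnected : ∀ Φ Ψ : Flag P,
    Relation.ReflTransGen
      (fun A B : Flag P => Adjacent A B ∧ (Φ : Set P) ∩ (Ψ : Set P) ⊆ (B : Set P)) Φ Ψ
  /-- Homogeneity: there are exactly two faces strictly between a `(j-1)`-face and an incident
  `(j+1)`-face. -/
  diamond : ∀ (j : ℤ) (F G : P), F ≤ G → faceRank F = j - 1 → faceRank G = j + 1 →
    {H : P | F ≤ H ∧ H ≤ G ∧ faceRank H = j}.encard = 2

/-- The automorphism group acts transitively on the flags. -/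
def IsRegular : Prop := ∀ Φ Ψ : Flag P, ∃ g : P ≃o P, Flag.map g Φ = Ψ

/-- The automorphism group is trivial. -/
def IsAsymmetric : Prop := ∀ g : P ≃o P, g = OrderIso.refl P

/-- All facets of the `n`-polytope `P` are mutually isomorphic; the facet `F` is identified
with the section `F / F₋₁ = {H | H ≤ F}`. -/
def IsEquifacetted (n : ℕ) : Prop :=
  ∀ F ∈ Face P (n - 1), ∀ G ∈ Face P (n - 1), Nonempty (Set.Iic F ≃o Set.Iic G)

/-- All facets of the `n`-polytope `P` are isomorphic to the `(n-1)`-simplex, whose face lattice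
is the lattice of subsets of an `n`-element set. -/
def IsSimplicial (n : ℕ) : Prop :=
  ∀ F ∈ Face P (n - 1), Nonempty (Set.Iic F ≃o Finset (Fin n))

/-- The `n`-polytope `P` has regular facets and a vertex-transitive automorphism group. -/
def IsSemiregular (n : ℕ) : Prop :=
  (∀ F ∈ Face P (n - 1), IsRegular (Set.Iic F)) ∧
  (∀ v ∈ Face P 0, ∀ w ∈ Face P 0, ∃ g : P ≃o P, g v = w)

/-- The vertices of `P` incident with a face. -/
def vertexSet {P : Type u} [PartialOrder P] (F : P) : Set P := {v | v ∈ Face P 0 ∧ v ≤ F}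

/-- The faces are determined by their vertex-sets, in such a way that `P` is represented by the
family of these vertex-sets, ordered by inclusion. -/
def IsVertexDescribable : Prop :=
  ∀ F G : P, F ≤ G ↔ vertexSet F ⊆ vertexSet G

/-- The `n`-polytope `P` is equivelar of type `{p 1, ..., p (n-1)}`: for `1 ≤ j ≤ n-1` and every
flag, the section `G / F` between the `(j+1)`-face `G` and the `(j-2)`-face `F` of the flag,
which is a polytope of rank 2, is a `p j`-gon, that is, has `p j` vertices
(a vertex of the section is a `(j-1)`-face of `P`). -/
def IsEquivelar (n : ℕ) (p : ℕ → ℕ) : Prop :=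
  ∀ j : ℕ, 1 ≤ j → j ≤ n - 1 → ∀ Ψ : Flag P, ∀ F ∈ Ψ, ∀ G ∈ Ψ,
    faceRank F = (j : ℤ) - 2 → faceRank G = (j : ℤ) + 1 →
    {H : P | F ≤ H ∧ H ≤ G ∧ faceRank H = (j : ℤ) - 1}.encard = p j

/-- The number of flag orbits of a (finite) polytope under its automorphism group. -/
noncomputable def numFlagOrbits : ℕ :=
  Nat.card (Quot (fun Φ Ψ : Flag P => ∃ g : P ≃o P, Flag.map g Φ = Ψ))

/-- The number of `j`-face orbits of a (finite) polytope under its automorphism group. -/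
noncomputable def numFaceOrbits (j : ℤ) : ℕ :=
  Nat.card (Quot (fun F G : Face P j => ∃ g : P ≃o P, g (F : P) = (G : P)))

/-- A toroidal map: a finite 3-polytope which is orientable (its flags can be coloured with two
colours such that adjacent flags have different colours) and has Euler characteristic zero,
that is, a map on the torus. -/
def IsToroidalMap : Prop :=
  Finite P ∧ IsPolytope P 3 ∧
  (∃ c : Flag P → Bool, ∀ Φ Ψ : Flag P, Adjacent Φ Ψ → c Φ ≠ c Ψ) ∧
  ((Face P 0).ncard : ℤ) - (Face P 1).ncard + (Face P 2).ncard = 0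

end Polytopes

section TwoPower

variable (K : Type u) [PartialOrder K]

/-- For a face `F` of `K` and a point `ε` of `2^V`, where `V` is the vertex-set of `K`, the set
`F(ε)` of all points that agree with `ε` in the components outside the vertex-set of `F`. -/
def cubeFace {K : Type u} [PartialOrder K] (F : K) (ε : Face K 0 → Fin 2) :
    Set (Face K 0 → Fin 2) :=
  {η | ∀ i : Face K 0, (i : K) ∉ vertexSet F → η i = ε i}

/-- The polytope `2^K`: the sets `F(ε)`, together with the empty set, ordered by inclusion. -/
abbrev TwoPow : Type u :=
  {S : Set (Face K 0 → Fin 2) // S = ∅ ∨ ∃ (F : K) (ε : Face K 0 → Fin 2), S = cubeFace F ε}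

end TwoPower

section Complexes

/-- The simplices of a simplicial complex (the empty one included), ordered by inclusion and
supplemented by a greatest face. -/
abbrev FacePoset {V : Type u} (C : Set (Set V)) : Type u := WithTop C

/-- The order complex of a polytope: its simplices are the chains without improper face. -/
def orderComplex (L : Type u) [PartialOrder L] : Set (Set L) :=
  {s | IsChain (· ≤ ·) s ∧ ∀ F ∈ s, ¬ IsBot F ∧ ¬ IsTop F}

/-- The facet of the order complex given by a flag: the set of proper faces in the flag. -/
def flagSimplex {L : Type u} [PartialOrder L] (Φ : Flag L) : Set L :=
  {F | F ∈ Φ ∧ ¬ IsBot F ∧ ¬ IsTop F}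

/-- Stellar subdivision of a facet `σ` of the simplicial complex `C`: the simplex `σ` is removed,
all other simplices are kept, and a new vertex `none` is joined to all proper subsets of `σ`. -/
def stellarSubdivision {V : Type u} (C : Set (Set V)) (σ : Set V) : Set (Set (Option V)) :=
  {s | ∃ τ ∈ C, τ ≠ σ ∧ s = some '' τ} ∪ {s | ∃ τ, τ ⊂ σ ∧ s = insert none (some '' τ)}

/-- The simplicial polytope obtained from the order complex of `L` by stellar subdivision of the
facet belonging to the flag `Φ`. -/
abbrev SubdividedOrderComplex {L : Type u} [PartialOrder L] (Φ : Flag L) : Type u :=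
  FacePoset (stellarSubdivision (orderComplex L) (flagSimplex Φ))

end Complexes

end AbstractPolytope

open AbstractPolytope

-- Write `m = n - 1`. The polytope `2^K` has vertices the points of `{0,1}^V`, and the faces through
-- a given vertex form a copy of `K`. The translations of `(Z/2)^V` act transitively on the
-- vertices, so the orbits of `2^K` are governed by the stabiliser of one vertex. This stabiliser
-- acts on the copy of `K` at the vertex. If `K` is asymmetric, it fixes all faces through the
-- vertex, hence a flag, and an automorphism of a polytope that fixes a flag is the identity
-- (`IsPolytope.eq_refl_of_fixes_flag`). So the automorphism group consists of the translations, and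
-- orbits of flags and of `j`-faces correspond to flags and `(j-1)`-faces of `K`. If `K` is
-- simplicial, each facet of `2^K` is a cube: any permutation of the vertices of a facet of `K` and
-- any translation act on it, which makes the facets regular and mutually isomorphic.
--
-- The asymmetry of the subdivided order complex (`isAsymmetric_subdivided`) comes from counting
-- facets. The new vertex lies in `m` facets and every other vertex in at least `m + 1`, so the new
-- vertex is fixed and its link, the boundary of the subdivided simplex, is preserved. A
-- codimension-2 face of that simplex, obtained by omitting the ranks `i < j`, lies in `2 p_i + 1`
-- facets if `j = i + 1` and in 5 otherwise. As the `p_i` are distinct and at least 3, each pair of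
-- consecutive ranks is preserved. For `m ≥ 3` this fixes every rank, hence a facet with all its
-- vertices.
--
-- Suitable `L` are built by induction on the rank. The cosets of the subgroups generated by
-- vertex-involutions of `K` form a polytope with vertex-figures `K`, and the new first entry of its
-- type can be made arbitrarily large (`exists_equivelar_extension`). In rank 3 a triangulation of
-- the torus with vertex-set a cyclic group is used instead. Each vertex of `L` yields a `j`-simplex
-- of the order complex, and subdivision destroys at most one of these.
--
-- That all these posets are polytopes follows from one criterion, `Ranked.isPolytope`: a gap-free
-- rank function, the diamond condition and connected sections imply strong flag-connectedness. It
-- is applied to class systems (cubes and coset geometries) and to simplicial manifolds (order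
-- complexes, subdivisions, tori).

universe v

/-! ### Ranked posets and a criterion for being a polytope -/

namespace AbstractPolytope

/-- A bounded poset with a strictly monotone function `r` onto `{0, ..., N}` such that chains can
be refined to chains without rank gaps. -/
structure Ranked {P : Type u} [PartialOrder P] (r : P → ℕ) (N : ℕ) : Prop where
  exists_bot : ∃ b : P, IsBot b ∧ r b = 0
  exists_top : ∃ t : P, IsTop t ∧ r t = N
  mono : StrictMono r
  dense : ∀ F G : P, F < G → r F + 1 < r G → ∃ H, F < H ∧ H < G

/-- The diamond condition with respect to a rank function. -/
def Thin {P : Type u} [PartialOrder P] (r : P → ℕ) : Prop :=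
  ∀ F G : P, F < G → r G = r F + 2 → {H : P | F < H ∧ H < G}.encard = 2

/-- The steps of a path of pairwise incident faces in the open interval between `F` and `G`. -/
def IncidentIn {P : Type u} [PartialOrder P] (F G : P) (X Y : P) : Prop :=
  (X ≤ Y ∨ Y ≤ X) ∧ F < Y ∧ Y < G

/-- All sections of rank at least `2` are connected. -/
def SectionConnected {P : Type u} [PartialOrder P] (r : P → ℕ) : Prop :=
  ∀ F G : P, F < G → r F + 3 ≤ r G → ∀ A B : P, F < A → A < G → F < B → B < G →
    Relation.ReflTransGen (IncidentIn F G) A B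

/-- Two flags are joined by successively adjacent flags that contain `J`. -/
def FlagConnected {P : Type u} [PartialOrder P] (J : Set P) (Φ Ψ : Flag P) : Prop :=
  Relation.ReflTransGen (fun A B : Flag P => Adjacent A B ∧ J ⊆ (B : Set P)) Φ Ψ

theorem FlagConnected.mono {P : Type u} [PartialOrder P] {J K : Set P} {Φ Ψ : Flag P}
    (hJK : K ⊆ J) (h : FlagConnected J Φ Ψ) : FlagConnected K Φ Ψ :=
  Relation.ReflTransGen.mono (fun _ _ hab => ⟨hab.1, hJK.trans hab.2⟩) _ _ h

section

variable {P : Type u} [PartialOrder P] {r : P → ℕ} {N : ℕ}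

theorem flag_le_of_rank_le (hr : StrictMono r) {Φ : Flag P} {F G : P} (hF : F ∈ Φ) (hG : G ∈ Φ)
    (h : r F ≤ r G) : F ≤ G := by
  rcases Φ.le_or_le hF hG with h' | h'
  · exact h'
  · rcases h'.eq_or_lt with h'' | h''
    · exact h''.ge
    · exact absurd (hr h'') (by omega)

theorem flag_lt_of_rank_lt (hr : StrictMono r) {Φ : Flag P} {F G : P} (hF : F ∈ Φ) (hG : G ∈ Φ)
    (h : r F < r G) : F < G :=
  (flag_le_of_rank_le hr hF hG h.le).lt_of_ne fun e => by rw [e] at h; exact lt_irrefl _ h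

theorem flag_eq_of_rank_eq (hr : StrictMono r) {Φ : Flag P} {F G : P} (hF : F ∈ Φ) (hG : G ∈ Φ)
    (h : r F = r G) : F = G :=
  le_antisymm (flag_le_of_rank_le hr hF hG h.le) (flag_le_of_rank_le hr hG hF h.ge)

theorem mem_flag_of_isBot {F : P} (hF : IsBot F) (Φ : Flag P) : F ∈ Φ :=
  Flag.mem_iff_forall_le_or_ge.2 fun b _ => Or.inl (hF b)

theorem mem_flag_of_isTop {F : P} (hF : IsTop F) (Φ : Flag P) : F ∈ Φ :=
  Flag.mem_iff_forall_le_or_ge.2 fun b _ => Or.inr (hF b)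

namespace Ranked

variable (h : Ranked r N)
include h

theorem rank_le (F : P) : r F ≤ N := by
  obtain ⟨t, ht, htN⟩ := h.exists_top
  exact htN ▸ h.mono.monotone (ht F)

theorem isBot_of_rank {F : P} (hF : r F = 0) : IsBot F := by
  obtain ⟨b, hb, hb0⟩ := h.exists_bot
  rcases (hb F).eq_or_lt with h' | h'
  · exact h' ▸ hb
  · have := h.mono h'; omega

theorem isTop_of_rank {F : P} (hF : r F = N) : IsTop F := by
  obtain ⟨b, hb, hb0⟩ := h.exists_top
  rcases (hb F).eq_or_lt with h' | h'
  · exact h' ▸ hb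
  · have := h.mono h'; omega

theorem rank_of_isBot {F : P} (hF : IsBot F) : r F = 0 := by
  obtain ⟨b, hb, hb0⟩ := h.exists_bot
  have := h.mono.monotone (hF b)
  omega

theorem rank_of_isTop {F : P} (hF : IsTop F) : r F = N := by
  obtain ⟨b, hb, hb0⟩ := h.exists_top
  have := h.mono.monotone (hF b)
  have := h.rank_le F
  omega

theorem exists_between_rank {F G : P} (hFG : F ≤ G) {k : ℕ} (h1 : r F ≤ k) (h2 : k ≤ r G) :
    ∃ H, F ≤ H ∧ H ≤ G ∧ r H = k := by
  induction hd : r G - r F using Nat.strong_induction_on generalizing F G with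
  | _ d ih =>
    by_cases hk : k = r F
    · exact ⟨F, le_rfl, hFG, hk.symm⟩
    by_cases hk' : k = r G
    · exact ⟨G, hFG, le_rfl, hk'.symm⟩
    have hlt : F < G := hFG.lt_of_ne fun e => by subst e; omega
    obtain ⟨H, hFH, hHG⟩ := h.dense F G hlt (by omega)
    have e1 := h.mono hFH
    have e2 := h.mono hHG
    rcases le_total k (r H) with hkH | hkH
    · obtain ⟨H', a, b, c⟩ := ih (r H - r F) (by omega) hFH.le h1 hkH rfl
      exact ⟨H', a, b.trans hHG.le, c⟩
    · obtain ⟨H', a, b, c⟩ := ih (r G - r H) (by omega) hHG.le hkH h2 rfl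
      exact ⟨H', hFH.le.trans a, b, c⟩

/-- Strict monotonicity bounds the height from above, the absence of gaps from below. Hence any
convenient `r` with these properties agrees with the rank used in the definition of a polytope. -/
theorem height_eq (F : P) : Order.height F = r F := by
  apply le_antisymm
  · have := Order.height_le_height_apply_of_strictMono r h.mono F
    simpa using this
  · induction hk : r F generalizing F with
    | zero => simp
    | succ k ih =>
      obtain ⟨b, hb, hb0⟩ := h.exists_bot
      obtain ⟨H, -, hHF, hHk⟩ := h.exists_between_rank (hb F) (k := k) (by omega) (by omega)
      have hlt : H < F := hHF.lt_of_ne fun e => by subst e; omega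
      have := Order.height_add_one_le hlt
      refine le_trans ?_ this
      push_cast
      gcongr
      exact ih H hHk

theorem faceRank_eq (F : P) : faceRank F = (r F : ℤ) - 1 := by
  simp [faceRank, h.height_eq F]

/-- If rank `k` were missed, two faces of the flag around it could be chosen with no face of the
flag between them. A face supplied by `dense` in that gap is comparable to the whole flag, against
maximality. -/
theorem exists_mem_flag (Φ : Flag P) {k : ℕ} (hk : k ≤ N) : ∃ F ∈ Φ, r F = k := by
  by_contra hcon
  push Not at hcon
  obtain ⟨b, hb, hb0⟩ := h.exists_bot
  obtain ⟨t, ht, htN⟩ := h.exists_top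
  have hbΦ : b ∈ Φ := mem_flag_of_isBot hb Φ
  have htΦ : t ∈ Φ := mem_flag_of_isTop ht Φ
  have key : ∀ d : ℕ, ∀ F ∈ Φ, ∀ G ∈ Φ, r F < k → k < r G → r G - r F ≤ d → False := by
    intro d
    induction d with
    | zero => intro F _ G _ h1 h2 h3; omega
    | succ d ih =>
      intro F hF G hG h1 h2 h3
      have hFG : F < G := flag_lt_of_rank_lt h.mono hF hG (by omega)
      by_cases hE : ∃ E ∈ Φ, r F < r E ∧ r E < r G
      · obtain ⟨E, hE, e1, e2⟩ := hE
        rcases lt_trichotomy (r E) k with h' | h' | h'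
        · exact ih E hE G hG h' h2 (by omega)
        · exact hcon E hE h'
        · exact ih F hF E hE h1 h' (by omega)
      · push Not at hE
        obtain ⟨H, hFH, hHG⟩ := h.dense F G hFG (by omega)
        have hH : H ∈ Φ := Flag.mem_iff_forall_le_or_ge.2 fun c hc => by
          rcases le_or_gt (r c) (r F) with h' | h'
          · exact Or.inr ((flag_le_of_rank_le h.mono hc hF h').trans hFH.le)
          · exact Or.inl (hHG.le.trans (flag_le_of_rank_le h.mono hG hc (hE c hc h')))
        have := hE H hH (h.mono hFH)
        have := h.mono hHG
        omega
  refine key N b hbΦ t htΦ ?_ ?_ (by omega)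
  · have := hcon b hbΦ; omega
  · have := hcon t htΦ; omega

theorem flag_encard (Φ : Flag P) : (Φ : Set P).encard = N + 1 := by
  have hinj : Set.InjOn r (Φ : Set P) := fun F hF G hG e => flag_eq_of_rank_eq h.mono hF hG e
  have himg : r '' (Φ : Set P) = Set.Iio (N + 1) := by
    ext k
    constructor
    · rintro ⟨F, _, rfl⟩
      exact Nat.lt_succ_of_le (h.rank_le F)
    · intro hk
      obtain ⟨F, hF, e⟩ := h.exists_mem_flag Φ (Nat.lt_succ_iff.1 hk)
      exact ⟨F, hF, e⟩
  rw [← hinj.encard_image, himg, Set.encard_eq_coe_toFinset_card]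
  simp

theorem isMaxChain {c : Set P} (hc : IsChain (· ≤ ·) c) (hk : ∀ k ≤ N, ∃ F ∈ c, r F = k) :
    IsMaxChain (· ≤ ·) c := by
  refine ⟨hc, fun t ht hct => hct.antisymm fun F hF => ?_⟩
  obtain ⟨G, hG, e⟩ := hk (r F) (h.rank_le F)
  have : F = G := by
    rcases ht.total hF (hct hG) with h' | h'
    · rcases h'.eq_or_lt with h'' | h''
      · exact h''
      · have := h.mono h''; omega
    · rcases h'.eq_or_lt with h'' | h''
      · exact h''.symm
      · have := h.mono h''; omega
  exact this ▸ hG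

/-- Replacing one face of a flag. -/
theorem exists_exchange {Φ : Flag P} {F H G H' : P} (hF : F ∈ Φ) (hH : H ∈ Φ) (hG : G ∈ Φ)
    (hFH' : F < H') (hH'G : H' < G) (hrF : r H = r F + 1) (hrG : r G = r H + 1) :
    ∃ Φ' : Flag P, (Φ' : Set P) = insert H' ((Φ : Set P) \ {H}) := by
  have hH'r : r H' = r H := by have := h.mono hFH'; have := h.mono hH'G; omega
  have hcomp : ∀ E ∈ (Φ : Set P) \ {H}, E ≤ H' ∨ H' ≤ E := by
    rintro E ⟨hE, hEH⟩
    have : r E ≠ r H := fun e => hEH (flag_eq_of_rank_eq h.mono hE hH e)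
    rcases lt_or_gt_of_ne this with h' | h'
    · exact Or.inl ((flag_le_of_rank_le h.mono hE hF (by omega)).trans hFH'.le)
    · exact Or.inr (hH'G.le.trans (flag_le_of_rank_le h.mono hG hE (by omega)))
  have hc : IsChain (· ≤ ·) (insert H' ((Φ : Set P) \ {H})) :=
    (Φ.chain_le.mono Set.sdiff_subset).insert fun E hE _ => (hcomp E hE).symm
  refine ⟨Flag.ofIsMaxChain _ (h.isMaxChain hc fun k hk => ?_), rfl⟩
  by_cases e : k = r H
  · exact ⟨H', Set.mem_insert _ _, by omega⟩
  · obtain ⟨E, hE, hEk⟩ := h.exists_mem_flag Φ hk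
    exact ⟨E, Set.mem_insert_of_mem _ ⟨hE, fun e' => e (by rw [← hEk, e'])⟩, hEk⟩

theorem adjacent_exchange {Φ Φ' : Flag P} {H H' : P} (hH : H ∈ Φ) (hne : H' ≠ H)
    (hr : r H' = r H) (he : (Φ' : Set P) = insert H' ((Φ : Set P) \ {H})) : Adjacent Φ Φ' := by
  have hH' : H' ∉ (Φ : Set P) := fun hm => hne (flag_eq_of_rank_eq h.mono hm hH hr)
  have e1 : (Φ : Set P) \ Φ' = {H} := by
    rw [he]; ext E
    simp only [Set.mem_sdiff, Set.mem_insert_iff, Set.mem_singleton_iff]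
    constructor
    · rintro ⟨a, b⟩; by_contra hc; exact b (Or.inr ⟨a, hc⟩)
    · rintro rfl; exact ⟨hH, by rintro (h | h); exacts [hne h.symm, h.2 rfl]⟩
  have e2 : (Φ' : Set P) \ Φ = {H'} := by
    rw [he]; ext E
    simp only [Set.mem_sdiff, Set.mem_insert_iff, Set.mem_singleton_iff]
    constructor
    · rintro ⟨a | a, b⟩; exacts [a, absurd a.1 b]
    · rintro rfl; exact ⟨Or.inl rfl, hH'⟩
  exact ⟨by rw [e1, Set.encard_singleton], by rw [e2, Set.encard_singleton]⟩

theorem flag_finite (Φ : Flag P) : (Φ : Set P).Finite := by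
  rw [← Set.encard_lt_top_iff, h.flag_encard]
  exact_mod_cast ENat.natCast_lt_top (N + 1)

theorem flag_ncard (Φ : Flag P) : (Φ : Set P).ncard = N + 1 := by
  have := h.flag_encard Φ
  rw [← (h.flag_finite Φ).cast_ncard_eq] at this
  exact_mod_cast this

/-- Induction on `k`, which bounds the number of faces of a flag outside `J`. Two flags with a
common face outside `J` are joined by the induction hypothesis for the enlarged `J`, so it suffices
to pass through flags that successively share such faces. -/
theorem flagConnected_of_subset (hs : SectionConnected r) (k : ℕ) :
    ∀ (Φ Ψ : Flag P) (J : Set P), J ⊆ (Φ : Set P) → J ⊆ (Ψ : Set P) → N + 1 ≤ J.ncard + k →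
      FlagConnected J Φ Ψ := by
  induction k with
  | zero =>
    intro Φ Ψ J h1 h2 h3
    have e1 := Set.eq_of_subset_of_ncard_le h1 (by rw [h.flag_ncard]; omega) (h.flag_finite Φ)
    have e2 := Set.eq_of_subset_of_ncard_le h2 (by rw [h.flag_ncard]; omega) (h.flag_finite Ψ)
    have : Φ = Ψ := Flag.ext (e1.symm.trans e2)
    subst this
    exact Relation.ReflTransGen.refl
  | succ k ih =>
    intro Φ Ψ J h1 h2 h3
    have hJfin : J.Finite := (h.flag_finite Φ).subset h1
    have ih' : ∀ (Φ Ψ : Flag P) (E : P), E ∉ J → E ∈ Φ → E ∈ Ψ → J ⊆ (Φ : Set P) →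
        J ⊆ (Ψ : Set P) → FlagConnected J Φ Ψ := by
      intro Φ Ψ E hE hEΦ hEΨ h1 h2
      refine FlagConnected.mono (Set.subset_insert E J) (ih Φ Ψ (insert E J)
        (Set.insert_subset hEΦ h1) (Set.insert_subset hEΨ h2) ?_)
      rw [Set.ncard_insert_of_notMem hE hJfin]; omega
    by_cases hJ : ∃ E, E ∈ Φ ∧ E ∈ Ψ ∧ E ∉ J
    · obtain ⟨E, a, b, c⟩ := hJ
      exact ih' Φ Ψ E c a b h1 h2
    push Not at hJ
    by_cases hΦΨ : (Φ : Set P) ⊆ Ψ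
    · have : Φ = Ψ := Flag.ext (Φ.max_chain' Ψ.chain_le hΦΨ)
      subst this
      exact Relation.ReflTransGen.refl
    obtain ⟨H, hHΦ, hHΨ⟩ := Set.not_subset.1 hΦΨ
    have hrJ : ∀ E ∈ J, r E ≠ r H := fun E hE e =>
      hHΨ (flag_eq_of_rank_eq h.mono (h1 hE) hHΦ e ▸ h2 hE)
    obtain ⟨b, hb, hb0⟩ := h.exists_bot
    obtain ⟨t, ht, htN⟩ := h.exists_top
    have hbJ : b ∈ J := hJ b (mem_flag_of_isBot hb Φ) (mem_flag_of_isBot hb Ψ)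
    have htJ : t ∈ J := hJ t (mem_flag_of_isTop ht Φ) (mem_flag_of_isTop ht Ψ)
    -- `F` and `G` are the faces of `J` next below and next above `H`, so every face strictly
    -- between them is compatible with all of `J`.
    obtain ⟨F, ⟨hFJ, hFH⟩, hFmax⟩ := Set.exists_max_image {E | E ∈ J ∧ r E < r H} r
      (hJfin.subset fun _ hE => hE.1) ⟨b, hbJ, by have := hrJ b hbJ; omega⟩
    obtain ⟨G, ⟨hGJ, hHG⟩, hGmin⟩ := Set.exists_min_image {E | E ∈ J ∧ r H < r E} r
      (hJfin.subset fun _ hE => hE.1)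
      ⟨t, htJ, by have := hrJ t htJ; have := h.rank_le H; change r H < r t; omega⟩
    have hgap : ∀ E ∈ J, E ≤ F ∨ G ≤ E := by
      intro E hE
      rcases lt_or_gt_of_ne (hrJ E hE) with h' | h'
      · exact Or.inl (flag_le_of_rank_le h.mono (h1 hE) (h1 hFJ) (hFmax E ⟨hE, h'⟩))
      · exact Or.inr (flag_le_of_rank_le h.mono (h1 hGJ) (h1 hE) (hGmin E ⟨hE, h'⟩))
    obtain ⟨H', hH'Ψ, hH'r⟩ := h.exists_mem_flag Ψ (h.rank_le H)
    have aFH := flag_lt_of_rank_lt h.mono (h1 hFJ) hHΦ hFH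
    have aHG := flag_lt_of_rank_lt h.mono hHΦ (h1 hGJ) hHG
    have aFH' := flag_lt_of_rank_lt h.mono (h2 hFJ) hH'Ψ (by omega)
    have aH'G := flag_lt_of_rank_lt h.mono hH'Ψ (h2 hGJ) (by omega)
    have hnotJ : ∀ X, F < X → X < G → X ∉ J := by
      intro X hX1 hX2 hX
      rcases hgap X hX with h' | h'
      · exact absurd hX1 h'.not_gt
      · exact absurd hX2 h'.not_gt
    -- When only one rank is free between `F` and `G`, exchanging `H` for `H'` is a single
    -- adjacency, and the new flag shares `H'` with `Ψ`.
    by_cases hgapr : r G ≤ r F + 2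
    · obtain ⟨Φ', hΦ'⟩ := h.exists_exchange (h1 hFJ) hHΦ (h1 hGJ) aFH' aH'G (by omega) (by omega)
      have hne : H' ≠ H := fun e => hHΨ (e ▸ hH'Ψ)
      have hadj := h.adjacent_exchange hHΦ hne hH'r hΦ'
      have hJΦ' : J ⊆ (Φ' : Set P) := by
        intro E hE
        rw [hΦ']
        exact Or.inr ⟨h1 hE, fun e => hrJ E hE (by rw [e])⟩
      refine Relation.ReflTransGen.head ⟨hadj, hJΦ'⟩ (ih' Φ' Ψ H' (hnotJ H' aFH' aH'G) ?_ hH'Ψ hJΦ' h2)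
      rw [← SetLike.mem_coe, hΦ']
      exact Set.mem_insert _ _
    · have hconn := hs F G (aFH.trans aHG) (by omega) H H' aFH aHG aFH' aH'G
      -- Otherwise a path of incident faces leads from `H` to `H'`. Consecutive faces `X`, `Y` of it
      -- form a chain with `J`, and a flag `Θ` through this chain links the flags through `X` to
      -- those through `Y`.
      have key : ∀ X, Relation.ReflTransGen (IncidentIn F G) H X → F < X ∧ X < G ∧
          ∀ Ξ : Flag P, X ∈ Ξ → J ⊆ (Ξ : Set P) → FlagConnected J Φ Ξ := by
        intro X hX
        induction hX with
        | refl => exact ⟨aFH, aHG, fun Ξ hΞ hJΞ => ih' Φ Ξ H (hnotJ H aFH aHG) hHΦ hΞ h1 hJΞ⟩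
        | @tail X Y _ hXY hX =>
          obtain ⟨hX1, hX2, hX⟩ := hX
          obtain ⟨hcomp, hY1, hY2⟩ := hXY
          refine ⟨hY1, hY2, fun Ξ hΞ hJΞ => ?_⟩
          have hc : IsChain (· ≤ ·) (insert X (insert Y J)) := by
            refine IsChain.insert (IsChain.insert (Φ.chain_le.mono h1) ?_) ?_
            · intro E hE _
              rcases hgap E hE with h' | h'
              · exact Or.inr (h'.trans hY1.le)
              · exact Or.inl (hY2.le.trans h')
            · rintro E (rfl | hE) _
              · exact hcomp
              · rcases hgap E hE with h' | h'
                · exact Or.inr (h'.trans hX1.le)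
                · exact Or.inl (hX2.le.trans h')
          obtain ⟨Θ, hΘ⟩ := hc.exists_subset_flag
          have hJΘ : J ⊆ (Θ : Set P) := fun E hE => hΘ (Or.inr (Or.inr hE))
          exact (hX Θ (hΘ (Or.inl rfl)) hJΘ).trans
            (ih' Θ Ξ Y (hnotJ Y hY1 hY2) (hΘ (Or.inr (Or.inl rfl))) hΞ hJΘ hJΞ)
      exact (key H' hconn).2.2 Ψ hH'Ψ h2

theorem flagConnected (hs : SectionConnected r) (Φ Ψ : Flag P) :
    FlagConnected ((Φ : Set P) ∩ Ψ) Φ Ψ :=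
  h.flagConnected_of_subset hs (N + 1) Φ Ψ _ Set.inter_subset_left Set.inter_subset_right
    (by omega)

end Ranked

/-- A poset with a rank function is a polytope if it is thin and its sections are connected. -/
theorem Ranked.isPolytope {n : ℕ} (h : Ranked r (n + 1)) (ht : Thin r) (hs : SectionConnected r) :
    IsPolytope P n where
  exists_least := h.exists_bot.imp fun _ h => h.1
  exists_greatest := h.exists_top.imp fun _ h => h.1
  rank_strictMono := fun F G hFG => by
    have := h.mono hFG
    rw [h.faceRank_eq, h.faceRank_eq]; omega
  rank_range := by
    ext k
    constructor
    · rintro ⟨F, rfl⟩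
      have := h.rank_le F
      rw [h.faceRank_eq, Set.mem_Icc]
      omega
    · rintro ⟨h1, h2⟩
      obtain ⟨b, hb, hb0⟩ := h.exists_bot
      obtain ⟨t, ht, htN⟩ := h.exists_top
      obtain ⟨H, -, -, hH⟩ := h.exists_between_rank (hb t) (k := (k + 1).toNat) (by omega)
        (by omega)
      exact ⟨H, by rw [h.faceRank_eq]; omega⟩
  flag_encard := fun Φ => by
    rw [h.flag_encard Φ]; push_cast; rw [add_assoc]; norm_num
  stronglyFlagConnected := fun Φ Ψ => h.flagConnected hs Φ Ψ
  diamond := fun j F G hFG hF hG => by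
    rw [h.faceRank_eq] at hF hG
    rw [← ht F G (hFG.lt_of_ne fun e => by subst e; omega) (by omega)]
    congr 1
    ext H
    simp only [Set.mem_ofPred_eq, h.faceRank_eq]
    constructor
    · rintro ⟨a, b, c⟩
      exact ⟨a.lt_of_ne fun e => by subst e; omega, b.lt_of_ne fun e => by subst e; omega⟩
    · rintro ⟨a, b⟩
      have := h.mono a
      have := h.mono b
      exact ⟨a.le, b.le, by omega⟩

/-- The rank of a face, normalised such that the least face has rank `0`. -/
noncomputable def rk (F : P) : ℕ := (Order.height F).toNat

theorem faceRank_eq_rk (F : P) : faceRank F = (rk F : ℤ) - 1 := rfl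

theorem mem_face_iff {F : P} {j : ℤ} : F ∈ Face P j ↔ (rk F : ℤ) = j + 1 := by
  change faceRank F = j ↔ _
  rw [faceRank_eq_rk]
  omega

theorem Ranked.rk_eq (h : Ranked r N) (F : P) : rk F = r F := by
  simp [rk, h.height_eq F]

theorem rk_map {Q : Type v} [PartialOrder Q] (g : P ≃o Q) (F : P) : rk (g F) = rk F := by
  simp [rk, Order.height_orderIso]

namespace IsPolytope

variable {n : ℕ} (h : IsPolytope P n)
include h

theorem rk_strictMono : StrictMono (rk : P → ℕ) := fun F G hFG => by
  have := h.rank_strictMono hFG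
  rw [faceRank_eq_rk, faceRank_eq_rk] at this
  omega

theorem rk_le (F : P) : rk F ≤ n + 1 := by
  have : faceRank F ∈ Set.range (faceRank : P → ℤ) := ⟨F, rfl⟩
  rw [h.rank_range, faceRank_eq_rk, Set.mem_Icc] at this
  omega

/-- For `dense`: the `n + 2` faces of a flag have distinct ranks among `0, ..., n + 1`, so every
rank occurs in every flag. -/
theorem ranked : Ranked (rk : P → ℕ) (n + 1) where
  exists_bot := by
    obtain ⟨b, hb⟩ := h.exists_least
    refine ⟨b, hb, ?_⟩
    have : (-1 : ℤ) ∈ Set.range (faceRank : P → ℤ) := by rw [h.rank_range, Set.mem_Icc]; omega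
    obtain ⟨F, hF⟩ := this
    rw [faceRank_eq_rk] at hF
    have := h.rk_strictMono.monotone (hb F)
    omega
  exists_top := by
    obtain ⟨b, hb⟩ := h.exists_greatest
    refine ⟨b, hb, ?_⟩
    have : (n : ℤ) ∈ Set.range (faceRank : P → ℤ) := by rw [h.rank_range, Set.mem_Icc]; omega
    obtain ⟨F, hF⟩ := this
    rw [faceRank_eq_rk] at hF
    have := h.rk_strictMono.monotone (hb F)
    have := h.rk_le b
    omega
  mono := h.rk_strictMono
  dense := fun F G hFG hr => by
    obtain ⟨Φ, hF, hG⟩ := Flag.exists_mem_mem hFG.le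
    have hinj : Set.InjOn rk (Φ : Set P) :=
      fun F hF G hG e => flag_eq_of_rank_eq h.rk_strictMono hF hG e
    have hsub : rk '' (Φ : Set P) ⊆ Set.Iio (n + 2) := by
      rintro _ ⟨F, -, rfl⟩
      exact Nat.lt_succ_of_le (h.rk_le F)
    have hcard : (rk '' (Φ : Set P)).encard = n + 2 := by rw [hinj.encard_image, h.flag_encard]
    have hIio : (Set.Iio (n + 2)).encard = n + 2 := by
      rw [Set.encard_eq_coe_toFinset_card]; simp
    have heq := (Set.Finite.subset (Set.finite_Iio (n + 2)) hsub).eq_of_subset_of_encard_le hsub (by rw [hcard, hIio])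
    have : rk F + 1 ∈ rk '' (Φ : Set P) := by
      rw [heq]
      have := h.rk_le G
      simp only [Set.mem_Iio]
      omega
    obtain ⟨H, hH, e⟩ := this
    exact ⟨H, flag_lt_of_rank_lt h.rk_strictMono hF hH (by omega),
      flag_lt_of_rank_lt h.rk_strictMono hH hG (by omega)⟩

theorem thin : Thin (rk : P → ℕ) := fun F G hFG hr => by
  rw [← h.diamond (rk F) F G hFG.le (by rw [faceRank_eq_rk]) (by rw [faceRank_eq_rk]; omega)]
  congr 1
  ext H
  simp only [Set.mem_ofPred_eq, faceRank_eq_rk]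
  constructor
  · rintro ⟨a, b⟩
    have := h.rk_strictMono a
    have := h.rk_strictMono b
    exact ⟨a.le, b.le, by omega⟩
  · rintro ⟨a, b, c⟩
    exact ⟨a.lt_of_ne fun e => by subst e; omega, b.lt_of_ne fun e => by subst e; omega⟩

theorem flagConnected (Φ Ψ : Flag P) : FlagConnected ((Φ : Set P) ∩ Ψ) Φ Ψ :=
  h.stronglyFlagConnected Φ Ψ

omit h in
theorem _root_.AbstractPolytope.Adjacent.exists_eq {Φ Ψ : Flag P} (ha : Adjacent Φ Ψ) :
    ∃ A, (Φ : Set P) \ Ψ = {A} := Set.encard_eq_one.1 ha.1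

/-- Follow a sequence of adjacent flags through `F` and `G`. Each has at least two faces strictly
between `F` and `G`, and a step changes only one face, so consecutive flags share a face of the open
interval. -/
theorem sectionConnected : SectionConnected (rk : P → ℕ) := by
  intro F G hFG hr A B hFA hAG hFB hBG
  have flag3 : ∀ X, F < X → X < G → ∃ Φ : Flag P, F ∈ Φ ∧ X ∈ Φ ∧ G ∈ Φ := by
    intro X h1 h2
    have hc : IsChain (· ≤ ·) ({F, X, G} : Set P) := by
      refine (IsChain.pair h2.le).insert ?_
      rintro E (rfl | rfl) _
      · exact Or.inl h1.le
      · exact Or.inl hFG.le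
    obtain ⟨Φ, hΦ⟩ := hc.exists_subset_flag
    exact ⟨Φ, hΦ (by simp), hΦ (by simp), hΦ (by simp)⟩
  obtain ⟨Φ, hΦF, hΦA, hΦG⟩ := flag3 A hFA hAG
  obtain ⟨Ψ, hΨF, hΨB, hΨG⟩ := flag3 B hFB hBG
  have hconn := (h.flagConnected Φ Ψ).mono (K := {F, G}) (by
    rintro E (rfl | rfl)
    · exact ⟨hΦF, hΨF⟩
    · exact ⟨hΦG, hΨG⟩)
  have key : ∀ Ξ : Flag P, FlagConnected {F, G} Φ Ξ → F ∈ Ξ ∧ G ∈ Ξ ∧ ∀ X ∈ Ξ, F < X → X < G →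
      Relation.ReflTransGen (IncidentIn F G) A X := by
    intro Ξ hΞ
    induction hΞ with
    | refl =>
      exact ⟨hΦF, hΦG, fun X hX h1 h2 =>
        Relation.ReflTransGen.single ⟨Φ.le_or_le hΦA hX, h1, h2⟩⟩
    | @tail Ξ Θ _ hs ih =>
      obtain ⟨hΞF, hΞG, ih⟩ := ih
      obtain ⟨hadj, hsub⟩ := hs
      have hΘF : F ∈ Θ := hsub (Or.inl rfl)
      have hΘG : G ∈ Θ := hsub (Or.inr rfl)
      refine ⟨hΘF, hΘG, fun X hX h1 h2 => ?_⟩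
      obtain ⟨C, hC⟩ := hadj.exists_eq
      obtain ⟨Y, hY, hYr⟩ := h.ranked.exists_mem_flag Ξ (k := rk F + 1)
        (by have := h.rk_le G; omega)
      obtain ⟨Z, hZ, hZr⟩ := h.ranked.exists_mem_flag Ξ (k := rk F + 2)
        (by have := h.rk_le G; omega)
      have hW : ∃ W, W ∈ Ξ ∧ W ∈ Θ ∧ F < W ∧ W < G := by
        have lt1 := fun X hX => flag_lt_of_rank_lt h.rk_strictMono (Φ := Ξ) (F := F) (G := X) hΞF hX
        have lt2 := fun X hX => flag_lt_of_rank_lt h.rk_strictMono (Φ := Ξ) (F := X) (G := G) hX hΞG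
        by_cases hYΘ : Y ∈ Θ
        · exact ⟨Y, hY, hYΘ, lt1 Y hY (by omega), lt2 Y hY (by omega)⟩
        · refine ⟨Z, hZ, ?_, lt1 Z hZ (by omega), lt2 Z hZ (by omega)⟩
          by_contra hZΘ
          have e1 : Y ∈ ({C} : Set P) := hC ▸ ⟨hY, hYΘ⟩
          have e2 : Z ∈ ({C} : Set P) := hC ▸ ⟨hZ, hZΘ⟩
          have : Y = Z := e1.trans e2.symm
          subst this
          omega
      obtain ⟨W, hW1, hW2, hW3, hW4⟩ := hW
      exact (ih W hW1 hW3 hW4).tail ⟨Θ.le_or_le hW2 hX, h1, h2⟩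
  exact (key Ψ hconn).2.2 B hΨB hFB hBG

end IsPolytope
end
end AbstractPolytope

/-! ### Rigidity and regularity of polytopes -/

namespace AbstractPolytope

section

variable {P : Type u} [PartialOrder P] {r : P → ℕ} {N : ℕ}

theorem Thin.eq_or_eq (ht : Thin r) {F G A B C : P} (hr : r G = r F + 2) (hFA : F < A) (hAG : A < G)
    (hFB : F < B) (hBG : B < G) (hFC : F < C) (hCG : C < G) (hAB : A ≠ B) : C = A ∨ C = B := by
  obtain ⟨x, y, -, hxy⟩ := Set.encard_eq_two.1 (ht F G (hFA.trans hAG) hr)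
  have e : ∀ Z, F < Z → Z < G → Z = x ∨ Z = y := fun Z h1 h2 => by
    have : Z ∈ {H : P | F < H ∧ H < G} := ⟨h1, h2⟩
    rwa [hxy] at this
  rcases e A hFA hAG with rfl | rfl <;> rcases e B hFB hBG with rfl | rfl <;>
    rcases e C hFC hCG with rfl | rfl <;> simp_all

/-- The improper faces lie in all flags, so the differing faces `A` and `B` are proper; their
neighbours `F` and `G` in the flag are common to both flags and span a diamond with middle faces `A`
and `B`. -/
theorem Ranked.adjacent_data (h : Ranked r N) {Φ Ψ : Flag P} (ha : Adjacent Φ Ψ) :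
    ∃ A B F G, A ∈ Φ ∧ B ∈ Ψ ∧ A ≠ B ∧ A ∉ Ψ ∧ B ∉ Φ ∧ r A = r B ∧
      (∀ E ∈ Φ, E ≠ A → E ∈ Ψ) ∧ (∀ E ∈ Ψ, E ≠ B → E ∈ Φ) ∧
      F ∈ Φ ∧ F ∈ Ψ ∧ G ∈ Φ ∧ G ∈ Ψ ∧ r A = r F + 1 ∧ r G = r A + 1 ∧
      F < A ∧ A < G ∧ F < B ∧ B < G := by
  obtain ⟨A, hA⟩ := Set.encard_eq_one.1 ha.1
  obtain ⟨B, hB⟩ := Set.encard_eq_one.1 ha.2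
  have mA : ∀ E, E ∈ Φ ∧ E ∉ Ψ ↔ E = A := fun E => by
    have : E ∈ (Φ : Set P) \ Ψ ↔ E ∈ ({A} : Set P) := by rw [hA]
    exact this
  have mB : ∀ E, E ∈ Ψ ∧ E ∉ Φ ↔ E = B := fun E => by
    have : E ∈ (Ψ : Set P) \ Φ ↔ E ∈ ({B} : Set P) := by rw [hB]
    exact this
  obtain ⟨hAΦ, hAΨ⟩ := (mA A).2 rfl
  obtain ⟨hBΨ, hBΦ⟩ := (mB B).2 rfl
  have cΦ : ∀ E ∈ Φ, E ≠ A → E ∈ Ψ := fun E hE hne => by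
    by_contra hc; exact hne ((mA E).1 ⟨hE, hc⟩)
  have cΨ : ∀ E ∈ Ψ, E ≠ B → E ∈ Φ := fun E hE hne => by
    by_contra hc; exact hne ((mB E).1 ⟨hE, hc⟩)
  obtain ⟨b, hb, hb0⟩ := h.exists_bot
  obtain ⟨t, htt, htN⟩ := h.exists_top
  have hrAB : r A = r B := by
    obtain ⟨E, hE, hEr⟩ := h.exists_mem_flag Ψ (h.rank_le A)
    by_cases hEΦ : E ∈ Φ
    · exact absurd (flag_eq_of_rank_eq h.mono hEΦ hAΦ hEr ▸ hE) hAΨ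
    · rw [← (mB E).1 ⟨hE, hEΦ⟩, hEr]
  have hA0 : r A ≠ 0 := fun e => hAΨ (mem_flag_of_isBot (h.isBot_of_rank e) Ψ)
  have hAN : r A ≠ N := fun e => hAΨ (mem_flag_of_isTop (h.isTop_of_rank e) Ψ)
  have := h.rank_le A
  obtain ⟨F, hF, hFr⟩ := h.exists_mem_flag Φ (k := r A - 1) (by omega)
  obtain ⟨G, hG, hGr⟩ := h.exists_mem_flag Φ (k := r A + 1) (by omega)
  have hFΨ := cΦ F hF (by rintro rfl; omega)
  have hGΨ := cΦ G hG (by rintro rfl; omega)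
  exact ⟨A, B, F, G, hAΦ, hBΨ, fun e => hAΨ (e ▸ hBΨ), hAΨ, hBΦ, hrAB, cΦ, cΨ, hF, hFΨ, hG, hGΨ,
    by omega, hGr, flag_lt_of_rank_lt h.mono hF hAΦ (by omega),
    flag_lt_of_rank_lt h.mono hAΦ hG (by omega), flag_lt_of_rank_lt h.mono hFΨ hBΨ (by omega),
    flag_lt_of_rank_lt h.mono hBΨ hGΨ (by omega)⟩

/-- An automorphism of a polytope that fixes all faces of a flag is the identity. -/
theorem IsPolytope.eq_refl_of_fixes_flag {n : ℕ} (h : IsPolytope P n) (g : P ≃o P) (Φ : Flag P)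
    (hg : ∀ F ∈ Φ, g F = F) : g = OrderIso.refl P := by
  have key : ∀ Ψ : Flag P, FlagConnected ∅ Φ Ψ → ∀ F ∈ Ψ, g F = F := by
    intro Ψ hΨ
    induction hΨ with
    | refl => exact hg
    | @tail Ψ Ξ _ hs ih =>
      obtain ⟨A, B, F, G, hA, hB, hAB, -, -, hr, -, hΞ, hF, -, hG, -, hrF, hrG, h1, h2, h3, h4⟩ :=
        h.ranked.adjacent_data hs.1
      intro E hE
      by_cases hEB : E = B
      · subst hEB
        -- The image of the new face stays in the diamond between `F` and `G`, whose other middle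
        -- face `A` is already an image.
        have i1 : F < g E := by rw [← ih F hF]; exact g.lt_iff_lt.2 h3
        have i2 : g E < G := by rw [← ih G hG]; exact g.lt_iff_lt.2 h4
        rcases h.thin.eq_or_eq (by omega) h1 h2 h3 h4 i1 i2 hAB with e | e
        · rw [← ih A hA] at e
          exact absurd (g.injective e).symm hAB
        · exact e
      · exact ih E (hΞ E hE hEB)
  ext F
  obtain ⟨Ψ, hΨ⟩ := Flag.exists_mem F
  exact key Ψ ((h.flagConnected Φ Ψ).mono (Set.empty_subset _)) F hΨ

/-- If every flag can be moved to each adjacent one by an automorphism, then the polytope is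
regular. -/
theorem IsPolytope.isRegular_of_adjacent {n : ℕ} (h : IsPolytope P n)
    (hadj : ∀ Φ Ψ : Flag P, Adjacent Φ Ψ → ∃ g : P ≃o P, Flag.map g Φ = Ψ) : IsRegular P := by
  intro Φ Ψ
  have hc : FlagConnected ∅ Φ Ψ := (h.flagConnected Φ Ψ).mono (Set.empty_subset _)
  induction hc with
  | refl => exact ⟨OrderIso.refl P, Flag.ext (by simp)⟩
  | tail _ hs ih =>
    obtain ⟨g, hg⟩ := ih
    obtain ⟨k, hk⟩ := hadj _ _ hs.1
    refine ⟨g.trans k, ?_⟩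
    rw [← hk, ← hg]
    apply Flag.ext
    simp [Set.image_image]

/-- The section between a face and the least face of a polytope is a polytope. -/
theorem IsPolytope.section_Iic {n k : ℕ} (h : IsPolytope P n) {T : P} (hT : rk T = k + 1) :
    Ranked (fun F : Set.Iic T => rk F.1) (k + 1) ∧ IsPolytope (Set.Iic T) k := by
  have hR : Ranked (fun F : Set.Iic T => rk F.1) (k + 1) := by
    refine ⟨?_, ⟨⟨T, le_rfl⟩, fun F => F.2, hT⟩, fun F G hFG => h.rk_strictMono hFG, ?_⟩
    · obtain ⟨b, hb, hb0⟩ := h.ranked.exists_bot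
      exact ⟨⟨b, hb T⟩, fun F => hb F.1, hb0⟩
    · intro F G hFG hr
      obtain ⟨H, h1, h2⟩ := h.ranked.dense F.1 G.1 hFG hr
      exact ⟨⟨H, h2.le.trans G.2⟩, h1, h2⟩
  refine ⟨hR, hR.isPolytope ?_ ?_⟩
  · intro F G hFG hr
    rw [← h.thin F.1 G.1 hFG hr, ← Subtype.val_injective.encard_image]
    congr 1
    ext H
    constructor
    · rintro ⟨H, hH, rfl⟩
      exact hH
    · intro hH
      exact ⟨⟨H, hH.2.le.trans G.2⟩, hH, rfl⟩
  · intro F G hFG hr A B hFA hAG hFB hBG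
    have := h.sectionConnected F.1 G.1 hFG hr A.1 B.1 hFA hAG hFB hBG
    have key : ∀ X, Relation.ReflTransGen (IncidentIn F.1 G.1) A.1 X → ∀ hX : X ≤ T,
        Relation.ReflTransGen (IncidentIn F G) A ⟨X, hX⟩ := by
      intro X hX
      induction hX with
      | refl => intro _; exact Relation.ReflTransGen.refl
      | @tail X Y hAX hXY ih =>
        intro hY
        have hXT : X ≤ T := by
          rcases hAX.cases_tail with rfl | ⟨_, _, hX⟩
          · exact A.2
          · exact hX.2.2.le.trans G.2
        exact (ih hXT).tail hXY
    exact key _ this B.2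

end

/-! ### Class systems and their posets of classes -/

/-- For each face of `K` a partition of `X` into classes, which grow with the face; the classes
of a face are spanned by those of its vertices, which have two elements. -/
structure ClassSystem {K : Type u} [PartialOrder K] {X : Type v} (cls : K → X → Set X) : Prop where
  mem_self : ∀ F x, x ∈ cls F x
  eq_of_mem : ∀ F x y, y ∈ cls F x → cls F y = cls F x
  subset_iff : ∀ F G x, cls F x ⊆ cls G x ↔ F ≤ G
  of_isBot : ∀ F x, IsBot F → cls F x = {x}
  of_isTop : ∀ F x, IsTop F → cls F x = Set.univ
  of_vertex : ∀ F x, rk F = 1 → (cls F x).encard = 2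
  path : ∀ F x y, y ∈ cls F x →
    Relation.ReflTransGen (fun a b => ∃ v ≤ F, rk v = 1 ∧ b ∈ cls v a) x y

/-- The classes of a class system together with the empty set, ordered by inclusion. -/
abbrev ClassPoset {K : Type u} {X : Type v} (cls : K → X → Set X) : Type v :=
  {S : Set X // S = ∅ ∨ ∃ (F : K) (x : X), S = cls F x}

namespace ClassPoset

variable {K : Type u} {X : Type v} (cls : K → X → Set X)

/-- The class of a point as an element of the poset of classes. -/
def face (F : K) (x : X) : ClassPoset cls := ⟨cls F x, Or.inr ⟨F, x, rfl⟩⟩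

/-- The empty set as an element of the poset of classes. -/
def emp : ClassPoset cls := ⟨∅, Or.inl rfl⟩

variable {cls}

theorem eq_emp_or (S : ClassPoset cls) : S = emp cls ∨ ∃ F x, S = face cls F x := by
  rcases S with ⟨S, rfl | ⟨F, x, rfl⟩⟩
  · exact Or.inl rfl
  · exact Or.inr ⟨F, x, rfl⟩

theorem emp_le (S : ClassPoset cls) : emp cls ≤ S := Set.empty_subset S.1

end ClassPoset

namespace ClassSystem

open ClassPoset

variable {K : Type u} [PartialOrder K] {X : Type v} {cls : K → X → Set X} (h : ClassSystem cls)
include h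

theorem face_le_iff {F G : K} {x y : X} : face cls F x ≤ face cls G y ↔ F ≤ G ∧ x ∈ cls G y := by
  constructor
  · intro hle
    have hx : x ∈ cls G y := hle (h.mem_self F x)
    refine ⟨(h.subset_iff F G x).1 ?_, hx⟩
    rw [h.eq_of_mem G y x hx]
    exact hle
  · rintro ⟨hFG, hx⟩
    change cls F x ⊆ cls G y
    rw [← h.eq_of_mem G y x hx]
    exact (h.subset_iff F G x).2 hFG

theorem face_eq_face {F : K} {x y : X} (hx : x ∈ cls F y) : face cls F x = face cls F y :=
  Subtype.ext (h.eq_of_mem F y x hx)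

theorem face_eq_iff {F G : K} {x y : X} : face cls F x = face cls G y ↔ F = G ∧ x ∈ cls G y := by
  constructor
  · intro e
    have h1 := h.face_le_iff.1 e.le
    exact ⟨h1.1.antisymm (h.face_le_iff.1 e.ge).1, h1.2⟩
  · rintro ⟨rfl, hx⟩
    exact h.face_eq_face hx

theorem emp_lt_face (F : K) (x : X) : emp cls < face cls F x :=
  (emp_le _).lt_of_ne fun e => by
    have : x ∈ (emp cls).1 := e ▸ h.mem_self F x
    exact this

theorem not_face_le_emp (F : K) (x : X) : ¬ face cls F x ≤ emp cls :=
  (h.emp_lt_face F x).not_ge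

theorem face_lt_iff {F G : K} {x y : X} : face cls F x < face cls G y ↔ F < G ∧ x ∈ cls G y := by
  rw [lt_iff_le_and_ne, lt_iff_le_and_ne, h.face_le_iff, ne_eq, h.face_eq_iff]
  tauto

omit h in
open Classical in
/-- The rank function of the poset of classes. -/
noncomputable def classRank (S : ClassPoset cls) : ℕ :=
  if hS : ∃ F x, S = face cls F x then rk hS.choose + 1 else 0

theorem classRank_face (F : K) (x : X) : classRank (face cls F x) = rk F + 1 := by
  have hS : ∃ G y, face cls F x = face cls G y := ⟨F, x, rfl⟩
  rw [classRank, dif_pos hS]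
  obtain ⟨y, hy⟩ := hS.choose_spec
  rw [← (h.face_eq_iff.1 hy).1]

theorem classRank_emp : classRank (emp cls) = 0 := by
  rw [classRank, dif_neg]
  rintro ⟨F, x, e⟩
  exact (h.emp_lt_face F x).ne e

theorem face_bot {b : K} (hb : IsBot b) (x y : X) : face cls b x = face cls b y ↔ x = y := by
  rw [h.face_eq_iff, h.of_isBot b y hb]
  simp

variable [Nonempty X] {m : ℕ} (hK : IsPolytope K m)
include hK

/-- Ranks are shifted by one against `K`: the empty set takes rank 0 and the classes of the least
face of `K`, which are single points, become the vertices. -/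
theorem ranked : Ranked (classRank (cls := cls)) (m + 2) where
  exists_bot := ⟨emp cls, emp_le, h.classRank_emp⟩
  exists_top := by
    obtain ⟨t, ht, htm⟩ := hK.ranked.exists_top
    obtain ⟨x⟩ := ‹Nonempty X›
    refine ⟨face cls t x, fun S => ?_, by rw [h.classRank_face, htm]⟩
    change S.1 ⊆ cls t x
    rw [h.of_isTop t x ht]
    exact Set.subset_univ _
  mono := fun S T hST => by
    rcases T.eq_emp_or with rfl | ⟨G, y, rfl⟩
    · exact absurd hST (emp_le S).not_gt
    rcases S.eq_emp_or with rfl | ⟨F, x, rfl⟩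
    · rw [h.classRank_emp, h.classRank_face]; omega
    · rw [h.classRank_face, h.classRank_face]
      have := hK.rk_strictMono (h.face_lt_iff.1 hST).1
      omega
  dense := fun S T hST hr => by
    rcases T.eq_emp_or with rfl | ⟨G, y, rfl⟩
    · exact absurd hST (emp_le S).not_gt
    rcases S.eq_emp_or with rfl | ⟨F, x, rfl⟩
    · rw [h.classRank_emp, h.classRank_face] at hr
      obtain ⟨b, hb, hb0⟩ := hK.ranked.exists_bot
      refine ⟨face cls b y, h.emp_lt_face _ _, h.face_lt_iff.2 ⟨(hb G).lt_of_ne ?_, h.mem_self _ _⟩⟩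
      rintro rfl
      omega
    · rw [h.classRank_face, h.classRank_face] at hr
      obtain ⟨hFG, hx⟩ := h.face_lt_iff.1 hST
      obtain ⟨H, h1, h2⟩ := hK.ranked.dense F G hFG (by omega)
      exact ⟨face cls H x, h.face_lt_iff.2 ⟨h1, h.mem_self _ _⟩, h.face_lt_iff.2 ⟨h2, hx⟩⟩

-- Above a nonempty class everything is a copy of a section of `K`, so its diamonds are inherited.
-- Above the empty set, the diamond condition says that the class of a vertex of `K` has two points.
omit [Nonempty X] in
theorem thin : Thin (classRank (cls := cls)) := fun S T hST hr => by
  obtain ⟨b, hb, hb0⟩ := hK.ranked.exists_bot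
  rcases T.eq_emp_or with rfl | ⟨G, y, rfl⟩
  · exact absurd hST (emp_le S).not_gt
  rcases S.eq_emp_or with rfl | ⟨F, x, rfl⟩
  · rw [h.classRank_emp, h.classRank_face] at hr
    have hinj : Function.Injective (face cls b) := fun x y e => (h.face_bot hb x y).1 e
    rw [← h.of_vertex G y (by omega), ← hinj.encard_image]
    congr 1
    ext H
    constructor
    · rintro ⟨h1, h2⟩
      rcases H.eq_emp_or with rfl | ⟨F, x, rfl⟩
      · exact absurd h1 (lt_irrefl _)
      obtain ⟨h3, h4⟩ := h.face_lt_iff.1 h2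
      have := hK.rk_strictMono h3
      have hF : F = b := le_antisymm (hK.ranked.isBot_of_rank (by omega) b) (hb F)
      exact ⟨x, h4, by rw [hF]⟩
    · rintro ⟨x, hx, rfl⟩
      refine ⟨h.emp_lt_face _ _, h.face_lt_iff.2 ⟨(hb G).lt_of_ne ?_, hx⟩⟩
      rintro rfl
      omega
  · rw [h.classRank_face, h.classRank_face] at hr
    obtain ⟨hFG, hx⟩ := h.face_lt_iff.1 hST
    have hinj : Function.Injective (fun H => face cls H x) := fun A B e => (h.face_eq_iff.1 e).1
    rw [← hK.thin F G hFG (by omega), ← hinj.encard_image]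
    congr 1
    ext H
    constructor
    · rintro ⟨h1, h2⟩
      rcases H.eq_emp_or with rfl | ⟨H, z, rfl⟩
      · exact absurd h1 (h.emp_lt_face _ _).not_gt
      obtain ⟨h3, h4⟩ := h.face_lt_iff.1 h1
      exact ⟨H, ⟨h3, (h.face_lt_iff.1 h2).1⟩, h.face_eq_face h4⟩
    · rintro ⟨H, ⟨h1, h2⟩, rfl⟩
      exact ⟨h.face_lt_iff.2 ⟨h1, h.mem_self _ _⟩, h.face_lt_iff.2 ⟨h2, hx⟩⟩

-- Sections over a nonempty class are inherited from `K`. Sections over the empty set are connected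
-- by the condition `path`: each step from `z` to `w` is realised by going from the point `z` up to
-- the class of a vertex of `K` and down to `w`.
omit [Nonempty X] in
theorem sectionConnected : SectionConnected (classRank (cls := cls)) := by
  intro S T hST hr A B hSA hAT hSB hBT
  obtain ⟨b, hb, hb0⟩ := hK.ranked.exists_bot
  rcases T.eq_emp_or with rfl | ⟨G, y, rfl⟩
  · exact absurd hST (emp_le S).not_gt
  rcases A.eq_emp_or with rfl | ⟨FA, xA, rfl⟩
  · exact absurd hSA (emp_le S).not_gt
  rcases B.eq_emp_or with rfl | ⟨FB, xB, rfl⟩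
  · exact absurd hSB (emp_le S).not_gt
  obtain ⟨hFA, hxA⟩ := h.face_lt_iff.1 hAT
  obtain ⟨hFB, hxB⟩ := h.face_lt_iff.1 hBT
  rcases S.eq_emp_or with rfl | ⟨F, x, rfl⟩
  · rw [h.classRank_emp, h.classRank_face] at hr
    have hbG : b < G := (hb G).lt_of_ne (by rintro rfl; omega)
    have hpath : Relation.ReflTransGen (fun a b => ∃ v ≤ G, rk v = 1 ∧ b ∈ cls v a) xA xB := by
      apply h.path
      rw [h.eq_of_mem G y xA hxA]
      exact hxB
    have key : ∀ z, Relation.ReflTransGen (fun a b => ∃ v ≤ G, rk v = 1 ∧ b ∈ cls v a) xA z →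
        z ∈ cls G y ∧ Relation.ReflTransGen (IncidentIn (emp cls) (face cls G y))
          (face cls FA xA) (face cls b z) := by
      intro z hz
      induction hz with
      | refl =>
        exact ⟨hxA, Relation.ReflTransGen.single
          ⟨Or.inr (h.face_le_iff.2 ⟨hb FA, h.mem_self _ _⟩), h.emp_lt_face _ _,
            h.face_lt_iff.2 ⟨hbG, hxA⟩⟩⟩
      | @tail z w _ hzw ih =>
        obtain ⟨v, hvG, hv, hw⟩ := hzw
        have hwG : w ∈ cls G y := by
          rw [← h.eq_of_mem G y z ih.1]
          exact (h.subset_iff v G z).2 hvG hw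
        have hvG' : v < G := hvG.lt_of_ne (by rintro rfl; omega)
        refine ⟨hwG, (ih.2.tail (b := face cls b z) (c := face cls v z) ⟨Or.inl ?_, ?_, ?_⟩).tail
          ⟨Or.inr ?_, h.emp_lt_face _ _, h.face_lt_iff.2 ⟨hbG, hwG⟩⟩⟩
        · exact h.face_le_iff.2 ⟨hb v, h.mem_self _ _⟩
        · exact h.emp_lt_face _ _
        · exact h.face_lt_iff.2 ⟨hvG', ih.1⟩
        · exact h.face_le_iff.2 ⟨hb v, hw⟩
    exact (key xB hpath).2.tail
      ⟨Or.inl (h.face_le_iff.2 ⟨hb FB, h.mem_self _ _⟩), h.emp_lt_face _ _, hBT⟩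
  · rw [h.classRank_face, h.classRank_face] at hr
    obtain ⟨hFG, hx⟩ := h.face_lt_iff.1 hST
    obtain ⟨hFFA, hxFA⟩ := h.face_lt_iff.1 hSA
    obtain ⟨hFFB, hxFB⟩ := h.face_lt_iff.1 hSB
    rw [← h.face_eq_face hxFA, ← h.face_eq_face hxFB]
    refine Relation.ReflTransGen.lift (fun H => face cls H x) ?_
      _ _ (hK.sectionConnected F G hFG (by omega) FA FB hFFA hFA hFFB hFB)
    rintro H H' ⟨hc, h1, h2⟩
    refine ⟨hc.imp (fun hc => h.face_le_iff.2 ⟨hc, h.mem_self _ _⟩)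
      (fun hc => h.face_le_iff.2 ⟨hc, h.mem_self _ _⟩), ?_, ?_⟩
    · exact h.face_lt_iff.2 ⟨h1, h.mem_self _ _⟩
    · exact h.face_lt_iff.2 ⟨h2, hx⟩

theorem isPolytope : IsPolytope (ClassPoset cls) (m + 1) :=
  (h.ranked hK).isPolytope (h.thin hK) (h.sectionConnected hK)

theorem rk_face (F : K) (x : X) : rk (face cls F x) = rk F + 1 := by
  rw [(h.ranked hK).rk_eq, h.classRank_face]

theorem rk_emp : rk (emp cls) = 0 := by
  rw [(h.ranked hK).rk_eq, h.classRank_emp]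

end ClassSystem

end AbstractPolytope

/-! ### The poset `2^K` as a class system -/

namespace AbstractPolytope

open ClassPoset

/-! ### Subsets of a finite set -/

theorem ranked_finset (m : ℕ) : Ranked (Finset.card : Finset (Fin m) → ℕ) m where
  exists_bot := ⟨∅, fun s => Finset.empty_subset s, rfl⟩
  exists_top := ⟨Finset.univ, fun s => Finset.subset_univ s, by simp⟩
  mono := Finset.card_strictMono
  dense := fun s t hst hr => by
    obtain ⟨a, hat, has⟩ := Finset.exists_of_ssubset hst
    have hcard : (insert a s).card = s.card + 1 := Finset.card_insert_of_notMem has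
    refine ⟨insert a s, Finset.ssubset_insert has,
      (Finset.insert_subset hat hst.subset).ssubset_of_ne ?_⟩
    rintro rfl
    omega

section

variable {K : Type u} [PartialOrder K]

/-- The subsets of the vertex-set of `F` are the vertex-sets of the faces below `F`. -/
def HasAllSubfaces (F : K) : Prop :=
  ∀ A : Set (Face K 0), (∀ i ∈ A, (i : K) ≤ F) → ∃ G ≤ F, ∀ i : Face K 0, (i : K) ≤ G ↔ i ∈ A

theorem rk_vertex (i : Face K 0) : rk (i : K) = 1 := by
  have := mem_face_iff.1 i.2
  omega

/-- Rank preservation matches the singletons in `Finset (Fin m)` with the vertices below `F`. Only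
these two consequences of being a simplex are used for `2^K`. -/
theorem IsPolytope.simplex_vertices {n m : ℕ} (h : IsPolytope K n) {F : K} (hF : rk F = m)
    (hm : m ≠ 0) (φ : Set.Iic F ≃o Finset (Fin m)) :
    HasAllSubfaces F ∧ Nonempty ({i : Face K 0 // (i : K) ≤ F} ≃ Fin m) := by
  obtain ⟨k, rfl⟩ := Nat.exists_eq_succ_of_ne_zero hm
  have hrk : ∀ G : Set.Iic F, (φ G).card = rk G.1 := fun G => by
    rw [← (ranked_finset _).rk_eq, rk_map, (h.section_Iic hF).1.rk_eq]
  have hvert : ∀ i : {i : Face K 0 // (i : K) ≤ F}, ∃ a, φ ⟨i.1.1, i.2⟩ = {a} := fun i => by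
    rw [← Finset.card_eq_one, hrk]
    exact rk_vertex i.1
  choose f hf using hvert
  have hface : ∀ a, (φ.symm {a}).1 ∈ Face K 0 := fun a => by
    rw [mem_face_iff, ← hrk]
    simp
  have hfg : ∀ a (h : (φ.symm {a}).1 ≤ F), f ⟨⟨(φ.symm {a}).1, hface a⟩, h⟩ = a := fun a h => by
    have e := hf ⟨⟨(φ.symm {a}).1, hface a⟩, h⟩
    have e' : φ (φ.symm {a}) = {f ⟨⟨(φ.symm {a}).1, hface a⟩, h⟩} := e
    rw [OrderIso.apply_symm_apply] at e'
    exact (Finset.singleton_injective e').symm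
  have hback : ∀ (i : Face K 0) (h : (i : K) ≤ F), (φ.symm {f ⟨i, h⟩}).1 = i := fun i h => by
    rw [← hf ⟨i, h⟩, OrderIso.symm_apply_apply]
  have hfinj : Function.Injective f := fun i j hij => by
    have := (hf i).trans (hij ▸ (hf j).symm)
    have := congrArg Subtype.val (φ.injective this)
    exact Subtype.ext (Subtype.ext this)
  constructor
  · classical
    intro A hA
    refine ⟨φ.symm (Finset.univ.filter fun a => ⟨(φ.symm {a}).1, hface a⟩ ∈ A),
      (φ.symm _).2, fun i => ?_⟩
    constructor
    · intro hi
      have hiF : (i : K) ≤ F := hi.trans (φ.symm _).2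
      have h1 : φ ⟨i, hiF⟩ ≤ Finset.univ.filter fun a => ⟨(φ.symm {a}).1, hface a⟩ ∈ A := by
        rw [← φ.le_symm_apply]
        exact hi
      rw [hf ⟨i, hiF⟩] at h1
      have h2 := (Finset.mem_filter.1 (h1 (Finset.mem_singleton_self _))).2
      rwa [show (⟨_, hface _⟩ : Face K 0) = i from Subtype.ext (hback i hiF)] at h2
    · intro hi
      have hiF := hA i hi
      have h1 : φ ⟨i, hiF⟩ ≤ Finset.univ.filter fun a => ⟨(φ.symm {a}).1, hface a⟩ ∈ A := by
        rw [hf ⟨i, hiF⟩]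
        refine Finset.singleton_subset_iff.2 (Finset.mem_filter.2 ⟨Finset.mem_univ _, ?_⟩)
        rwa [show (⟨_, hface _⟩ : Face K 0) = i from Subtype.ext (hback i hiF)]
      rw [← φ.le_symm_apply] at h1
      exact h1
  · exact ⟨Equiv.ofBijective f ⟨hfinj, fun a => ⟨⟨⟨(φ.symm {a}).1, hface a⟩, (φ.symm {a}).2⟩,
      hfg a _⟩⟩⟩

theorem IsVertexDescribable.le_iff (hv : IsVertexDescribable K) {F G : K} :
    F ≤ G ↔ ∀ i : Face K 0, (i : K) ≤ F → (i : K) ≤ G := by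
  rw [hv F G]
  constructor
  · intro h i hi
    exact (h ⟨i.2, hi⟩).2
  · rintro h v ⟨hv, hvF⟩
    exact ⟨hv, h ⟨v, hv⟩ hvF⟩

theorem mem_cubeFace {F : K} {ε η : Face K 0 → Fin 2} :
    η ∈ cubeFace F ε ↔ ∀ i : Face K 0, ¬ (i : K) ≤ F → η i = ε i := by
  refine forall_congr' fun i => ?_
  have : (i : K) ∈ vertexSet F ↔ (i : K) ≤ F := ⟨fun h => h.2, fun h => ⟨i.2, h⟩⟩
  rw [this]

theorem classSystem_cubeFace [Finite K] {m : ℕ} (hK : IsPolytope K m) (hv : IsVertexDescribable K) :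
    ClassSystem (cubeFace (K := K)) := by
  classical
  have hflip : ∀ a : Fin 2, a + 1 ≠ a := by decide
  have hflip' : ∀ a b : Fin 2, a ≠ b → a = b + 1 := by decide
  refine ⟨?_, ?_, ?_, ?_, ?_, ?_, ?_⟩
  · intro F x
    rw [mem_cubeFace]
    exact fun _ _ => rfl
  · intro F x y hxy
    rw [mem_cubeFace] at hxy
    ext η
    rw [mem_cubeFace, mem_cubeFace]
    exact forall₂_congr fun i hi => by rw [hxy i hi]
  · intro F G x
    rw [hv.le_iff]
    constructor
    · intro hsub i hi
      by_contra hiG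
      -- Flipping the coordinate `i` of `x` tests whether `i` is a vertex of the face.
      have hmem : Function.update x i (x i + 1) ∈ cubeFace F x := by
        rw [mem_cubeFace]
        intro j hj
        rw [Function.update_of_ne]
        rintro rfl
        exact hj hi
      have := mem_cubeFace.1 (hsub hmem) i hiG
      rw [Function.update_self] at this
      exact hflip _ this
    · intro h η hη
      rw [mem_cubeFace] at hη ⊢
      exact fun i hi => hη i fun hiF => hi (h i hiF)
  · intro F x hF
    ext η
    rw [mem_cubeFace, Set.mem_singleton_iff]
    constructor
    · intro h
      funext i
      refine h i fun hi => ?_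
      have := hK.ranked.rank_of_isBot fun b => (hi.trans (hF b))
      rw [rk_vertex] at this
      omega
    · rintro rfl _ _
      rfl
  · intro F x hF
    ext η
    rw [mem_cubeFace]
    simp only [Set.mem_univ, iff_true]
    exact fun i hi => absurd (hF i) hi
  · intro F x hF
    have hFv : F ∈ Face K 0 := by rw [mem_face_iff]; omega
    have hiF : ∀ i : Face K 0, (i : K) ≤ F ↔ i = ⟨F, hFv⟩ := fun i => by
      constructor
      · intro h
        rcases h.eq_or_lt with h | h
        · exact Subtype.ext h
        · have := hK.rk_strictMono h
          rw [rk_vertex, hF] at this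
          omega
      · rintro rfl
        exact le_rfl
    rw [Set.encard_eq_two]
    refine ⟨x, Function.update x ⟨F, hFv⟩ (x ⟨F, hFv⟩ + 1), ?_, ?_⟩
    · intro e
      have := congrFun e ⟨F, hFv⟩
      rw [Function.update_self] at this
      exact hflip _ this.symm
    · ext η
      rw [mem_cubeFace]
      simp only [hiF, Set.mem_insert_iff, Set.mem_singleton_iff]
      constructor
      · intro h
        by_cases e : η ⟨F, hFv⟩ = x ⟨F, hFv⟩
        · left
          funext i
          by_cases hi : i = ⟨F, hFv⟩
          · rw [hi, e]
          · exact h i hi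
        · right
          funext i
          by_cases hi : i = ⟨F, hFv⟩
          · rw [hi, Function.update_self]
            exact hflip' _ _ e
          · rw [Function.update_of_ne hi, h i hi]
      · rintro (rfl | rfl) i hi
        · rfl
        · rw [Function.update_of_ne hi]
  · intro F x y hy
    have := Fintype.ofFinite (Face K 0)
    -- The path changes one coordinate at a time; `s` contains the coordinates that may differ from
    -- those of `x`.
    have key : ∀ (s : Finset (Face K 0)) (η : Face K 0 → Fin 2), (∀ i ∉ s, η i = x i) →
        η ∈ cubeFace F x → Relation.ReflTransGen
          (fun a b => ∃ v ≤ F, rk v = 1 ∧ b ∈ cubeFace v a) x η := by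
      intro s
      induction s using Finset.induction_on with
      | empty =>
        intro η h _
        have : η = x := funext fun i => h i (Finset.notMem_empty i)
        rw [this]
      | insert a s _ ih =>
        intro η h hη
        have hη' := mem_cubeFace.1 hη
        have hpath := ih (Function.update η a (x a)) (fun i hi => by
          by_cases e : i = a
          · rw [e, Function.update_self]
          · rw [Function.update_of_ne e]
            exact h i (by simp [e, hi])) (mem_cubeFace.2 fun i hi => by
          by_cases e : i = a
          · rw [e, Function.update_self]
          · rw [Function.update_of_ne e, hη' i hi])
        by_cases ha : (a : K) ≤ F
        · refine hpath.tail ⟨a, ha, rk_vertex a, mem_cubeFace.2 fun i hi => ?_⟩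
          rw [Function.update_of_ne]
          rintro rfl
          exact hi le_rfl
        · rwa [← hη' a ha, Function.update_eq_self] at hpath
    exact key Finset.univ y (fun i hi => absurd (Finset.mem_univ i) hi) hy

/-- The permutation of the points of the cube that permutes coordinates and maps `x` to `y`. -/
def pointMap (x y : Face K 0 → Fin 2) (π : Equiv.Perm (Face K 0)) :
    (Face K 0 → Fin 2) ≃ (Face K 0 → Fin 2) where
  -- Arithmetic in `Fin 2` is modulo 2, so this is an affine map with linear part given by `π`.
  toFun η := fun i => y i + (η (π.symm i) - x (π.symm i))
  invFun η := fun i => x i + (η (π i) - y (π i))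
  left_inv η := by funext i; simp
  right_inv η := by funext i; simp

theorem pointMap_apply (x y η : Face K 0 → Fin 2) (π : Equiv.Perm (Face K 0)) (i : Face K 0) :
    pointMap x y π η i = y i + (η (π.symm i) - x (π.symm i)) := rfl

theorem pointMap_symm (x y : Face K 0 → Fin 2) (π : Equiv.Perm (Face K 0)) :
    (pointMap x y π).symm = pointMap y x π.symm := by
  ext η i
  rfl

theorem pointMap_self (x y : Face K 0 → Fin 2) (π : Equiv.Perm (Face K 0)) :
    pointMap x y π x = y := by
  funext i
  simp [pointMap_apply]

/-- Only the vertices of the two faces have to match under `π`; no automorphism of `K` is required.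
-/
theorem image_pointMap (x y z : Face K 0 → Fin 2) (π : Equiv.Perm (Face K 0)) {F G : K}
    (hFG : ∀ i : Face K 0, (i : K) ≤ F ↔ (π i : K) ≤ G) :
    pointMap x y π '' cubeFace F z = cubeFace G (pointMap x y π z) := by
  ext η
  rw [Equiv.image_eq_preimage_symm, Set.mem_preimage, mem_cubeFace, mem_cubeFace, pointMap_symm]
  constructor
  · intro h i hi
    have := h (π.symm i) (by rwa [hFG, Equiv.apply_symm_apply])
    rw [pointMap_apply] at this ⊢
    rw [← this]
    simp
  · intro h i hi
    have := h (π i) (by rwa [← hFG])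
    rw [pointMap_apply] at this ⊢
    rw [Equiv.symm_symm, this]
    simp

/-- Facets of the cube poset over simplices are isomorphic, by permuting coordinates. -/
theorem exists_section_iso (hC : ClassSystem (cubeFace (K := K))) {F G : K}
    (hF : HasAllSubfaces F) (hG : HasAllSubfaces G) (x y : Face K 0 → Fin 2)
    (π : Equiv.Perm (Face K 0)) (hπ : ∀ i : Face K 0, (i : K) ≤ F ↔ (π i : K) ≤ G) :
    ∃ g : Set.Iic (face cubeFace F x) ≃o Set.Iic (face cubeFace G y),
      ∀ A, (g A).1.1 = pointMap x y π '' A.1.1 := by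
  have key : ∀ {F G : K} (_ : HasAllSubfaces G) (x y : Face K 0 → Fin 2)
      (π : Equiv.Perm (Face K 0)) (_ : ∀ i : Face K 0, (i : K) ≤ F ↔ (π i : K) ≤ G)
      (A : Set.Iic (face cubeFace F x)), ∃ B : Set.Iic (face cubeFace G y),
      B.1.1 = pointMap x y π '' A.1.1 := by
    intro F G hG x y π hπ ⟨A, hA⟩
    rcases A.eq_emp_or with rfl | ⟨H, z, rfl⟩
    · exact ⟨⟨emp _, emp_le _⟩, (Set.image_empty _).symm⟩
    · obtain ⟨hHF, hz⟩ := hC.face_le_iff.1 hA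
      -- `HasAllSubfaces` ensures that the permuted vertex-set of `H` is again the vertex-set of a
      -- face.
      obtain ⟨H', hH'G, hH'⟩ := hG {i | (π.symm i : K) ≤ H} (fun i hi => by
        have := (hπ _).1 (le_trans hi hHF)
        rwa [Equiv.apply_symm_apply] at this)
      refine ⟨⟨face cubeFace H' (pointMap x y π z), hC.face_le_iff.2 ⟨hH'G, ?_⟩⟩, ?_⟩
      · rw [mem_cubeFace] at hz ⊢
        intro i hi
        have := hz (π.symm i) (by rwa [hπ, Equiv.apply_symm_apply])
        rw [pointMap_apply, this]
        simp
      · exact (image_pointMap x y z π fun i => by rw [hH']; simp).symm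
  have hπ' : ∀ i : Face K 0, (i : K) ≤ G ↔ (π.symm i : K) ≤ F := fun i => by
    rw [hπ, Equiv.apply_symm_apply]
  choose f hf using key (F := F) (G := G) hG x y π hπ
  choose f' hf' using key (F := G) (G := F) hF y x π.symm hπ'
  refine ⟨⟨⟨f, f', fun A => ?_, fun A => ?_⟩, ?_⟩, hf⟩
  · apply Subtype.ext
    apply Subtype.ext
    rw [hf', hf, ← pointMap_symm, Equiv.symm_image_image]
  · apply Subtype.ext
    apply Subtype.ext
    rw [hf, hf', ← pointMap_symm, Equiv.image_symm_image]
  · intro A B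
    change (f A).1.1 ⊆ (f B).1.1 ↔ A.1.1 ⊆ B.1.1
    rw [hf, hf, Set.image_subset_image_iff (pointMap x y π).injective]

/-- The translation automorphism of the cube poset that maps `x` to `y`. -/
theorem exists_translation (x y : Face K 0 → Fin 2) :
    ∃ g : ClassPoset (cubeFace (K := K)) ≃o ClassPoset (cubeFace (K := K)),
      ∀ F, g (face cubeFace F x) = face cubeFace F y := by
  have key : ∀ (x y : Face K 0 → Fin 2) (A : ClassPoset (cubeFace (K := K))),
      ∃ B : ClassPoset (cubeFace (K := K)), B.1 = pointMap x y 1 '' A.1 := by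
    intro x y A
    rcases A.eq_emp_or with rfl | ⟨F, z, rfl⟩
    · exact ⟨emp _, (Set.image_empty _).symm⟩
    · exact ⟨face _ F (pointMap x y 1 z), (image_pointMap x y z 1 fun i => by simp).symm⟩
  choose f hf using key x y
  choose f' hf' using key y x
  have hsymm : (pointMap x y 1).symm = pointMap y x 1 := pointMap_symm x y 1
  refine ⟨⟨⟨f, f', fun A => ?_, fun A => ?_⟩, ?_⟩, ?_⟩
  · apply Subtype.ext
    rw [hf', hf, ← hsymm, Equiv.symm_image_image]
  · apply Subtype.ext
    rw [hf, hf', ← hsymm, Equiv.image_symm_image]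
  · intro A B
    change (f A).1 ⊆ (f B).1 ↔ A.1 ⊆ B.1
    rw [hf, hf, Set.image_subset_image_iff (pointMap x y 1).injective]
  · intro F
    apply Subtype.ext
    refine (hf _).trans ?_
    refine (image_pointMap x y x 1 (G := F) fun i => by simp).trans ?_
    rw [pointMap_self]
    rfl

end

end AbstractPolytope

/-! ### Facets, automorphisms and orbits of `2^K` -/

namespace AbstractPolytope

open ClassPoset

section

variable {K : Type u} [PartialOrder K]

theorem flag_map_eq {P : Type u} [PartialOrder P] (g : P ≃o P) {Φ Ψ : Flag P}
    (h : ∀ E ∈ Φ, g E ∈ Ψ) : Flag.map g Φ = Ψ := by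
  refine Flag.ext ((Flag.map g Φ).max_chain' Ψ.chain_le ?_)
  rintro _ ⟨E, hE, rfl⟩
  exact h E hE

variable [Finite K] {m : ℕ} (hK : IsPolytope K m) (hv : IsVertexDescribable K)
include hK hv

theorem facet_of_cubeFace {S : ClassPoset (cubeFace (K := K))}
    (hS : S ∈ Face (ClassPoset (cubeFace (K := K))) m) :
    ∃ F x, S = face _ F x ∧ F ∈ Face K (m - 1) := by
  have hC := classSystem_cubeFace hK hv
  rw [mem_face_iff] at hS
  rcases S.eq_emp_or with rfl | ⟨F, x, rfl⟩
  · rw [hC.rk_emp hK] at hS; omega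
  · rw [hC.rk_face hK] at hS
    exact ⟨F, x, rfl, mem_face_iff.2 (by push_cast at hS; omega)⟩

/-- Two facets of `K` have equally many vertices, so a bijection between their vertex-sets extends
to a permutation of all coordinates, which maps one cube to the other. -/
theorem isEquifacetted_cubeFace (hm : m ≠ 0) (hs : IsSimplicial K m) :
    IsEquifacetted (ClassPoset (cubeFace (K := K))) (m + 1) := by
  have hC := classSystem_cubeFace hK hv
  intro S hS T hT
  obtain ⟨F, x, rfl, hF⟩ := facet_of_cubeFace hK hv (by simpa using hS)
  obtain ⟨G, y, rfl, hG⟩ := facet_of_cubeFace hK hv (by simpa using hT)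
  obtain ⟨φ⟩ := hs F hF
  obtain ⟨ψ⟩ := hs G hG
  have hFr : rk F = m := by have := mem_face_iff.1 hF; omega
  have hGr : rk G = m := by have := mem_face_iff.1 hG; omega
  obtain ⟨hF', ⟨e⟩⟩ := hK.simplex_vertices hFr hm φ
  obtain ⟨hG', ⟨e'⟩⟩ := hK.simplex_vertices hGr hm ψ
  classical
  have := Fintype.ofFinite (Face K 0)
  have hπ : ∀ i : Face K 0, (i : K) ≤ F ↔ ((e.trans e'.symm).extendSubtype i : K) ≤ G := fun i => by
    by_cases hi : (i : K) ≤ F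
    · simp only [hi, true_iff]
      exact (e.trans e'.symm).extendSubtype_mem i hi
    · simp only [hi, false_iff]
      exact (e.trans e'.symm).extendSubtype_not_mem i hi
  obtain ⟨g, -⟩ := exists_section_iso hC hF' hG' x y _ hπ
  exact ⟨g⟩

/-- This section is a cube. A flag is moved to an adjacent one by a translation if the vertex
changes, and by a transposition of two coordinates, fixing the vertex of the flag, if a larger face
changes. -/
theorem isRegular_section_cubeFace {F : K} (hF : HasAllSubfaces F) (x : Face K 0 → Fin 2) :
    IsRegular (Set.Iic (face cubeFace F x)) := by
  classical
  have hC := classSystem_cubeFace hK hv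
  obtain ⟨hR, hP⟩ := hC.isPolytope hK |>.section_Iic (hC.rk_face hK F x)
  obtain ⟨b, hb, hb0⟩ := hK.ranked.exists_bot
  apply hP.isRegular_of_adjacent
  intro Φ Ψ hadj
  obtain ⟨A, B, C, D, hA, hB, hAB, -, -, hr, hΨ, -, hCΦ, -, hD, -, hrC, hrD, hCA, hAD, hCB, hBD⟩ :=
    hR.adjacent_data hadj
  suffices ∃ g : Set.Iic (face cubeFace F x) ≃o Set.Iic (face cubeFace F x),
      g A = B ∧ ∀ E ∈ Φ, E ≤ C ∨ D ≤ E → g E = E by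
    obtain ⟨g, hgA, hg⟩ := this
    refine ⟨g, flag_map_eq g fun E hE => ?_⟩
    by_cases hEA : E = A
    · rw [hEA, hgA]
      exact hB
    · rw [hg E hE]
      · exact hΨ E hE hEA
      · have hne : rk E.1 ≠ rk A.1 := fun e => hEA (flag_eq_of_rank_eq hR.mono hE hA e)
        rcases lt_or_gt_of_ne hne with h | h
        · exact Or.inl (flag_le_of_rank_le hR.mono hE hCΦ (by omega))
        · exact Or.inr (flag_le_of_rank_le hR.mono hD hE (by omega))
  obtain ⟨A, hAF⟩ := A
  obtain ⟨B, hBF⟩ := B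
  obtain ⟨C, hCF⟩ := C
  obtain ⟨D, hDF⟩ := D
  simp only [Subtype.mk_lt_mk] at hCA hAD hCB hBD
  simp only at hr hrC hrD
  rcases A.eq_emp_or with rfl | ⟨HA, xA, rfl⟩
  · exact absurd hCA (emp_le C).not_gt
  rcases B.eq_emp_or with rfl | ⟨HB, xB, rfl⟩
  · exact absurd hCB (emp_le C).not_gt
  rcases D.eq_emp_or with rfl | ⟨HD, xD, rfl⟩
  · exact absurd hAD (emp_le _).not_gt
  rw [hC.rk_face hK, hC.rk_face hK] at hr
  rw [hC.rk_face hK] at hrC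
  obtain ⟨hAD', hxA⟩ := hC.face_lt_iff.1 hAD
  obtain ⟨hBD', hxB⟩ := hC.face_lt_iff.1 hBD
  obtain ⟨hHAF, hxAF⟩ := hC.face_le_iff.1 hAF
  obtain ⟨hHBF, hxBF⟩ := hC.face_le_iff.1 hBF
  -- The vertex of the flag serves as a common base point of all its nonempty faces.
  obtain ⟨xC, hvert⟩ : ∃ x₀, ∀ E ∈ Φ, E.1 = emp _ ∨ x₀ ∈ E.1.1 := by
    obtain ⟨⟨S, hSF⟩, hS, hSr⟩ := hR.exists_mem_flag Φ (k := 1) (by omega)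
    simp only at hSr
    rcases S.eq_emp_or with rfl | ⟨H, z, rfl⟩
    · rw [hC.rk_emp hK] at hSr
      omega
    · refine ⟨z, fun E hE => ?_⟩
      rcases E.1.eq_emp_or with h | ⟨G, y, h⟩
      · exact Or.inl h
      · refine Or.inr (flag_le_of_rank_le hR.mono hS hE ?_ (hC.mem_self H z))
        rw [hSr, h, hC.rk_face hK]
        omega
  have hCform : C = emp _ ∨ ∃ HC, C = face _ HC xC := by
    rcases C.eq_emp_or with h | ⟨G, y, rfl⟩
    · exact Or.inl h
    · rcases hvert _ hCΦ with h | h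
      · exact Or.inl h
      · exact Or.inr ⟨G, (hC.face_eq_face h).symm⟩
  rcases hCform with rfl | ⟨HC, rfl⟩
  · rw [hC.rk_emp hK] at hrC
    have hHA : HA = b := le_antisymm (hK.ranked.isBot_of_rank (by omega) b) (hb HA)
    have hHB : HB = b := le_antisymm (hK.ranked.isBot_of_rank (by omega) b) (hb HB)
    subst hHA hHB
    -- Here `A` and `B` are vertices. The translation from `xA` to `xB` preserves each face that
    -- contains both points, in particular every face above `D`.
    have key := exists_section_iso hC hF hF xA xB 1 (fun i => by simp)
    rw [hC.face_eq_face hxAF, hC.face_eq_face hxBF] at key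
    obtain ⟨g, hg⟩ := key
    refine ⟨g, ?_, ?_⟩
    · apply Subtype.ext
      apply Subtype.ext
      rw [hg]
      refine (image_pointMap xA xB xA 1 (G := HB) fun i => by simp).trans ?_
      rw [pointMap_self]
      rfl
    · rintro ⟨E, hEF⟩ - (hE | hE)
      · rcases E.eq_emp_or with rfl | ⟨H, z, rfl⟩
        · apply Subtype.ext
          apply Subtype.ext
          rw [hg]
          exact Set.image_empty _
        · exact absurd hE (hC.not_face_le_emp _ _)
      · rcases E.eq_emp_or with rfl | ⟨H, z, rfl⟩
        · exact absurd hE (hC.not_face_le_emp _ _)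
        · obtain ⟨hDH, hxDz⟩ := hC.face_le_iff.1 (Subtype.mk_le_mk.1 hE)
          have h1 := (hC.face_le_iff.1 ((hC.face_le_iff.2 ⟨hAD'.le, hxA⟩).trans hE)).2
          have h2 := (hC.face_le_iff.1 ((hC.face_le_iff.2 ⟨hBD'.le, hxB⟩).trans hE)).2
          apply Subtype.ext
          apply Subtype.ext
          rw [hg]
          change pointMap xA xB 1 '' cubeFace H z = cubeFace H z
          rw [← hC.eq_of_mem H z xA h1, image_pointMap xA xB xA 1 (G := H) fun i => by simp,
            pointMap_self, hC.eq_of_mem H z xA h1, hC.eq_of_mem H z xB h2]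
  · obtain ⟨hCA', hxC⟩ := hC.face_lt_iff.1 hCA
    obtain ⟨hCB', hxC'⟩ := hC.face_lt_iff.1 hCB
    rw [hC.rk_face hK] at hrC
    rw [← hC.face_eq_face hxC] at *
    rw [← hC.face_eq_face hxC'] at *
    obtain ⟨-, hxCF⟩ := hC.face_le_iff.1 hCF
    -- In a simplex, raising the rank by one adds exactly one vertex: adding any new vertex `u` to
    -- `HC` already gives a face below `H`, which must be `H`. Exchanging the vertices added in `HA`
    -- and in `HB` then turns `A` into `B`.
    have hnew : ∀ H ≤ F, HC < H → rk H = rk HC + 1 → ∃ u : Face K 0, (u : K) ≤ H ∧ ¬ (u : K) ≤ HC ∧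
        ∀ i : Face K 0, (i : K) ≤ H ↔ (i : K) ≤ HC ∨ i = u := by
      intro H hHF hCH hHr
      have : ¬ H ≤ HC := hCH.not_ge
      rw [hv.le_iff] at this
      push Not at this
      obtain ⟨u, huH, huC⟩ := this
      obtain ⟨G, -, hG⟩ := hF {i | (i : K) ≤ HC ∨ i = u} (by
        rintro i (hi | rfl)
        · exact hi.trans (hCH.le.trans hHF)
        · exact huH.trans hHF)
      have hCG : HC < G := by
        refine (hv.le_iff.2 fun i hi => (hG i).2 (Or.inl hi)).lt_of_ne ?_
        rintro rfl
        exact huC ((hG u).2 (Or.inr rfl))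
      have hGH : G ≤ H := hv.le_iff.2 fun i hi => by
        rcases (hG i).1 hi with hi | rfl
        · exact hi.trans hCH.le
        · exact huH
      have : G = H := by
        rcases hGH.eq_or_lt with e | e
        · exact e
        · have := hK.rk_strictMono e
          have := hK.rk_strictMono hCG
          omega
      subst this
      exact ⟨u, huH, huC, hG⟩
    obtain ⟨u, hu1, hu2, hu3⟩ := hnew HA hHAF hCA' (by omega)
    obtain ⟨w, hw1, hw2, hw3⟩ := hnew HB hHBF hCB' (by omega)
    have hpres : ∀ H : K, ((u : K) ≤ H ↔ (w : K) ≤ H) →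
        ∀ i : Face K 0, (i : K) ≤ H ↔ (Equiv.swap u w i : K) ≤ H := by
      intro H hH i
      rw [Equiv.swap_apply_def]
      split_ifs with h1 h2
      · rw [h1, hH]
      · rw [h2, hH]
      · rfl
    have key := exists_section_iso hC hF hF xC xC (Equiv.swap u w)
      (hpres F ⟨fun _ => hw1.trans hHBF, fun _ => hu1.trans hHAF⟩)
    rw [hC.face_eq_face hxCF] at key
    obtain ⟨g, hg⟩ := key
    refine ⟨g, ?_, ?_⟩
    · apply Subtype.ext
      apply Subtype.ext
      rw [hg]
      change pointMap xC xC (Equiv.swap u w) '' cubeFace HA xA = cubeFace HB xB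
      rw [← hC.eq_of_mem HA xA xC hxC, ← hC.eq_of_mem HB xB xC hxC',
        image_pointMap xC xC xC (Equiv.swap u w) (G := HB) fun i => ?_, pointMap_self]
      rw [hu3, hw3]
      grind
    · rintro ⟨E, hEF⟩ hEΦ hE
      apply Subtype.ext
      apply Subtype.ext
      rw [hg]
      rcases E.eq_emp_or with rfl | ⟨H, z, rfl⟩
      · exact Set.image_empty _
      change pointMap xC xC (Equiv.swap u w) '' cubeFace H z = cubeFace H z
      have hz : xC ∈ cubeFace H z ∧ ((u : K) ≤ H ↔ (w : K) ≤ H) := by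
        refine ⟨(hvert _ hEΦ).resolve_left fun h => ?_, ?_⟩
        · exact hC.not_face_le_emp H z h.le
        rcases hE with hE | hE
        · obtain ⟨h1, -⟩ := hC.face_le_iff.1 (Subtype.mk_le_mk.1 hE)
          exact ⟨fun h => absurd (h.trans h1) hu2, fun h => absurd (h.trans h1) hw2⟩
        · have h1 := hC.face_le_iff.1 (hAD.le.trans hE)
          have h2 := hC.face_le_iff.1 (hBD.le.trans hE)
          exact ⟨fun _ => hw1.trans h2.1, fun _ => hu1.trans h1.1⟩
      rw [← hC.eq_of_mem H z xC hz.1, image_pointMap xC xC xC _ (hpres H hz.2), pointMap_self]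

theorem isSemiregular_cubeFace (hm : m ≠ 0) (hs : IsSimplicial K m) :
    IsSemiregular (ClassPoset (cubeFace (K := K))) (m + 1) := by
  have hC := classSystem_cubeFace hK hv
  constructor
  · intro S hS
    obtain ⟨F, x, rfl, hF⟩ := facet_of_cubeFace hK hv (by simpa using hS)
    obtain ⟨φ⟩ := hs F hF
    have hFr : rk F = m := by have := mem_face_iff.1 hF; omega
    exact isRegular_section_cubeFace hK hv (hK.simplex_vertices hFr hm φ).1 x
  · intro S hS T hT
    obtain ⟨b, hb, hb0⟩ := hK.ranked.exists_bot
    have key : ∀ S ∈ Face (ClassPoset (cubeFace (K := K))) 0, ∃ x, S = face _ b x := by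
      intro S hS
      rw [mem_face_iff] at hS
      rcases S.eq_emp_or with rfl | ⟨F, x, rfl⟩
      · rw [hC.rk_emp hK] at hS; omega
      · rw [hC.rk_face hK] at hS
        exact ⟨x, by rw [le_antisymm (hK.ranked.isBot_of_rank (by omega) b) (hb F)]⟩
    obtain ⟨x, rfl⟩ := key S hS
    obtain ⟨y, rfl⟩ := key T hT
    obtain ⟨g, hg⟩ := exists_translation (K := K) x y
    exact ⟨g, hg b⟩

/-- If `K` is asymmetric, then the vertex stabilisers of `2^K` are trivial. -/
theorem eq_refl_of_fixes_vertex (ha : IsAsymmetric K) {b : K} (hb : IsBot b)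
    (x : Face K 0 → Fin 2) (g : ClassPoset (cubeFace (K := K)) ≃o ClassPoset (cubeFace (K := K)))
    (hg : g (face _ b x) = face _ b x) : g = OrderIso.refl _ := by
  have hC := classSystem_cubeFace hK hv
  have key : ∀ g : ClassPoset (cubeFace (K := K)) ≃o ClassPoset (cubeFace (K := K)),
      g (face _ b x) = face _ b x → ∀ F, ∃ G, g (face _ F x) = face _ G x := by
    intro g hg F
    have h1 : face _ b x ≤ g (face _ F x) := by
      rw [← hg, g.le_iff_le]
      exact hC.face_le_iff.2 ⟨hb F, hC.mem_self _ _⟩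
    rcases (g (face _ F x)).eq_emp_or with e | ⟨G, y, e⟩
    · rw [e] at h1
      exact absurd h1 (hC.not_face_le_emp _ _)
    · rw [e] at h1 ⊢
      exact ⟨G, (hC.face_eq_face (hC.face_le_iff.1 h1).2).symm⟩
  have hg' : g.symm (face _ b x) = face _ b x := by rw [OrderIso.symm_apply_eq, hg]
  choose f hf using key g hg
  choose f' hf' using key g.symm hg'
  have hinj : ∀ {F G : K}, face (cubeFace (K := K)) F x = face _ G x → F = G :=
    fun h => (hC.face_eq_iff.1 h).1
  -- The faces through `x` form a copy of `K`, so `g` induces an automorphism of `K`; being trivial,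
  -- it leaves every flag through `x` fixed.
  have hid := ha ⟨⟨f, f', fun F => hinj (by rw [← hf', ← hf, OrderIso.symm_apply_apply]),
    fun F => hinj (by rw [← hf, ← hf', OrderIso.apply_symm_apply])⟩, fun {F G} => by
      have h1 : face (cubeFace (K := K)) (f F) x ≤ face _ (f G) x ↔
          face (cubeFace (K := K)) F x ≤ face _ G x := by
        rw [← hf, ← hf, g.le_iff_le]
      rw [hC.face_le_iff, hC.face_le_iff] at h1
      simpa [hC.mem_self] using h1⟩
  have hfid : ∀ F, f F = F := fun F => DFunLike.congr_fun hid F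
  obtain ⟨Φ, hΦ⟩ := Flag.exists_mem (face (cubeFace (K := K)) b x)
  refine (hC.isPolytope hK).eq_refl_of_fixes_flag g Φ fun S hS => ?_
  rcases S.eq_emp_or with rfl | ⟨F, y, rfl⟩
  · exact le_antisymm (by rw [← g.le_symm_apply]; exact emp_le _) (emp_le _)
  · have : x ∈ cubeFace F y := by
      rcases Φ.le_or_le hΦ hS with h | h
      · exact (hC.face_le_iff.1 h).2
      · obtain ⟨h1, h2⟩ := hC.face_le_iff.1 h
        rw [hC.of_isBot b x hb] at h2
        rw [Set.mem_singleton_iff] at h2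
        subst h2
        exact hC.mem_self _ _
    rw [← hC.face_eq_face this, hf, hfid]

/-- The faces through the origin represent all orbits, by translations. They are inequivalent, since
every automorphism turns out to be a translation. -/
theorem numFaceOrbits_cubeFace (ha : IsAsymmetric K) (j : ℕ) :
    numFaceOrbits (ClassPoset (cubeFace (K := K))) j = (Face K ((j : ℤ) - 1)).ncard := by
  have hC := classSystem_cubeFace hK hv
  obtain ⟨b, hb, hb0⟩ := hK.ranked.exists_bot
  have hmem : ∀ F : Face K ((j : ℤ) - 1), face cubeFace F.1 0 ∈
      Face (ClassPoset (cubeFace (K := K))) j := fun F => by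
    have := mem_face_iff.1 F.2
    rw [mem_face_iff, hC.rk_face hK]
    push_cast
    omega
  have heq : Equivalence (fun F G : Face (ClassPoset (cubeFace (K := K))) j =>
      ∃ g : ClassPoset (cubeFace (K := K)) ≃o ClassPoset (cubeFace (K := K)),
        g (F : ClassPoset (cubeFace (K := K))) = (G : ClassPoset (cubeFace (K := K)))) :=
    ⟨fun F => ⟨OrderIso.refl _, rfl⟩, fun ⟨g, hg⟩ => ⟨g.symm, by rw [← hg]; simp⟩,
      fun ⟨g, hg⟩ ⟨g', hg'⟩ => ⟨g.trans g', by rw [← hg', ← hg]; rfl⟩⟩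
  rw [← Nat.card_coe_set_eq, numFaceOrbits]
  refine (Nat.card_eq_of_bijective (fun F => Quot.mk _ ⟨face cubeFace F.1 0, hmem F⟩) ⟨?_, ?_⟩).symm
  · intro F G hFG
    obtain ⟨g, hg⟩ := heq.quot_mk_eq_iff _ _ |>.1 hFG
    simp only at hg
    have h1 : ∃ y, g (face _ b 0) = face _ b y := by
      rcases hy : (g (face _ b 0)).eq_emp_or with h | ⟨H, y, h⟩
      · have := rk_map g (face _ b 0)
        rw [h, hC.rk_emp hK, hC.rk_face hK] at this
        omega
      · have := rk_map g (face _ b 0)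
        rw [h, hC.rk_face hK, hC.rk_face hK] at this
        refine ⟨y, by rw [h, le_antisymm (hK.ranked.isBot_of_rank (by omega) b) (hb H)]⟩
    obtain ⟨y, hy⟩ := h1
    -- Translating the image `y` of the origin back gives an automorphism that fixes a vertex. It is
    -- the identity, so `t` undoes `g`; translations do not change the underlying face of `K`.
    obtain ⟨t, ht⟩ := exists_translation (K := K) y 0
    have := eq_refl_of_fixes_vertex hK hv ha hb 0 (g.trans t) (by
      rw [OrderIso.trans_apply, hy, ht])
    have h2 : t (g (face _ F.1 0)) = face _ F.1 0 := DFunLike.congr_fun this _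
    have h3 : face _ b y ≤ g (face _ F.1 0) := by
      rw [← hy, g.le_iff_le]
      exact hC.face_le_iff.2 ⟨hb _, hC.mem_self _ _⟩
    rw [hg] at h2 h3
    rw [← hC.face_eq_face (hC.face_le_iff.1 h3).2, ht] at h2
    exact Subtype.ext (hC.face_eq_iff.1 h2).1.symm
  · intro q
    induction q using Quot.ind with
    | _ S =>
      obtain ⟨S, hS⟩ := S
      have hS' := mem_face_iff.1 hS
      rcases S.eq_emp_or with rfl | ⟨F, x, rfl⟩
      · rw [hC.rk_emp hK] at hS'; omega
      · rw [hC.rk_face hK] at hS'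
        obtain ⟨t, ht⟩ := exists_translation (K := K) 0 x
        exact ⟨⟨F, mem_face_iff.2 (by push_cast at hS'; omega)⟩, Quot.sound ⟨t, ht F⟩⟩

theorem exists_flag_cubeFace (x : Face K 0 → Fin 2) (φ : Flag K) :
    ∃ Φ : Flag (ClassPoset (cubeFace (K := K))), ∀ F, face cubeFace F x ∈ Φ ↔ F ∈ φ := by
  have hC := classSystem_cubeFace hK hv
  have hchain : IsChain (· ≤ ·) (insert (emp _) ((fun F => face cubeFace F x) '' (φ : Set K))) := by
    refine IsChain.insert ?_ fun S _ _ => Or.inl (emp_le S)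
    rintro _ ⟨F, hF, rfl⟩ _ ⟨G, hG, rfl⟩ -
    exact (φ.le_or_le hF hG).imp (fun h => hC.face_le_iff.2 ⟨h, hC.mem_self _ _⟩)
      fun h => hC.face_le_iff.2 ⟨h, hC.mem_self _ _⟩
  refine ⟨Flag.ofIsMaxChain _ ((hC.ranked hK).isMaxChain hchain fun k hk => ?_), fun F => ?_⟩
  · rcases k with _ | k
    · exact ⟨emp _, Or.inl rfl, hC.classRank_emp⟩
    · obtain ⟨F, hF, hFk⟩ := hK.ranked.exists_mem_flag φ (k := k) (by omega)
      exact ⟨_, Or.inr ⟨F, hF, rfl⟩, by rw [hC.classRank_face, hFk]⟩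
  · rw [← SetLike.mem_coe, Flag.coe_ofIsMaxChain]
    constructor
    · rintro (h | ⟨G, hG, h⟩)
      · exact absurd h.symm (hC.emp_lt_face F x).ne
      · exact (hC.face_eq_iff.1 h).1 ▸ hG
    · exact fun h => Or.inr ⟨F, h, rfl⟩

theorem exists_mem_flag_face
    (Φ : Flag (ClassPoset (cubeFace (K := K)))) :
    ∃ x, ∀ S ∈ Φ, S = emp _ ∨ ∃ F, S = face _ F x := by
  have hC := classSystem_cubeFace hK hv
  obtain ⟨S, hS, hSr⟩ := (hC.ranked hK).exists_mem_flag Φ (k := 1) (by omega)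
  rcases S.eq_emp_or with rfl | ⟨F, x, rfl⟩
  · rw [hC.classRank_emp] at hSr; omega
  · rw [hC.classRank_face] at hSr
    refine ⟨x, fun T hT => ?_⟩
    rcases T.eq_emp_or with rfl | ⟨G, y, rfl⟩
    · exact Or.inl rfl
    · have := flag_le_of_rank_le (hC.ranked hK).mono hS hT
        (by rw [hC.classRank_face, hC.classRank_face]; omega)
      exact Or.inr ⟨G, (hC.face_eq_face (hC.face_le_iff.1 this).2).symm⟩

/-- Each flag is translated to one through the origin, and these correspond to the flags of `K`. An
automorphism between two of them fixes the origin, their common vertex, and so is the identity. -/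
theorem numFlagOrbits_cubeFace (ha : IsAsymmetric K) :
    numFlagOrbits (ClassPoset (cubeFace (K := K))) = Nat.card (Flag K) := by
  have hC := classSystem_cubeFace hK hv
  obtain ⟨b, hb, hb0⟩ := hK.ranked.exists_bot
  have heq : Equivalence (fun Φ Ψ : Flag (ClassPoset (cubeFace (K := K))) =>
      ∃ g : ClassPoset (cubeFace (K := K)) ≃o ClassPoset (cubeFace (K := K)), Flag.map g Φ = Ψ) :=
    ⟨fun Φ => ⟨OrderIso.refl _, flag_map_eq _ fun E hE => hE⟩,
      fun ⟨g, hg⟩ => ⟨g.symm, by rw [← hg, ← Flag.symm_map, Equiv.symm_apply_apply]⟩,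
      fun ⟨g, hg⟩ ⟨g', hg'⟩ => ⟨g.trans g', flag_map_eq _ fun E hE => by
        rw [← hg', ← hg]; exact ⟨_, ⟨E, hE, rfl⟩, rfl⟩⟩⟩
  choose f hf using exists_flag_cubeFace hK hv 0
  rw [numFlagOrbits]
  refine (Nat.card_eq_of_bijective (fun φ => Quot.mk _ (f φ)) ⟨?_, ?_⟩).symm
  · intro φ ψ h
    obtain ⟨g, hg⟩ := heq.quot_mk_eq_iff _ _ |>.1 h
    have hbφ := (hf φ b).2 (mem_flag_of_isBot hb φ)
    have hbψ := (hf ψ b).2 (mem_flag_of_isBot hb ψ)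
    have hgb : g (face _ b 0) ∈ f ψ := by rw [← hg]; exact ⟨_, hbφ, rfl⟩
    have := flag_eq_of_rank_eq (hC.isPolytope hK).rk_strictMono hgb hbψ (rk_map g _)
    have hid := eq_refl_of_fixes_vertex hK hv ha hb 0 g this
    subst hid
    have hfe : f φ = f ψ := by
      rw [← hg]
      exact (flag_map_eq _ fun E hE => hE).symm
    ext F
    have h1 : F ∈ φ ↔ F ∈ ψ := by rw [← hf φ, ← hf ψ, hfe]
    exact h1
  · intro q
    induction q using Quot.ind with
    | _ Ψ =>
      obtain ⟨x, hx⟩ := exists_mem_flag_face hK hv Ψ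
      have hchain : IsChain (· ≤ ·) {F : K | face cubeFace F x ∈ Ψ} := fun F hF G hG _ =>
        (Ψ.le_or_le hF hG).imp (fun h => (hC.face_le_iff.1 h).1) fun h => (hC.face_le_iff.1 h).1
      have hmax := hK.ranked.isMaxChain hchain fun k hk => by
        obtain ⟨S, hS, hSr⟩ := (hC.ranked hK).exists_mem_flag Ψ (k := k + 1) (by omega)
        rcases hx S hS with rfl | ⟨F, rfl⟩
        · rw [hC.classRank_emp] at hSr; omega
        · rw [hC.classRank_face] at hSr
          exact ⟨F, hS, by omega⟩
      obtain ⟨t, ht⟩ := exists_translation (K := K) x 0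
      refine ⟨Flag.ofIsMaxChain _ hmax, Eq.symm (Quot.sound ⟨t, flag_map_eq t fun S hS => ?_⟩)⟩
      rcases hx S hS with rfl | ⟨F, rfl⟩
      · exact mem_flag_of_isBot (fun T => by
          rw [← t.le_symm_apply]; exact emp_le _) _
      · rw [ht, hf]
        exact hS

end

end AbstractPolytope

/-! ### Simplicial manifolds and their face posets -/

namespace AbstractPolytope

/-- A step between facets of a complex that contain `s` and share a ridge. -/
def FacetStep {V : Type u} (C : Set (Set V)) (d : ℕ) (s a b : Set V) : Prop :=
  b ∈ C ∧ b.encard = d ∧ s ⊆ b ∧ (d : ℕ∞) ≤ (a ∩ b).encard + 1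

/-- A pure simplicial complex all of whose facets have `d` vertices, in which every ridge is in
exactly two facets, and in which the stars are strongly connected. -/
structure IsSimplicialManifold {V : Type u} (C : Set (Set V)) (d : ℕ) : Prop where
  down : ∀ s ∈ C, ∀ t ⊆ s, t ∈ C
  empty_mem : ∅ ∈ C
  pure : ∀ s ∈ C, ∃ t ∈ C, s ⊆ t ∧ t.encard = d
  ridge : ∀ s ∈ C, s.encard + 1 = d → {t | t ∈ C ∧ s ⊆ t ∧ t.encard = d}.encard = 2
  connected : ∀ s ∈ C, s.encard + 2 ≤ d → ∀ a ∈ C, ∀ b ∈ C, s ⊆ a → s ⊆ b → a.encard = d →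
    b.encard = d → Relation.ReflTransGen (FacetStep C d s) a b

/-- A simplex as an element of the face poset. -/
def simplexFace {V : Type u} {C : Set (Set V)} (s : Set V) (hs : s ∈ C) : FacePoset C :=
  ((⟨s, hs⟩ : C) : WithTop C)

theorem eq_top_or_simplexFace {V : Type u} {C : Set (Set V)} (F : FacePoset C) :
    F = ⊤ ∨ ∃ s hs, F = simplexFace s hs := by
  induction F using WithTop.recTopCoe with
  | top => exact Or.inl rfl
  | coe s => exact Or.inr ⟨s.1, s.2, rfl⟩

theorem simplexFace_le {V : Type u} {C : Set (Set V)} {s t : Set V} {hs : s ∈ C} {ht : t ∈ C} :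
    simplexFace s hs ≤ simplexFace t ht ↔ s ⊆ t := WithTop.coe_le_coe

theorem simplexFace_lt {V : Type u} {C : Set (Set V)} {s t : Set V} {hs : s ∈ C} {ht : t ∈ C} :
    simplexFace s hs < simplexFace t ht ↔ s ⊂ t := WithTop.coe_lt_coe

theorem simplexFace_lt_top {V : Type u} {C : Set (Set V)} {s : Set V} (hs : s ∈ C) :
    simplexFace s hs < ⊤ := WithTop.coe_lt_top _

theorem simplexFace_inj {V : Type u} {C : Set (Set V)} {s t : Set V} {hs : s ∈ C} {ht : t ∈ C} :
    simplexFace s hs = simplexFace t ht ↔ s = t := by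
  constructor
  · intro h
    exact congrArg Subtype.val (WithTop.coe_injective h)
  · rintro rfl; rfl

/-- The number of vertices of a simplex; the greatest face has one more than the facets. -/
noncomputable def simplexRank {V : Type u} {C : Set (Set V)} (d : ℕ) (F : FacePoset C) : ℕ :=
  WithTop.recTopCoe (C := fun _ => ℕ) (d + 1) (fun s => s.1.ncard) F

theorem simplexRank_simplexFace {V : Type u} {C : Set (Set V)} (d : ℕ) (s : Set V) (hs : s ∈ C) :
    simplexRank d (simplexFace s hs) = s.ncard := rfl

theorem simplexRank_top {V : Type u} {C : Set (Set V)} (d : ℕ) :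
    simplexRank d (⊤ : FacePoset C) = d + 1 := rfl

namespace IsSimplicialManifold

variable {V : Type u} {C : Set (Set V)} {d : ℕ} (h : IsSimplicialManifold C d)
include h

theorem finite {s : Set V} (hs : s ∈ C) : s.Finite := by
  obtain ⟨t, -, hst, ht⟩ := h.pure s hs
  have : t.Finite := by
    rw [← Set.encard_lt_top_iff, ht]
    exact ENat.natCast_lt_top d
  exact this.subset hst

theorem encard_eq_iff {s : Set V} (hs : s ∈ C) {k : ℕ} : s.encard = k ↔ s.ncard = k := by
  rw [← (h.finite hs).cast_ncard_eq]
  exact Nat.cast_inj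

theorem ncard_le {s : Set V} (hs : s ∈ C) : s.ncard ≤ d := by
  obtain ⟨t, htC, hst, ht⟩ := h.pure s hs
  rw [h.encard_eq_iff htC] at ht
  exact ht ▸ Set.ncard_le_ncard hst (h.finite htC)

theorem ncard_lt {s t : Set V} (ht : t ∈ C) (hst : s ⊂ t) : s.ncard < t.ncard :=
  Set.ncard_lt_ncard hst (h.finite ht)

theorem ranked : Ranked (simplexRank (C := C) d) (d + 1) where
  exists_bot := by
    refine ⟨simplexFace ∅ h.empty_mem, fun F => ?_, by simp [simplexRank_simplexFace]⟩
    rcases eq_top_or_simplexFace F with rfl | ⟨s, hs, rfl⟩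
    · exact le_top
    · exact simplexFace_le.2 (Set.empty_subset s)
  exists_top := ⟨⊤, fun _ => le_top, rfl⟩
  mono := fun F G hFG => by
    rcases eq_top_or_simplexFace F with rfl | ⟨s, hs, rfl⟩
    · exact absurd hFG le_top.not_gt
    rcases eq_top_or_simplexFace G with rfl | ⟨t, ht, rfl⟩
    · exact Nat.lt_succ_of_le (h.ncard_le hs)
    · exact h.ncard_lt ht (simplexFace_lt.1 hFG)
  dense := fun F G hFG hr => by
    rcases eq_top_or_simplexFace F with rfl | ⟨s, hs, rfl⟩
    · exact absurd hFG le_top.not_gt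
    rcases eq_top_or_simplexFace G with rfl | ⟨t, ht, rfl⟩
    · rw [simplexRank_simplexFace, simplexRank_top] at hr
      obtain ⟨t, htC, hst, ht⟩ := h.pure s hs
      rw [h.encard_eq_iff htC] at ht
      refine ⟨simplexFace t htC, simplexFace_lt.2 (hst.ssubset_of_ne ?_), simplexFace_lt_top _⟩
      rintro rfl
      omega
    · rw [simplexRank_simplexFace, simplexRank_simplexFace] at hr
      have hst := simplexFace_lt.1 hFG
      obtain ⟨x, hxt, hxs⟩ := Set.exists_of_ssubset hst
      have hsub := Set.insert_subset hxt hst.subset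
      refine ⟨simplexFace (insert x s) (h.down t ht _ hsub),
        simplexFace_lt.2 (Set.ssubset_insert hxs), simplexFace_lt.2 (hsub.ssubset_of_ne ?_)⟩
      rintro rfl
      rw [Set.ncard_insert_of_notMem hxs (h.finite hs)] at hr
      omega

theorem rk_simplexFace (s : Set V) (hs : s ∈ C) : rk (simplexFace s hs) = s.ncard :=
  h.ranked.rk_eq _

theorem rk_top : rk (⊤ : FacePoset C) = d + 1 := h.ranked.rk_eq _

/-- Below the greatest face this is the condition `ridge`. Below a simplex, the two middle faces
arise by adding one of the two missing vertices. -/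
theorem thin : Thin (simplexRank (C := C) d) := fun F G hFG hr => by
  rcases eq_top_or_simplexFace F with rfl | ⟨s, hs, rfl⟩
  · exact absurd hFG le_top.not_gt
  rcases eq_top_or_simplexFace G with rfl | ⟨t, ht, rfl⟩
  · rw [simplexRank_simplexFace, simplexRank_top] at hr
    rw [← h.ridge s hs (by
      have := (h.encard_eq_iff hs (k := s.ncard)).2 rfl
      rw [this]
      norm_cast
      omega)]
    have hinj : Function.Injective (fun a : C => (a : WithTop C)) := WithTop.coe_injective
    have e1 : {H : FacePoset C | simplexFace s hs < H ∧ H < ⊤} =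
        (fun a : C => (a : WithTop C)) '' {a | s ⊆ a.1 ∧ a.1.encard = d} := by
      ext H
      constructor
      · rintro ⟨h1, h2⟩
        rcases eq_top_or_simplexFace H with rfl | ⟨t, ht, rfl⟩
        · exact absurd h2 (lt_irrefl _)
        refine ⟨⟨t, ht⟩, ⟨(simplexFace_lt.1 h1).subset, ?_⟩, rfl⟩
        rw [h.encard_eq_iff ht]
        have := h.ncard_lt ht (simplexFace_lt.1 h1)
        have := h.ncard_le ht
        omega
      · rintro ⟨⟨t, ht⟩, ⟨h1, h2⟩, rfl⟩
        simp only at h1 h2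
        rw [h.encard_eq_iff ht] at h2
        refine ⟨simplexFace_lt.2 (h1.ssubset_of_ne ?_), simplexFace_lt_top ht⟩
        rintro rfl
        omega
    rw [e1, hinj.encard_image, ← Subtype.val_injective.encard_image]
    congr 1
    ext t
    constructor
    · rintro ⟨a, ha, rfl⟩
      exact ⟨a.2, ha.1, ha.2⟩
    · rintro ⟨h1, h2, h3⟩
      exact ⟨⟨t, h1⟩, ⟨h2, h3⟩, rfl⟩
  · rw [simplexRank_simplexFace, simplexRank_simplexFace] at hr
    have hst := simplexFace_lt.1 hFG
    have hdiff : (t \ s).ncard = 2 := by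
      rw [Set.ncard_sdiff hst.subset (h.finite hs)]
      omega
    obtain ⟨x, y, hxy, hd⟩ := Set.ncard_eq_two.1 hdiff
    have hx : x ∈ t \ s := by rw [hd]; simp
    have hy : y ∈ t \ s := by rw [hd]; simp
    have hsubx := Set.insert_subset hx.1 hst.subset
    have hsuby := Set.insert_subset hy.1 hst.subset
    have hxs : insert x s ∈ C := h.down t ht _ hsubx
    have hys : insert y s ∈ C := h.down t ht _ hsuby
    have hcx := Set.ncard_insert_of_notMem hx.2 (h.finite hs)
    have hcy := Set.ncard_insert_of_notMem hy.2 (h.finite hs)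
    rw [Set.encard_eq_two]
    refine ⟨simplexFace _ hxs, simplexFace _ hys, ?_, ?_⟩
    · rw [ne_eq, simplexFace_inj]
      intro e
      have : x ∈ insert y s := e ▸ Set.mem_insert x s
      exact this.elim hxy hx.2
    · ext H
      constructor
      · rintro ⟨h1, h2⟩
        rcases eq_top_or_simplexFace H with rfl | ⟨a, ha, rfl⟩
        · exact absurd h2 le_top.not_gt
        rw [simplexFace_lt] at h1 h2
        have c1 := h.ncard_lt ha h1
        have c2 := h.ncard_lt ht h2
        obtain ⟨z, hza, hzs⟩ := Set.exists_of_ssubset h1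
        have hz : z ∈ ({x, y} : Set V) := hd ▸ ⟨h2.subset hza, hzs⟩
        have hcz := Set.ncard_insert_of_notMem hzs (h.finite hs)
        have e : insert z s = a := Set.eq_of_subset_of_ncard_le
          (Set.insert_subset hza h1.subset) (by omega) (h.finite ha)
        rcases hz with rfl | rfl
        · exact Or.inl (simplexFace_inj.2 e.symm)
        · exact Or.inr (simplexFace_inj.2 e.symm)
      · rintro (rfl | rfl)
        · refine ⟨simplexFace_lt.2 (Set.ssubset_insert hx.2),
            simplexFace_lt.2 (hsubx.ssubset_of_ne ?_)⟩
          rintro rfl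
          omega
        · refine ⟨simplexFace_lt.2 (Set.ssubset_insert hy.2),
            simplexFace_lt.2 (hsuby.ssubset_of_ne ?_)⟩
          rintro rfl
          omega

/-- Below the greatest face, a path of facets through `s` is used: two consecutive facets meet in a
simplex that is strictly larger than `s` by cardinality. Below a simplex `t` with at least three
more vertices than `s`, the faces `s ∪ {x}` and `s ∪ {y}` are joined via `s ∪ {x, y}`. -/
theorem sectionConnected : SectionConnected (simplexRank (C := C) d) := by
  intro F G hFG hr A B hFA hAG hFB hBG
  rcases eq_top_or_simplexFace F with rfl | ⟨s, hs, rfl⟩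
  · exact absurd hFG le_top.not_gt
  rcases eq_top_or_simplexFace A with rfl | ⟨a, ha, rfl⟩
  · exact absurd hAG le_top.not_gt
  rcases eq_top_or_simplexFace B with rfl | ⟨b, hb, rfl⟩
  · exact absurd hBG le_top.not_gt
  rw [simplexFace_lt] at hFA hFB
  rcases eq_top_or_simplexFace G with rfl | ⟨t, ht, rfl⟩
  · rw [simplexRank_simplexFace, simplexRank_top] at hr
    obtain ⟨a', ha', haa', hca⟩ := h.pure a ha
    obtain ⟨b', hb', hbb', hcb⟩ := h.pure b hb
    have hpath := h.connected s hs (by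
      rw [(h.encard_eq_iff hs (k := s.ncard)).2 rfl]
      norm_cast
      omega) a' ha' b' hb' (hFA.subset.trans haa') (hFB.subset.trans hbb') hca hcb
    have key : ∀ c, Relation.ReflTransGen (FacetStep C d s) a' c → ∃ hc : c ∈ C, s ⊂ c ∧
        Relation.ReflTransGen (IncidentIn (simplexFace s hs) ⊤)
          (simplexFace a ha) (simplexFace c hc) := by
      intro c hc
      induction hc with
      | refl =>
        refine ⟨ha', hFA.trans_subset haa', Relation.ReflTransGen.single
          ⟨Or.inl (simplexFace_le.2 haa'), simplexFace_lt.2 (hFA.trans_subset haa'),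
            simplexFace_lt_top _⟩⟩
      | @tail c e _ hce ih =>
        obtain ⟨hc, hsc, hpc⟩ := ih
        obtain ⟨heC, hed, hse, hce⟩ := hce
        have hi : c ∩ e ∈ C := h.down e heC _ Set.inter_subset_right
        have hsi : s ⊂ c ∩ e := by
          refine (Set.subset_inter hsc.subset hse).ssubset_of_ne ?_
          intro e'
          rw [← e', (h.encard_eq_iff hs (k := s.ncard)).2 rfl] at hce
          norm_cast at hce
          omega
        have hse' : s ⊂ e := hsi.trans_subset Set.inter_subset_right
        exact ⟨heC, hse', (hpc.tail (c := simplexFace (c ∩ e) hi)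
          ⟨Or.inr (simplexFace_le.2 Set.inter_subset_left), simplexFace_lt.2 hsi,
            simplexFace_lt_top _⟩).tail ⟨Or.inl (simplexFace_le.2 Set.inter_subset_right),
            simplexFace_lt.2 hse', simplexFace_lt_top _⟩⟩
    obtain ⟨_, _, hp⟩ := key b' hpath
    exact hp.tail ⟨Or.inr (simplexFace_le.2 hbb'), simplexFace_lt.2 hFB, simplexFace_lt_top _⟩
  · rw [simplexRank_simplexFace, simplexRank_simplexFace] at hr
    rw [simplexFace_lt] at hFG hAG hBG
    obtain ⟨x, hxa, hxs⟩ := Set.exists_of_ssubset hFA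
    obtain ⟨y, hyb, hys⟩ := Set.exists_of_ssubset hFB
    have hsx : insert x s ⊆ a := Set.insert_subset hxa hFA.subset
    have hsy : insert y s ⊆ b := Set.insert_subset hyb hFB.subset
    have hsxy : insert x (insert y s) ⊂ t := by
      refine (Set.insert_subset (hAG.subset hxa) (hsy.trans hBG.subset)).ssubset_of_ne ?_
      rintro rfl
      have c1 := Set.ncard_insert_le x (insert y s)
      have c2 := Set.ncard_insert_le y s
      omega
    have hxC := h.down a ha _ hsx
    have hyC := h.down b hb _ hsy
    have hxyC := h.down t ht _ hsxy.subset
    refine ((((Relation.ReflTransGen.refl (a := simplexFace a ha)).tail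
      (c := simplexFace _ hxC) ?_).tail (c := simplexFace _ hxyC) ?_).tail
      (c := simplexFace _ hyC) ?_).tail ?_
    · exact ⟨Or.inr (simplexFace_le.2 hsx), simplexFace_lt.2 (Set.ssubset_insert hxs),
        simplexFace_lt.2 (hsx.trans_ssubset hAG)⟩
    · exact ⟨Or.inl (simplexFace_le.2 (Set.insert_subset_insert (Set.subset_insert _ _))),
        simplexFace_lt.2 ((Set.ssubset_insert hys).trans_subset (Set.subset_insert _ _)),
        simplexFace_lt.2 hsxy⟩
    · exact ⟨Or.inr (simplexFace_le.2 (Set.subset_insert _ _)),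
        simplexFace_lt.2 (Set.ssubset_insert hys), simplexFace_lt.2 (hsy.trans_ssubset hBG)⟩
    · exact ⟨Or.inl (simplexFace_le.2 hsy), simplexFace_lt.2 hFB, simplexFace_lt.2 hBG⟩

theorem isPolytope : IsPolytope (FacePoset C) d :=
  h.ranked.isPolytope h.thin h.sectionConnected

theorem mem_face_iff {F : FacePoset C} {j : ℕ} (hj : j < d) :
    F ∈ Face (FacePoset C) j ↔ ∃ s hs, F = simplexFace s hs ∧ s.ncard = j + 1 := by
  rw [AbstractPolytope.mem_face_iff]
  rcases eq_top_or_simplexFace F with rfl | ⟨s, hs, rfl⟩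
  · rw [h.rk_top]
    constructor
    · intro e; omega
    · rintro ⟨s, hs, e, -⟩
      exact absurd e (simplexFace_lt_top hs).ne'
  · rw [h.rk_simplexFace]
    constructor
    · intro e
      exact ⟨s, hs, rfl, by omega⟩
    · rintro ⟨t, ht, e, hc⟩
      rw [simplexFace_inj] at e
      subst e
      omega

theorem isSimplicial (hd : d ≠ 0) : IsSimplicial (FacePoset C) d := by
  intro F hF
  obtain ⟨k, rfl⟩ := Nat.exists_eq_succ_of_ne_zero hd
  obtain ⟨s, hs, rfl, hc⟩ := (h.mem_face_iff (Nat.lt_succ_self k)).1 (by simpa using hF)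
  have hfin := h.finite hs
  have e : s ≃ Fin (k + 1) := by
    have := hfin.fintype
    exact Fintype.equivFinOfCardEq (by rw [← Nat.card_eq_fintype_card, Nat.card_coe_set_eq, hc])
  have hsub : ∀ T : Finset (Fin (k + 1)), {x | ∃ hx : x ∈ s, e ⟨x, hx⟩ ∈ T} ⊆ s :=
    fun T x hx => hx.1
  let f : Finset (Fin (k + 1)) → Set.Iic (simplexFace s hs) := fun T =>
    ⟨simplexFace {x | ∃ hx : x ∈ s, e ⟨x, hx⟩ ∈ T} (h.down s hs _ (hsub T)),
      simplexFace_le.2 (hsub T)⟩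
  have hf : ∀ {S T : Finset (Fin (k + 1))}, f S ≤ f T ↔ S ≤ T := by
    intro S T
    change simplexFace _ _ ≤ simplexFace _ _ ↔ _
    rw [simplexFace_le]
    constructor
    · intro hST i hi
      have : (e.symm i : V) ∈ {x | ∃ hx : x ∈ s, e ⟨x, hx⟩ ∈ S} := ⟨(e.symm i).2, by simpa using hi⟩
      obtain ⟨_, h2⟩ := hST this
      simpa using h2
    · rintro hST x ⟨hx, hxS⟩
      exact ⟨hx, hST hxS⟩
  have hsurj : Function.Surjective f := by
    classical
    rintro ⟨F, hF⟩
    rcases eq_top_or_simplexFace F with rfl | ⟨t, ht, rfl⟩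
    · exact absurd (simplexFace_lt_top hs) (not_lt_of_ge hF)
    have hts := simplexFace_le.1 hF
    refine ⟨Finset.univ.filter fun i => (e.symm i : V) ∈ t, Subtype.ext (simplexFace_inj.2 ?_)⟩
    ext x
    simp only [Finset.mem_filter, Finset.mem_univ, true_and, Equiv.symm_apply_apply,
      Set.mem_ofPred_eq, exists_prop, and_iff_right_iff_imp]
    exact fun hx => hts hx
  exact ⟨(RelIso.ofSurjective (OrderEmbedding.ofMapLEIff f fun _ _ => hf) hsurj).symm⟩

theorem mem_vertexSet_iff (hd : d ≠ 0) {F : FacePoset C} {x : V} (hx : {x} ∈ C) :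
    simplexFace {x} hx ∈ vertexSet F ↔ simplexFace {x} hx ≤ F := by
  refine ⟨fun h => h.2, fun h' => ⟨?_, h'⟩⟩
  have := (h.mem_face_iff (j := 0) (by omega)).2 ⟨{x}, hx, rfl, by simp⟩
  exact_mod_cast this

/-- The only danger is that a simplex contains all vertices, like the greatest face. The second
facet through a ridge of a facet has a vertex outside that facet, which excludes this. -/
theorem isVertexDescribable (hd : d ≠ 0) : IsVertexDescribable (FacePoset C) := by
  intro F G
  constructor
  · exact fun hFG v hv => ⟨hv.1, hv.2.trans hFG⟩
  intro hFG
  have hFG' : ∀ x (hx : {x} ∈ C), simplexFace {x} hx ≤ F → simplexFace {x} hx ≤ G := by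
    intro x hx hxF
    exact (hFG ((h.mem_vertexSet_iff hd hx).2 hxF)).2
  rcases eq_top_or_simplexFace G with rfl | ⟨t, ht, rfl⟩
  · exact le_top
  rcases eq_top_or_simplexFace F with rfl | ⟨s, hs, rfl⟩
  · exfalso
    obtain ⟨t', ht', htt', hcard⟩ := h.pure t ht
    have hcard' := (h.encard_eq_iff ht').1 hcard
    obtain ⟨x, hx⟩ : t'.Nonempty := Set.nonempty_of_ncard_ne_zero (by omega)
    have hr : t' \ {x} ∈ C := h.down t' ht' _ Set.sdiff_subset
    have hrc := h.ridge _ hr (by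
      rw [Set.encard_sdiff_singleton_add_one hx, hcard])
    obtain ⟨p, q, hpq, hset⟩ := Set.encard_eq_two.1 hrc
    obtain ⟨t'', ht'', hne⟩ : ∃ t'' ∈ {t | t ∈ C ∧ t' \ {x} ⊆ t ∧ t.encard = d}, t'' ≠ t' := by
      rw [hset]
      by_cases e : p = t'
      · exact ⟨q, by simp, fun e' => hpq (e.trans e'.symm)⟩
      · exact ⟨p, by simp, e⟩
    have hns : ¬ t'' ⊆ t' := fun hs => hne (Set.eq_of_subset_of_ncard_le hs
      (by rw [hcard', (h.encard_eq_iff ht''.1).1 ht''.2.2]) (h.finite ht'))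
    obtain ⟨y, hy, hyt⟩ := Set.not_subset.1 hns
    have hyC : {y} ∈ C := h.down _ ht''.1 _ (Set.singleton_subset_iff.2 hy)
    have := simplexFace_le.1 (hFG' y hyC le_top)
    exact hyt (htt' (this rfl))
  · refine simplexFace_le.2 fun x hx => ?_
    have hxC : {x} ∈ C := h.down _ hs _ (Set.singleton_subset_iff.2 hx)
    exact simplexFace_le.1 (hFG' x hxC (simplexFace_le.2 (Set.singleton_subset_iff.2 hx))) rfl

end IsSimplicialManifold

end AbstractPolytope

/-! ### Order complexes of polytopes -/

namespace AbstractPolytope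

section OrderComplex

variable {L : Type u} [PartialOrder L] {m : ℕ} (hL : IsPolytope L m)
include hL

theorem IsPolytope.proper_iff {F : L} : (¬ IsBot F ∧ ¬ IsTop F) ↔ 1 ≤ rk F ∧ rk F ≤ m := by
  have h1 : IsBot F ↔ rk F = 0 := ⟨hL.ranked.rank_of_isBot, hL.ranked.isBot_of_rank⟩
  have h2 : IsTop F ↔ rk F = m + 1 := ⟨hL.ranked.rank_of_isTop, hL.ranked.isTop_of_rank⟩
  have := hL.rk_le F
  rw [h1, h2]
  omega

theorem IsPolytope.mem_flagSimplex {Φ : Flag L} {F : L} :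
    F ∈ flagSimplex Φ ↔ F ∈ Φ ∧ 1 ≤ rk F ∧ rk F ≤ m := by
  rw [← hL.proper_iff]
  exact Iff.rfl

theorem IsPolytope.mem_orderComplex {s : Set L} :
    s ∈ orderComplex L ↔ IsChain (· ≤ ·) s ∧ ∀ F ∈ s, 1 ≤ rk F ∧ rk F ≤ m := by
  simp only [← hL.proper_iff]
  exact Iff.rfl

theorem IsPolytope.flagSimplex_mem (Φ : Flag L) : flagSimplex Φ ∈ orderComplex L :=
  hL.mem_orderComplex.2 ⟨Φ.chain_le.mono fun _ h => h.1, fun _ h => (hL.mem_flagSimplex.1 h).2⟩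

theorem IsPolytope.flagSimplex_encard (Φ : Flag L) : (flagSimplex Φ).encard = m := by
  have hinj : Set.InjOn rk (flagSimplex Φ) := fun F hF G hG e =>
    flag_eq_of_rank_eq hL.rk_strictMono hF.1 hG.1 e
  have himg : rk '' flagSimplex Φ = Set.Icc 1 m := by
    ext k
    constructor
    · rintro ⟨F, hF, rfl⟩
      exact (hL.mem_flagSimplex.1 hF).2
    · intro hk
      obtain ⟨F, hF, e⟩ := hL.ranked.exists_mem_flag Φ (k := k) (by have := hk.2; omega)
      exact ⟨F, hL.mem_flagSimplex.2 ⟨hF, by rw [e]; exact hk⟩, e⟩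
  rw [← hinj.encard_image, himg, Set.encard_eq_coe_toFinset_card]
  simp

theorem IsPolytope.flagSimplex_finite (Φ : Flag L) : (flagSimplex Φ).Finite := by
  rw [← Set.encard_lt_top_iff, hL.flagSimplex_encard]
  exact ENat.natCast_lt_top m

omit hL in
theorem exists_flagSimplex_superset {s : Set L} (hs : s ∈ orderComplex L) :
    ∃ Φ : Flag L, s ⊆ flagSimplex Φ := by
  obtain ⟨Φ, hΦ⟩ := hs.1.exists_subset_flag
  exact ⟨Φ, fun F hF => ⟨hΦ hF, hs.2 F hF⟩⟩

theorem IsPolytope.exists_eq_flagSimplex {s : Set L} (hs : s ∈ orderComplex L)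
    (hm : s.encard = m) : ∃ Φ : Flag L, s = flagSimplex Φ := by
  obtain ⟨Φ, hΦ⟩ := exists_flagSimplex_superset hs
  exact ⟨Φ, (hL.flagSimplex_finite Φ).eq_of_subset_of_encard_le' hΦ
    (by rw [hm, hL.flagSimplex_encard])⟩

omit hL in
theorem subset_flag_iff {s : Set L} (hs : s ∈ orderComplex L) {Φ : Flag L} :
    s ⊆ flagSimplex Φ ↔ s ⊆ (Φ : Set L) :=
  ⟨fun h _ hF => (h hF).1, fun h _ hF => ⟨h hF, hs.2 _ hF⟩⟩

omit hL in
theorem flag_subset_of_flagSimplex {Φ Ψ : Flag L} {H : L}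
    (h : ∀ F ∈ flagSimplex Φ, F ≠ H → F ∈ Ψ) : ∀ F ∈ Φ, F ≠ H → F ∈ Ψ := by
  intro F hF hFH
  by_cases hp : ¬ IsBot F ∧ ¬ IsTop F
  · exact h F ⟨hF, hp⟩ hFH
  · rw [not_and_or, not_not, not_not] at hp
    rcases hp with hp | hp
    · exact mem_flag_of_isBot hp Ψ
    · exact mem_flag_of_isTop hp Ψ

omit hL in
theorem flagSimplex_injective :
    Function.Injective (flagSimplex : Flag L → Set L) := by
  intro Φ Ψ h
  refine Flag.ext (Φ.max_chain' Ψ.chain_le fun F hF => ?_)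
  by_cases hp : ¬ IsBot F ∧ ¬ IsTop F
  · have : F ∈ flagSimplex Φ := ⟨hF, hp⟩
    rw [h] at this
    exact this.1
  · rw [not_and_or, not_not, not_not] at hp
    rcases hp with hp | hp
    · exact mem_flag_of_isBot hp Ψ
    · exact mem_flag_of_isTop hp Ψ

/-- A chain that misses a single proper rank is completed by a middle face of the diamond at that
rank. -/
theorem IsPolytope.orderComplex_ridge {s : Set L} (hs : s ∈ orderComplex L)
    (hc : s.encard + 1 = m) :
    {t | t ∈ orderComplex L ∧ s ⊆ t ∧ t.encard = m}.encard = 2 := by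
  obtain ⟨Φ, hΦ⟩ := exists_flagSimplex_superset hs
  have hfin := (hL.flagSimplex_finite Φ).subset hΦ
  obtain ⟨H, hH⟩ : ∃ H, flagSimplex Φ \ s = {H} := by
    rw [← Set.encard_eq_one]
    have := Set.encard_sdiff_add_encard_of_subset hΦ
    rw [hL.flagSimplex_encard, ← hc, add_comm] at this
    exact ENat.add_right_injective_of_ne_top (Set.encard_ne_top_iff.2 hfin) this
  have hHm : H ∈ flagSimplex Φ \ s := by rw [hH]; rfl
  obtain ⟨hHΦ, hH1, hHm'⟩ := hL.mem_flagSimplex.1 hHm.1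
  have hmem : ∀ E ∈ flagSimplex Φ, E ≠ H → E ∈ s := fun E hE hne => by
    by_contra hEs
    have : E ∈ flagSimplex Φ \ s := ⟨hE, hEs⟩
    rw [hH] at this
    exact hne this
  obtain ⟨F, hF, hFr⟩ := hL.ranked.exists_mem_flag Φ (k := rk H - 1) (by omega)
  obtain ⟨G, hG, hGr⟩ := hL.ranked.exists_mem_flag Φ (k := rk H + 1) (by omega)
  have hFH := flag_lt_of_rank_lt hL.rk_strictMono hF hHΦ (by omega)
  have hHG := flag_lt_of_rank_lt hL.rk_strictMono hHΦ hG (by omega)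
  have hns : ∀ H', F < H' → H' < G → H' ∉ s := by
    intro H' h1 h2 h3
    have e1 := hL.rk_strictMono h1
    have e2 := hL.rk_strictMono h2
    have := flag_eq_of_rank_eq hL.rk_strictMono (hΦ h3).1 hHΦ (by omega)
    exact hHm.2 (this ▸ h3)
  have hinj : Set.InjOn (fun H' => insert H' s) {H' | F < H' ∧ H' < G} := by
    intro A hA B hB hAB
    have : A ∈ insert B s := by
      rw [← show insert A s = insert B s from hAB]
      exact Set.mem_insert _ _
    exact this.resolve_right (hns A hA.1 hA.2)
  rw [← hL.thin F G (hFH.trans hHG) (by omega), ← hinj.encard_image]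
  congr 1
  ext t
  constructor
  · rintro ⟨htC, hst, ht⟩
    obtain ⟨Ψ, rfl⟩ := hL.exists_eq_flagSimplex htC ht
    have hsub := flag_subset_of_flagSimplex (Ψ := Ψ) (H := H) fun E hE hne =>
      (hst (hmem E hE hne)).1
    have hFΨ := hsub F hF hFH.ne
    have hGΨ := hsub G hG hHG.ne'
    obtain ⟨H', hH'Ψ, hH'r⟩ := hL.ranked.exists_mem_flag Ψ (k := rk H) (by omega)
    have h1 := flag_lt_of_rank_lt hL.rk_strictMono hFΨ hH'Ψ (by omega)
    have h2 := flag_lt_of_rank_lt hL.rk_strictMono hH'Ψ hGΨ (by omega)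
    refine ⟨H', ⟨h1, h2⟩, ?_⟩
    refine (hL.flagSimplex_finite Ψ).eq_of_subset_of_encard_le'
      (Set.insert_subset (hL.mem_flagSimplex.2 ⟨hH'Ψ, by omega⟩) hst) ?_
    rw [Set.encard_insert_of_notMem (hns H' h1 h2), hc, ht]
  · rintro ⟨H', ⟨h1, h2⟩, rfl⟩
    obtain ⟨Φ', hΦ'⟩ := hL.ranked.exists_exchange hF hHΦ hG h1 h2 (by omega) (by omega)
    have e1 := hL.rk_strictMono h1
    have e2 := hL.rk_strictMono h2
    refine ⟨?_, Set.subset_insert _ _, ?_⟩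
    · rw [hL.mem_orderComplex]
      refine ⟨Φ'.chain_le.mono ?_, ?_⟩
      · rw [hΦ']
        exact Set.insert_subset_insert fun E hE => ⟨(hΦ hE).1, fun e => hHm.2 (e ▸ hE)⟩
      · rintro E (rfl | hE)
        · omega
        · exact (hL.mem_orderComplex.1 hs).2 E hE
    · change (insert H' s).encard = m
      rw [Set.encard_insert_of_notMem (hns H' h1 h2), hc]

/-- The facets correspond to the flags and their steps to adjacency, so connectedness of stars is
strong flag-connectedness of `L`. -/
theorem IsPolytope.orderComplex_isSimplicialManifold :
    IsSimplicialManifold (orderComplex L) m where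
  down := fun s hs t hts => ⟨hs.1.mono hts, fun F hF => hs.2 F (hts hF)⟩
  empty_mem := ⟨IsChain.empty, fun F hF => absurd hF (Set.notMem_empty F)⟩
  pure := fun s hs => by
    obtain ⟨Φ, hΦ⟩ := exists_flagSimplex_superset hs
    exact ⟨_, hL.flagSimplex_mem Φ, hΦ, hL.flagSimplex_encard Φ⟩
  ridge := fun s hs hc => hL.orderComplex_ridge hs hc
  connected := fun s hs _ a ha b hb hsa hsb hca hcb => by
    obtain ⟨Φ, rfl⟩ := hL.exists_eq_flagSimplex ha hca
    obtain ⟨Ψ, rfl⟩ := hL.exists_eq_flagSimplex hb hcb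
    have hpath := (hL.flagConnected Φ Ψ).mono (K := s)
      (Set.subset_inter (fun F hF => (hsa hF).1) fun F hF => (hsb hF).1)
    refine Relation.ReflTransGen.lift (fun Φ : Flag L => flagSimplex Φ) ?_ _ _ hpath
    rintro Ξ Θ ⟨hadj, hsub⟩
    refine ⟨hL.flagSimplex_mem Θ, hL.flagSimplex_encard Θ, (subset_flag_iff hs).2 hsub, ?_⟩
    obtain ⟨A, hA⟩ := hadj.exists_eq
    have : flagSimplex Ξ ⊆ insert A (flagSimplex Ξ ∩ flagSimplex Θ) := by
      intro E hE
      by_cases hEΘ : E ∈ Θ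
      · exact Or.inr ⟨hE, hEΘ, hE.2⟩
      · left
        have : E ∈ (Ξ : Set L) \ Θ := ⟨hE.1, hEΘ⟩
        rw [hA] at this
        exact this
    rw [← hL.flagSimplex_encard Ξ]
    exact (Set.encard_le_encard this).trans (Set.encard_insert_le _ _)

end OrderComplex

/-! ### Stellar subdivision of a facet -/

section Stellar

variable {V : Type u}

/-- A set of old vertices in the stellar subdivision. -/
abbrev oldSet (τ : Set V) : Set (Option V) := some '' τ

/-- A set of old vertices together with the new vertex. -/
abbrev newSet (τ : Set V) : Set (Option V) := insert none (some '' τ)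

theorem eq_oldSet_or_newSet (S : Set (Option V)) : (∃ τ, S = oldSet τ) ∨ ∃ τ, S = newSet τ := by
  by_cases h : none ∈ S
  · right
    refine ⟨some ⁻¹' S, ?_⟩
    ext (_ | x) <;> simp [h]
  · left
    refine ⟨some ⁻¹' S, ?_⟩
    ext (_ | x) <;> simp [h]

theorem oldSet_subset_oldSet {τ ρ : Set V} : oldSet τ ⊆ oldSet ρ ↔ τ ⊆ ρ :=
  Set.image_subset_image_iff (Option.some_injective V)

theorem some_mem_newSet {τ : Set V} {x : V} : some x ∈ newSet τ ↔ x ∈ τ := by simp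

theorem some_mem_oldSet {τ : Set V} {x : V} : some x ∈ oldSet τ ↔ x ∈ τ := by simp

theorem none_notMem_oldSet {τ : Set V} : none ∉ oldSet τ := by simp

theorem none_mem_newSet {τ : Set V} : none ∈ newSet τ := by simp

theorem oldSet_subset_newSet {τ ρ : Set V} : oldSet τ ⊆ newSet ρ ↔ τ ⊆ ρ := by
  constructor
  · intro h x hx
    exact some_mem_newSet.1 (h (some_mem_oldSet.2 hx))
  · rintro h _ ⟨x, hx, rfl⟩
    exact some_mem_newSet.2 (h hx)

theorem newSet_subset_newSet {τ ρ : Set V} : newSet τ ⊆ newSet ρ ↔ τ ⊆ ρ := by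
  constructor
  · intro h x hx
    exact some_mem_newSet.1 (h (some_mem_newSet.2 hx))
  · rintro h (_ | x) hx
    · exact none_mem_newSet
    · exact some_mem_newSet.2 (h (some_mem_newSet.1 hx))

theorem not_newSet_subset_oldSet {τ ρ : Set V} : ¬ newSet τ ⊆ oldSet ρ :=
  fun h => none_notMem_oldSet (h none_mem_newSet)

theorem oldSet_injective : Function.Injective (oldSet : Set V → Set (Option V)) :=
  (Option.some_injective V).image_injective

theorem newSet_injective : Function.Injective (newSet : Set V → Set (Option V)) := fun _ _ h =>
  (newSet_subset_newSet.1 h.le).antisymm (newSet_subset_newSet.1 h.ge)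

theorem oldSet_ne_newSet {τ ρ : Set V} : oldSet τ ≠ newSet ρ := fun h =>
  not_newSet_subset_oldSet h.ge

theorem encard_oldSet (τ : Set V) : (oldSet τ).encard = τ.encard :=
  (Option.some_injective V).encard_image τ

theorem encard_newSet (τ : Set V) : (newSet τ).encard = τ.encard + 1 := by
  rw [newSet, Set.encard_insert_of_notMem none_notMem_oldSet, encard_oldSet]

theorem oldSet_mem {C : Set (Set V)} {σ τ : Set V} :
    oldSet τ ∈ stellarSubdivision C σ ↔ τ ∈ C ∧ τ ≠ σ := by
  constructor
  · rintro (⟨ρ, h1, h2, h⟩ | ⟨ρ, -, h⟩)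
    · rw [oldSet_injective h]
      exact ⟨h1, h2⟩
    · exact absurd h oldSet_ne_newSet
  · exact fun h => Or.inl ⟨τ, h.1, h.2, rfl⟩

theorem newSet_mem {C : Set (Set V)} {σ τ : Set V} :
    newSet τ ∈ stellarSubdivision C σ ↔ τ ⊂ σ := by
  constructor
  · rintro (⟨ρ, h1, h2, h⟩ | ⟨ρ, h1, h⟩)
    · exact absurd h.symm oldSet_ne_newSet
    · rw [newSet_injective h]
      exact h1
  · exact fun h => Or.inr ⟨τ, h, rfl⟩

/-- `FacetStep` restricts only the target of a step, so reversing a path requires the conditions at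
its starting facet as well. -/
theorem FacetStep.reverse_path {C : Set (Set V)} {d : ℕ} {s a b : Set V} (ha : a ∈ C)
    (hd : a.encard = d) (hsa : s ⊆ a) (h : Relation.ReflTransGen (FacetStep C d s) a b) :
    Relation.ReflTransGen (FacetStep C d s) b a := by
  have key : (b ∈ C ∧ b.encard = d ∧ s ⊆ b) ∧ Relation.ReflTransGen (FacetStep C d s) b a := by
    induction h with
    | refl => exact ⟨⟨ha, hd, hsa⟩, Relation.ReflTransGen.refl⟩
    | tail _ hbc ih =>
      obtain ⟨h1, h2, h3, h4⟩ := hbc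
      refine ⟨⟨h1, h2, h3⟩, ih.2.head ⟨ih.1.1, ih.1.2.1, ih.1.2.2, ?_⟩⟩
      rwa [Set.inter_comm]
  exact key.2

variable {C : Set (Set V)} {d : ℕ} (h : IsSimplicialManifold C d) {σ : Set V} (hσ : σ ∈ C)
  (hσd : σ.encard = d)
include h hσ hσd

omit h hσ in
theorem exists_eq_diff_singleton {ρ : Set V} (hρ : ρ ⊆ σ) (hc : ρ.encard + 1 = d) :
    ∃ x ∈ σ, x ∉ ρ ∧ ρ = σ \ {x} := by
  have hfin : ρ.Finite := by
    rw [← Set.encard_lt_top_iff]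
    refine lt_of_le_of_lt (b := (d : ℕ∞)) ?_ (ENat.natCast_lt_top d)
    rw [← hc]
    exact le_self_add
  obtain ⟨x, hx⟩ : ∃ x, σ \ ρ = {x} := by
    rw [← Set.encard_eq_one]
    have := Set.encard_sdiff_add_encard_of_subset hρ
    rw [hσd, ← hc, add_comm] at this
    exact ENat.add_right_injective_of_ne_top (Set.encard_ne_top_iff.2 hfin) this
  have hx' : x ∈ σ \ ρ := by rw [hx]; rfl
  exact ⟨x, hx'.1, hx'.2, by rw [← hx, Set.sdiff_sdiff_cancel_left hρ]⟩

theorem eq_of_facet_subset {t : Set V} (ht : t ∈ C) (hst : σ ⊆ t) : t = σ := by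
  symm
  apply Set.eq_of_subset_of_ncard_le hst _ (h.finite ht)
  rw [(h.encard_eq_iff hσ).1 hσd]
  exact h.ncard_le ht

theorem encard_lt_of_ssubset {τ : Set V} (hτ : τ ⊂ σ) : τ.encard + 1 ≤ d := by
  rw [← hσd]
  exact Order.add_one_le_of_lt (((h.finite hσ).subset hτ.subset).encard_lt_encard hτ)

/-- For an old ridge in `σ`, the facet `σ` is replaced by the cone over the ridge; for other old
ridges nothing changes. A ridge with the new vertex omits two vertices of `σ`, and either of them
can be added. -/
theorem stellar_ridge (S : Set (Option V)) (hS : S ∈ stellarSubdivision C σ)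
    (hc : S.encard + 1 = d) :
    {t | t ∈ stellarSubdivision C σ ∧ S ⊆ t ∧ t.encard = d}.encard = 2 := by
  have cancel : ∀ {a b : ℕ∞}, a + 1 = b + 1 → a = b := fun h =>
    ENat.add_left_injective_of_ne_top ENat.one_ne_top h
  rcases eq_oldSet_or_newSet S with ⟨τ, rfl⟩ | ⟨τ, rfl⟩
  · obtain ⟨hτ, hτσ⟩ := oldSet_mem.1 hS
    rw [encard_oldSet] at hc
    have hrC := h.ridge τ hτ hc
    obtain ⟨p, q, hpq, hset⟩ := Set.encard_eq_two.1 hrC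
    have hiff : ∀ t, (t ∈ C ∧ τ ⊆ t ∧ t.encard = d) ↔ t = p ∨ t = q := fun t => by
      have : t ∈ {t | t ∈ C ∧ τ ⊆ t ∧ t.encard = d} ↔ t ∈ ({p, q} : Set (Set V)) := by rw [hset]
      exact this
    by_cases hsub : τ ⊆ σ
    · have hss := hsub.ssubset_of_ne hτσ
      obtain ⟨a, haσ, ha⟩ : ∃ a, a ≠ σ ∧ ∀ t, (t ∈ C ∧ τ ⊆ t ∧ t.encard = d) ↔ t = σ ∨ t = a := by
        rcases (hiff σ).1 ⟨hσ, hsub, hσd⟩ with rfl | rfl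
        · exact ⟨q, hpq.symm, hiff⟩
        · exact ⟨p, hpq, fun t => by rw [hiff, or_comm]⟩
      obtain ⟨haC, hτa, had⟩ := (ha a).2 (Or.inr rfl)
      rw [Set.encard_eq_two]
      refine ⟨oldSet a, newSet τ, oldSet_ne_newSet, ?_⟩
      ext T
      constructor
      · rintro ⟨hT, hST, hTd⟩
        rcases eq_oldSet_or_newSet T with ⟨t, rfl⟩ | ⟨t, rfl⟩
        · obtain ⟨htC, htσ⟩ := oldSet_mem.1 hT
          rw [encard_oldSet] at hTd
          rcases (ha t).1 ⟨htC, oldSet_subset_oldSet.1 hST, hTd⟩ with e | e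
          · exact absurd e htσ
          · exact Or.inl (by rw [e])
        · right
          have hts := newSet_mem.1 hT
          rw [encard_newSet, ← hc] at hTd
          have hτt := oldSet_subset_newSet.1 hST
          have e : τ = t := ((h.finite hσ).subset hts.subset).eq_of_subset_of_encard_le' hτt
            (cancel hTd).le
          exact congrArg newSet e.symm
      · rintro (rfl | rfl)
        · exact ⟨oldSet_mem.2 ⟨haC, haσ⟩, oldSet_subset_oldSet.2 hτa, by rw [encard_oldSet, had]⟩
        · exact ⟨newSet_mem.2 hss, oldSet_subset_newSet.2 le_rfl, by rw [encard_newSet, hc]⟩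
    · rw [Set.encard_eq_two]
      refine ⟨oldSet p, oldSet q, fun e => hpq (oldSet_injective e), ?_⟩
      ext T
      constructor
      · rintro ⟨hT, hST, hTd⟩
        rcases eq_oldSet_or_newSet T with ⟨t, rfl⟩ | ⟨t, rfl⟩
        · obtain ⟨htC, htσ⟩ := oldSet_mem.1 hT
          rw [encard_oldSet] at hTd
          rcases (hiff t).1 ⟨htC, oldSet_subset_oldSet.1 hST, hTd⟩ with e | e
          · exact Or.inl (by rw [e])
          · exact Or.inr (by rw [e]; rfl)
        · exact absurd ((oldSet_subset_newSet.1 hST).trans (newSet_mem.1 hT).subset) hsub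
      · have key : ∀ t, t = p ∨ t = q → oldSet t ∈ {t | t ∈ stellarSubdivision C σ ∧
            oldSet τ ⊆ t ∧ t.encard = d} := by
          intro t ht
          obtain ⟨h1, h2, h3⟩ := (hiff t).2 ht
          refine ⟨oldSet_mem.2 ⟨h1, ?_⟩, oldSet_subset_oldSet.2 h2, by rw [encard_oldSet, h3]⟩
          rintro rfl
          exact hsub h2
        rintro (rfl | rfl)
        · exact key _ (Or.inl rfl)
        · exact key _ (Or.inr rfl)
  · have hss := newSet_mem.1 hS
    rw [encard_newSet] at hc
    have hfin := (h.finite hσ).subset hss.subset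
    obtain ⟨x, y, hxy, hd⟩ : ∃ x y, x ≠ y ∧ σ \ τ = {x, y} := by
      rw [← Set.encard_eq_two]
      have := Set.encard_sdiff_add_encard_of_subset hss.subset
      rw [hσd, ← hc, add_comm, add_assoc] at this
      exact ENat.add_right_injective_of_ne_top (Set.encard_ne_top_iff.2 hfin) this
    have hx : x ∈ σ \ τ := by rw [hd]; simp
    have hy : y ∈ σ \ τ := by rw [hd]; simp
    have hins : ∀ z ∈ σ \ τ, newSet (insert z τ) ∈ {t | t ∈ stellarSubdivision C σ ∧
        newSet τ ⊆ t ∧ t.encard = d} := by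
      intro z hz
      have hcard : (insert z τ).encard + 1 = d := by rw [Set.encard_insert_of_notMem hz.2, hc]
      refine ⟨newSet_mem.2 ((Set.insert_subset hz.1 hss.subset).ssubset_of_ne ?_),
        newSet_subset_newSet.2 (Set.subset_insert _ _), by rw [encard_newSet, hcard]⟩
      intro e
      rw [e, hσd] at hcard
      norm_cast at hcard
      omega
    rw [Set.encard_eq_two]
    refine ⟨newSet (insert x τ), newSet (insert y τ), fun e => ?_, ?_⟩
    · have : x ∈ insert y τ := by rw [← newSet_injective e]; exact Set.mem_insert _ _
      exact this.elim hxy hx.2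
    · ext T
      constructor
      · rintro ⟨hT, hST, hTd⟩
        rcases eq_oldSet_or_newSet T with ⟨t, rfl⟩ | ⟨t, rfl⟩
        · exact absurd hST not_newSet_subset_oldSet
        · have hts := newSet_mem.1 hT
          have htf := (h.finite hσ).subset hts.subset
          rw [encard_newSet, ← hc] at hTd
          have hτt := newSet_subset_newSet.1 hST
          have hcard := cancel hTd
          obtain ⟨z, hzt, hzτ⟩ : ∃ z ∈ t, z ∉ τ := by
            by_contra hcon
            push Not at hcon
            have : t = τ := Set.Subset.antisymm hcon hτt
            rw [this, ← hfin.cast_ncard_eq] at hcard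
            norm_cast at hcard
            omega
          have hz : z ∈ ({x, y} : Set V) := hd ▸ ⟨hts.subset hzt, hzτ⟩
          have e : insert z τ = t := htf.eq_of_subset_of_encard_le' (Set.insert_subset hzt hτt)
            (by rw [Set.encard_insert_of_notMem hzτ, hcard])
          rcases hz with rfl | rfl
          · exact Or.inl (by rw [e])
          · exact Or.inr (by rw [e]; rfl)
      · rintro (rfl | rfl)
        · exact hins x hx
        · exact hins y hy

-- The new facets are pairwise adjacent: each omits one vertex of `σ`.
omit h hσ in
theorem newSet_step {S : Set (Option V)} {x y : V} (hy : y ∈ σ)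
    (hS : S ⊆ newSet (σ \ {y})) :
    FacetStep (stellarSubdivision C σ) d S (newSet (σ \ {x})) (newSet (σ \ {y})) := by
  refine ⟨newSet_mem.2 (Set.sdiff_singleton_ssubset.2 hy), ?_, hS, ?_⟩
  · rw [encard_newSet, Set.encard_sdiff_singleton_add_one hy, hσd]
  · have hsub : newSet (σ \ {y}) ⊆ insert (some x) (newSet (σ \ {x}) ∩ newSet (σ \ {y})) := by
      rintro (_ | z) hz
      · exact Or.inr ⟨none_mem_newSet, none_mem_newSet⟩
      · by_cases e : z = x
        · exact Or.inl (by rw [e])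
        · have hz' := some_mem_newSet.1 hz
          exact Or.inr ⟨some_mem_newSet.2 ⟨hz'.1, e⟩, hz⟩
    refine le_trans (le_of_eq ?_) ((Set.encard_le_encard hsub).trans (Set.encard_insert_le _ _))
    rw [encard_newSet, Set.encard_sdiff_singleton_add_one hy, hσd]

/-- If the simplex is not contained in `σ`, its star is the old one. If it contains the new vertex,
its facets are all new and pairwise adjacent. For an old simplex in `σ`, old paths are rerouted
around the deleted facet through the new ones. -/
theorem stellar_connected (S : Set (Option V)) (hS : S ∈ stellarSubdivision C σ)
    (hc : S.encard + 2 ≤ d) (A : Set (Option V)) (hA : A ∈ stellarSubdivision C σ)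
    (B : Set (Option V)) (hB : B ∈ stellarSubdivision C σ) (hSA : S ⊆ A) (hSB : S ⊆ B)
    (hAd : A.encard = d) (hBd : B.encard = d) :
    Relation.ReflTransGen (FacetStep (stellarSubdivision C σ) d S) A B := by
  have hnew : ∀ ρ, newSet ρ ∈ stellarSubdivision C σ → (newSet ρ).encard = d →
      ∃ x ∈ σ, x ∉ ρ ∧ ρ = σ \ {x} := fun ρ h1 h2 =>
    exists_eq_diff_singleton hσd (newSet_mem.1 h1).subset (by rw [← encard_newSet, h2])
  rcases eq_oldSet_or_newSet S with ⟨τ, rfl⟩ | ⟨τ, rfl⟩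
  · obtain ⟨hτ, hτσ⟩ := oldSet_mem.1 hS
    rw [encard_oldSet] at hc
    by_cases hsub : τ ⊆ σ
    · obtain ⟨x₀, hx₀, hx₀τ⟩ := Set.exists_of_ssubset (hsub.ssubset_of_ne hτσ)
      have hhub : newSet (σ \ {x₀}) ∈ stellarSubdivision C σ ∧ (newSet (σ \ {x₀})).encard = d ∧
          oldSet τ ⊆ newSet (σ \ {x₀}) :=
        ⟨newSet_mem.2 (Set.sdiff_singleton_ssubset.2 hx₀), by
          rw [encard_newSet, Set.encard_sdiff_singleton_add_one hx₀, hσd],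
          oldSet_subset_newSet.2 (Set.subset_sdiff_singleton hsub hx₀τ)⟩
      have key : ∀ A ∈ stellarSubdivision C σ, A.encard = d → oldSet τ ⊆ A →
          Relation.ReflTransGen (FacetStep (stellarSubdivision C σ) d (oldSet τ))
            (newSet (σ \ {x₀})) A := by
        intro A hA hAd hSA
        rcases eq_oldSet_or_newSet A with ⟨a, rfl⟩ | ⟨ρ, rfl⟩
        · obtain ⟨haC, haσ⟩ := oldSet_mem.1 hA
          rw [encard_oldSet] at hAd
          have hpath := h.connected τ hτ hc σ hσ a haC hsub (oldSet_subset_oldSet.1 hSA) hσd hAd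
          have ind : ∀ b, Relation.ReflTransGen (FacetStep C d τ) σ b → b = σ ∨
              Relation.ReflTransGen (FacetStep (stellarSubdivision C σ) d (oldSet τ))
                (newSet (σ \ {x₀})) (oldSet b) := by
            intro b hb
            induction hb with
            | refl => exact Or.inl rfl
            | @tail b c _ hbc ih =>
              obtain ⟨hcC, hcd, hτc, hint⟩ := hbc
              by_cases hcσ : c = σ
              · exact Or.inl hcσ
              right
              have hcmem : oldSet c ∈ stellarSubdivision C σ := oldSet_mem.2 ⟨hcC, hcσ⟩
              rcases ih with rfl | ih
              -- The old path leaves `b = σ` across the ridge `b ∩ c`. The new path goes from the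
              -- hub to the cone over this ridge and then to `c`.
              · have hss : b ∩ c ⊂ b := Set.inter_subset_left.ssubset_of_ne fun e =>
                  hcσ (eq_of_facet_subset h hσ hσd hcC (Set.inter_eq_left.1 e))
                obtain ⟨x, hx, hxbc, hbc⟩ := exists_eq_diff_singleton hσd hss.subset
                  (le_antisymm (encard_lt_of_ssubset h hσ hσd hss) hint)
                have hsub' : oldSet τ ⊆ newSet (b \ {x}) :=
                  oldSet_subset_newSet.2 (hbc ▸ Set.subset_inter hsub hτc)
                refine (Relation.ReflTransGen.single (newSet_step hσd hx hsub')).tail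
                  ⟨hcmem, by rw [encard_oldSet, hcd], oldSet_subset_oldSet.2 hτc, ?_⟩
                have hle : oldSet (b ∩ c) ⊆ newSet (b \ {x}) ∩ oldSet c := by
                  rw [← hbc]
                  exact Set.subset_inter (oldSet_subset_newSet.2 le_rfl)
                    (oldSet_subset_oldSet.2 Set.inter_subset_right)
                refine hint.trans ?_
                rw [← encard_oldSet]
                gcongr
              · refine ih.tail ⟨hcmem, by rw [encard_oldSet, hcd], oldSet_subset_oldSet.2 hτc, ?_⟩
                rwa [oldSet, oldSet, ← Set.image_inter (Option.some_injective V), encard_oldSet]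
          exact (ind a hpath).resolve_left haσ
        · obtain ⟨x, hx, -, rfl⟩ := hnew ρ hA hAd
          exact Relation.ReflTransGen.single (newSet_step hσd hx hSA)
      exact (FacetStep.reverse_path hhub.1 hhub.2.1 hhub.2.2 (key A hA hAd hSA)).trans
        (key B hB hBd hSB)
    · have hold : ∀ A ∈ stellarSubdivision C σ, oldSet τ ⊆ A → ∃ a, A = oldSet a := by
        intro A hA hSA
        rcases eq_oldSet_or_newSet A with ⟨a, rfl⟩ | ⟨ρ, rfl⟩
        · exact ⟨a, rfl⟩
        · exact absurd ((oldSet_subset_newSet.1 hSA).trans (newSet_mem.1 hA).subset) hsub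
      obtain ⟨a, rfl⟩ := hold A hA hSA
      obtain ⟨b, rfl⟩ := hold B hB hSB
      rw [encard_oldSet] at hAd hBd
      refine Relation.ReflTransGen.lift (fun a => oldSet a) ?_ _ _
        (h.connected τ hτ hc a (oldSet_mem.1 hA).1 b (oldSet_mem.1 hB).1
          (oldSet_subset_oldSet.1 hSA) (oldSet_subset_oldSet.1 hSB) hAd hBd)
      rintro p q ⟨h1, h2, h3, h4⟩
      refine ⟨oldSet_mem.2 ⟨h1, ?_⟩, by rw [encard_oldSet, h2], oldSet_subset_oldSet.2 h3, ?_⟩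
      · rintro rfl
        exact hsub h3
      · rwa [← Set.image_inter (Option.some_injective V), encard_oldSet]
  · have hn : ∀ A ∈ stellarSubdivision C σ, A.encard = d → newSet τ ⊆ A →
        ∃ x ∈ σ, A = newSet (σ \ {x}) := by
      intro A hA hAd hSA
      rcases eq_oldSet_or_newSet A with ⟨a, rfl⟩ | ⟨ρ, rfl⟩
      · exact absurd hSA not_newSet_subset_oldSet
      · obtain ⟨x, hx, -, rfl⟩ := hnew ρ hA hAd
        exact ⟨x, hx, rfl⟩
    obtain ⟨x, hx, rfl⟩ := hn A hA hAd hSA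
    obtain ⟨y, hy, rfl⟩ := hn B hB hBd hSB
    exact Relation.ReflTransGen.single (newSet_step hσd hy hSB)

theorem isSimplicialManifold_stellarSubdivision (hd : d ≠ 0) :
    IsSimplicialManifold (stellarSubdivision C σ) d where
  down := fun S hS T hTS => by
    rcases eq_oldSet_or_newSet S with ⟨s, rfl⟩ | ⟨s, rfl⟩ <;>
    rcases eq_oldSet_or_newSet T with ⟨t, rfl⟩ | ⟨t, rfl⟩
    · obtain ⟨hs, hsσ⟩ := oldSet_mem.1 hS
      have hts := oldSet_subset_oldSet.1 hTS
      refine oldSet_mem.2 ⟨h.down s hs t hts, ?_⟩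
      rintro rfl
      exact hsσ (eq_of_facet_subset h hσ hσd hs hts)
    · exact absurd hTS not_newSet_subset_oldSet
    · have hts := (oldSet_subset_newSet.1 hTS).trans_ssubset (newSet_mem.1 hS)
      exact oldSet_mem.2 ⟨h.down σ hσ t hts.subset, hts.ne⟩
    · exact newSet_mem.2 ((newSet_subset_newSet.1 hTS).trans_ssubset (newSet_mem.1 hS))
  empty_mem := by
    have : oldSet (∅ : Set V) ∈ stellarSubdivision C σ := by
      refine oldSet_mem.2 ⟨h.empty_mem, ?_⟩
      rintro rfl
      simp only [Set.encard_empty] at hσd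
      exact hd (by exact_mod_cast hσd.symm)
    simpa using this
  pure := fun S hS => by
    have hsub : ∀ τ, τ ⊂ σ → ∃ t ∈ stellarSubdivision C σ, newSet τ ⊆ t ∧ t.encard = d := by
      intro τ hτ
      obtain ⟨x, hx, hxτ⟩ := Set.exists_of_ssubset hτ
      refine ⟨newSet (σ \ {x}), newSet_mem.2 (Set.sdiff_singleton_ssubset.2 hx),
        newSet_subset_newSet.2 (Set.subset_sdiff_singleton hτ.subset hxτ), ?_⟩
      rw [encard_newSet, Set.encard_sdiff_singleton_add_one hx, hσd]
    rcases eq_oldSet_or_newSet S with ⟨s, rfl⟩ | ⟨s, rfl⟩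
    · obtain ⟨hs, hsσ⟩ := oldSet_mem.1 hS
      by_cases hss : s ⊆ σ
      · obtain ⟨t, h1, h2, h3⟩ := hsub s (hss.ssubset_of_ne hsσ)
        exact ⟨t, h1, (Set.subset_insert _ _).trans h2, h3⟩
      · obtain ⟨t, ht, hst, htd⟩ := h.pure s hs
        refine ⟨oldSet t, oldSet_mem.2 ⟨ht, ?_⟩, oldSet_subset_oldSet.2 hst, by
          rw [encard_oldSet, htd]⟩
        rintro rfl
        exact hss hst
    · exact hsub s (newSet_mem.1 hS)
  ridge := stellar_ridge h hσ hσd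
  connected := stellar_connected h hσ hσd

end Stellar

end AbstractPolytope

/-! ### Numbers of facets around a simplex -/

namespace AbstractPolytope

/-- The number of facets of a complex that contain a given simplex. -/
noncomputable def facetDegree {V : Type u} (C : Set (Set V)) (d : ℕ) (s : Set V) : ℕ∞ :=
  {t | t ∈ C ∧ s ⊆ t ∧ t.encard = d}.encard

section Automorphisms

variable {V : Type u} {C : Set (Set V)} {d : ℕ} (h : IsSimplicialManifold C d)
  (g : FacePoset C ≃o FacePoset C)
include h

theorem IsSimplicialManifold.map_simplexFace {s : Set V} (hs : s ∈ C) :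
    ∃ t ht, g (simplexFace s hs) = simplexFace t ht ∧ t.ncard = s.ncard := by
  have hr := rk_map g (simplexFace s hs)
  rw [h.rk_simplexFace] at hr
  rcases eq_top_or_simplexFace (g (simplexFace s hs)) with e | ⟨t, ht, e⟩
  · rw [e, h.rk_top] at hr
    have := h.ncard_le hs
    omega
  · rw [e, h.rk_simplexFace] at hr
    exact ⟨t, ht, e, hr⟩

theorem IsSimplicialManifold.map_vertex {x : V} (hx : {x} ∈ C) :
    ∃ y, ∃ hy : {y} ∈ C, g (simplexFace {x} hx) = simplexFace {y} hy := by
  obtain ⟨t, ht, e, hc⟩ := h.map_simplexFace g hx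
  rw [Set.ncard_singleton] at hc
  obtain ⟨y, rfl⟩ := Set.ncard_eq_one.1 hc
  exact ⟨y, ht, e⟩

theorem IsSimplicialManifold.map_eq_image {s : Set V} (hs : s ∈ C) (f : V → V)
    (hf : Set.InjOn f s) (hfC : ∀ x ∈ s, ∃ (hx : {x} ∈ C) (hy : {f x} ∈ C),
      g (simplexFace {x} hx) = simplexFace {f x} hy) :
    ∃ ht : f '' s ∈ C, g (simplexFace s hs) = simplexFace (f '' s) ht := by
  obtain ⟨t, ht, e, hc⟩ := h.map_simplexFace g hs
  have hsub : f '' s ⊆ t := by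
    rintro _ ⟨x, hx, rfl⟩
    obtain ⟨h1, h2, h3⟩ := hfC x hx
    have : g (simplexFace {x} h1) ≤ g (simplexFace s hs) :=
      g.le_iff_le.2 (simplexFace_le.2 (Set.singleton_subset_iff.2 hx))
    rw [h3, e, simplexFace_le] at this
    exact this rfl
  have : f '' s = t := Set.eq_of_subset_of_ncard_le hsub (by rw [hf.ncard_image, hc]) (h.finite ht)
  subst this
  exact ⟨ht, e⟩

/-- The degree counts the faces of rank `d` above the simplex, a description in terms of the order
alone. -/
theorem IsSimplicialManifold.facetDegree_map {s t : Set V} (hs : s ∈ C) (ht : t ∈ C)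
    (e : g (simplexFace s hs) = simplexFace t ht) : facetDegree C d s = facetDegree C d t := by
  have hinj : Function.Injective (fun a : C => (a : WithTop C)) := WithTop.coe_injective
  have key : ∀ s (hs : s ∈ C), facetDegree C d s =
      {F : FacePoset C | simplexFace s hs ≤ F ∧ rk F = d}.encard := by
    intro s hs
    have e1 : {F : FacePoset C | simplexFace s hs ≤ F ∧ rk F = d} =
        (fun a : C => (a : WithTop C)) '' {a | s ⊆ a.1 ∧ a.1.encard = d} := by
      ext F
      constructor
      · rintro ⟨h1, h2⟩
        rcases eq_top_or_simplexFace F with rfl | ⟨t, ht, rfl⟩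
        · rw [h.rk_top] at h2
          omega
        · rw [h.rk_simplexFace] at h2
          exact ⟨⟨t, ht⟩, ⟨simplexFace_le.1 h1, (h.encard_eq_iff ht).2 h2⟩, rfl⟩
      · rintro ⟨⟨t, ht⟩, ⟨h1, h2⟩, rfl⟩
        exact ⟨simplexFace_le.2 h1, (h.rk_simplexFace t ht).trans ((h.encard_eq_iff ht).1 h2)⟩
    rw [e1, hinj.encard_image, ← Subtype.val_injective.encard_image, facetDegree]
    congr 1
    ext t
    constructor
    · rintro ⟨h1, h2, h3⟩
      exact ⟨⟨t, h1⟩, ⟨h2, h3⟩, rfl⟩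
    · rintro ⟨a, ha, rfl⟩
      exact ⟨a.2, ha.1, ha.2⟩
  rw [key s hs, key t ht, ← g.injective.encard_image]
  congr 1
  ext F
  constructor
  · rintro ⟨F, ⟨h1, h2⟩, rfl⟩
    exact ⟨by rw [← e, g.le_iff_le]; exact h1, by rw [rk_map, h2]⟩
  · rintro ⟨h1, h2⟩
    refine ⟨g.symm F, ⟨?_, by rw [rk_map, h2]⟩, by simp⟩
    rw [g.le_symm_apply, e]
    exact h1

end Automorphisms

section OrderComplexDegrees

variable {L : Type u} [PartialOrder L] {m : ℕ} (hL : IsPolytope L m)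
include hL

theorem IsPolytope.exists_adjacent (Φ : Flag L) {k : ℕ} (h1 : 1 ≤ k) (h2 : k ≤ m) :
    ∃ Ψ : Flag L, (∀ E, rk E ≠ k → (E ∈ Ψ ↔ E ∈ Φ)) ∧ ∀ E ∈ Φ, rk E = k → E ∉ Ψ := by
  obtain ⟨F, hF, hFr⟩ := hL.ranked.exists_mem_flag Φ (k := k - 1) (by omega)
  obtain ⟨H, hH, hHr⟩ := hL.ranked.exists_mem_flag Φ (k := k) (by omega)
  obtain ⟨G, hG, hGr⟩ := hL.ranked.exists_mem_flag Φ (k := k + 1) (by omega)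
  have hFH := flag_lt_of_rank_lt hL.rk_strictMono hF hH (by omega)
  have hHG := flag_lt_of_rank_lt hL.rk_strictMono hH hG (by omega)
  obtain ⟨H', hH', hne⟩ : ∃ H' ∈ {X | F < X ∧ X < G}, H' ≠ H := by
    obtain ⟨x, y, hxy, hset⟩ := Set.encard_eq_two.1 (hL.thin F G (hFH.trans hHG) (by omega))
    rw [hset]
    by_cases e : x = H
    · exact ⟨y, by simp, fun e' => hxy (e.trans e'.symm)⟩
    · exact ⟨x, by simp, e⟩
  obtain ⟨Ψ, hΨ⟩ := hL.ranked.exists_exchange hF hH hG hH'.1 hH'.2 (by omega) (by omega)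
  have e1 := hL.rk_strictMono hH'.1
  have e2 := hL.rk_strictMono hH'.2
  refine ⟨Ψ, fun E hE => ?_, fun E hE hEk => ?_⟩
  · rw [← SetLike.mem_coe, hΨ]
    constructor
    · rintro (rfl | hE')
      · omega
      · exact hE'.1
    · intro hE'
      exact Or.inr ⟨hE', by rintro rfl; omega⟩
  · rw [flag_eq_of_rank_eq hL.rk_strictMono hE hH (by omega), ← SetLike.mem_coe, hΨ]
    rintro (e | e)
    · exact hne e.symm
    · exact e.2 rfl

/-- Flags through `F` are told apart by the ranks at which they differ from a fixed flag `Φ`. The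
empty set, the `m - 1` singletons avoiding `rk F` and one pair of such ranks occur, which gives `m +
1` flags; the pair exists because `m ≥ 3`. -/
theorem IsPolytope.le_encard_flags (hm : 3 ≤ m) {F : L} (h1 : 1 ≤ rk F) (h2 : rk F ≤ m) :
    (m + 1 : ℕ∞) ≤ {Ψ : Flag L | F ∈ Ψ}.encard := by
  obtain ⟨Φ, hΦ⟩ := Flag.exists_mem F
  let D : Flag L → Set ℕ := fun Ψ => {k | ∃ E ∈ Φ, rk E = k ∧ E ∉ Ψ}
  have hadj := fun (Ψ : Flag L) (k : ℕ) (h1 : 1 ≤ k) (h2 : k ≤ m) =>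
    hL.exists_adjacent Ψ h1 h2
  have hD0 : D Φ = ∅ := by
    ext k
    simp only [D, Set.mem_ofPred_eq, Set.mem_empty_iff_false, iff_false]
    rintro ⟨E, hE, -, hE'⟩
    exact hE' hE
  have hD1 : ∀ k, 1 ≤ k → k ≤ m → k ≠ rk F → ∃ Ψ : Flag L, F ∈ Ψ ∧ D Ψ = {k} ∧
      ∀ E, rk E ≠ k → (E ∈ Ψ ↔ E ∈ Φ) := by
    intro k hk1 hk2 hkF
    obtain ⟨Ψ, hΨ, hΨ'⟩ := hadj Φ k hk1 hk2
    refine ⟨Ψ, (hΨ F hkF.symm).2 hΦ, ?_, hΨ⟩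
    ext i
    simp only [D, Set.mem_ofPred_eq, Set.mem_singleton_iff]
    constructor
    · rintro ⟨E, hE, rfl, hE'⟩
      by_contra hne
      exact hE' ((hΨ E hne).2 hE)
    · rintro rfl
      obtain ⟨E, hE, hEr⟩ := hL.ranked.exists_mem_flag Φ (k := i) (by omega)
      exact ⟨E, hE, hEr, hΨ' E hE hEr⟩
  obtain ⟨i, j, hij, hi1, hi2, hiF, hj1, hj2, hjF⟩ : ∃ i j : ℕ, i ≠ j ∧ 1 ≤ i ∧ i ≤ m ∧
      i ≠ rk F ∧ 1 ≤ j ∧ j ≤ m ∧ j ≠ rk F := by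
    by_cases e1 : rk F = 1
    · exact ⟨2, 3, by omega, by omega, by omega, by omega, by omega, by omega, by omega⟩
    · by_cases e2 : rk F = 2
      · exact ⟨1, 3, by omega, by omega, by omega, by omega, by omega, by omega, by omega⟩
      · exact ⟨1, 2, by omega, by omega, by omega, by omega, by omega, by omega, by omega⟩
  have hD2 : ∃ Ψ : Flag L, F ∈ Ψ ∧ D Ψ = {i, j} := by
    obtain ⟨Ψ, hFΨ, hDΨ, hΨ⟩ := hD1 i hi1 hi2 hiF
    obtain ⟨Ξ, hΞ, hΞ'⟩ := hadj Ψ j hj1 hj2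
    refine ⟨Ξ, (hΞ F hjF.symm).2 hFΨ, ?_⟩
    ext k
    simp only [D, Set.mem_ofPred_eq, Set.mem_insert_iff, Set.mem_singleton_iff]
    constructor
    · rintro ⟨E, hE, rfl, hE'⟩
      by_contra hne
      push Not at hne
      exact hE' ((hΞ E hne.2).2 ((hΨ E hne.1).2 hE))
    · rintro (rfl | rfl)
      · obtain ⟨E, hE, hEr, hEΨ⟩ : k ∈ D Ψ := by rw [hDΨ]; rfl
        exact ⟨E, hE, hEr, fun h => hEΨ ((hΞ E (by omega)).1 h)⟩
      · obtain ⟨E, hE, hEr⟩ := hL.ranked.exists_mem_flag Φ (k := k) (by omega)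
        exact ⟨E, hE, hEr, hΞ' E ((hΨ E (by omega)).2 hE) hEr⟩
  have hT : insert ∅ (insert {i, j} ((fun k => ({k} : Set ℕ)) '' (Set.Icc 1 m \ {rk F}))) ⊆
      D '' {Ψ : Flag L | F ∈ Ψ} := by
    rintro _ (rfl | rfl | ⟨k, ⟨hk, hkF⟩, rfl⟩)
    · exact ⟨Φ, hΦ, hD0⟩
    · obtain ⟨Ψ, h1, h2⟩ := hD2
      exact ⟨Ψ, h1, h2⟩
    · obtain ⟨Ψ, h1, h2, -⟩ := hD1 k hk.1 hk.2 hkF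
      exact ⟨Ψ, h1, h2⟩
  refine le_trans ?_ ((Set.encard_le_encard hT).trans (Set.encard_image_le _ _))
  rw [Set.encard_insert_of_notMem, Set.encard_insert_of_notMem,
    Set.singleton_injective.encard_image]
  · have h3 : (Set.Icc 1 m \ {rk F}).encard + 1 = m := by
      rw [Set.encard_sdiff_singleton_add_one (Set.mem_Icc.2 ⟨h1, h2⟩),
        Set.encard_eq_coe_toFinset_card]
      simp
    rw [h3]
  · rintro ⟨k, -, hk⟩
    have h1 : i ∈ ({k} : Set ℕ) := by rw [show ({k} : Set ℕ) = {i, j} from hk]; simp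
    have h2 : j ∈ ({k} : Set ℕ) := by rw [show ({k} : Set ℕ) = {i, j} from hk]; simp
    exact hij (h1.trans h2.symm)
  · rintro (h | ⟨k, -, hk⟩)
    · exact (Set.insert_nonempty i {j}).ne_empty h.symm
    · exact (Set.singleton_nonempty k).ne_empty hk

end OrderComplexDegrees

end AbstractPolytope

namespace AbstractPolytope

section Stellar

variable {V : Type u} {C : Set (Set V)} {d : ℕ} {σ : Set V}

/-- The facets at the new vertex are the cones over `σ \ {x}`, one for each vertex `x` of `σ`. -/
theorem facetDegree_newSet_empty (hσd : σ.encard = d) :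
    facetDegree (stellarSubdivision C σ) d (newSet ∅) = d := by
  have hinj : Set.InjOn (fun x => newSet (σ \ {x})) σ := by
    intro x hx y hy e
    by_contra hne
    have : x ∈ σ \ {y} := ⟨hx, hne⟩
    rw [← newSet_injective e] at this
    exact this.2 rfl
  rw [← hσd, ← hinj.encard_image, facetDegree]
  congr 1
  ext T
  constructor
  · rintro ⟨hT, hsub, hTd⟩
    rcases eq_oldSet_or_newSet T with ⟨t, rfl⟩ | ⟨t, rfl⟩
    · exact absurd hsub not_newSet_subset_oldSet
    · rw [encard_newSet] at hTd
      obtain ⟨x, hx, -, rfl⟩ := exists_eq_diff_singleton hσd (newSet_mem.1 hT).subset hTd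
      exact ⟨x, hx, rfl⟩
  · rintro ⟨x, hx, rfl⟩
    exact ⟨newSet_mem.2 (Set.sdiff_singleton_ssubset.2 hx),
      newSet_subset_newSet.2 (Set.empty_subset _), by
        rw [encard_newSet, Set.encard_sdiff_singleton_add_one hx, hσd]⟩

/-- The subdivision removes the facet `σ` here and adds the cones over `σ \ {a}` and `σ \ {b}`. The
form of the equation avoids subtraction. -/
theorem facetDegree_oldSet_sdiff_pair (hσ : σ ∈ C) (hσd : σ.encard = d) {a b : V} (ha : a ∈ σ)
    (hb : b ∈ σ) (hab : a ≠ b) :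
    facetDegree (stellarSubdivision C σ) d (oldSet (σ \ {a, b})) + 1 =
      facetDegree C d (σ \ {a, b}) + 2 := by
  have e1 : {t | t ∈ stellarSubdivision C σ ∧ oldSet (σ \ {a, b}) ⊆ t ∧ t.encard = d} =
      oldSet '' ({t | t ∈ C ∧ σ \ {a, b} ⊆ t ∧ t.encard = d} \ {σ}) ∪
        {newSet (σ \ {a}), newSet (σ \ {b})} := by
    ext T
    constructor
    · rintro ⟨hT, hsub, hTd⟩
      rcases eq_oldSet_or_newSet T with ⟨t, rfl⟩ | ⟨t, rfl⟩
      · obtain ⟨htC, htσ⟩ := oldSet_mem.1 hT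
        rw [encard_oldSet] at hTd
        exact Or.inl ⟨t, ⟨⟨htC, oldSet_subset_oldSet.1 hsub, hTd⟩, htσ⟩, rfl⟩
      · rw [encard_newSet] at hTd
        obtain ⟨x, hx, -, rfl⟩ := exists_eq_diff_singleton hσd (newSet_mem.1 hT).subset hTd
        right
        have hx' : x ∈ ({a, b} : Set V) := by
          by_contra hne
          exact (oldSet_subset_newSet.1 hsub ⟨hx, hne⟩).2 rfl
        rcases hx' with rfl | rfl
        · exact Or.inl rfl
        · exact Or.inr rfl
    · have key : ∀ x ∈ σ, x ∈ ({a, b} : Set V) → newSet (σ \ {x}) ∈ {t |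
          t ∈ stellarSubdivision C σ ∧ oldSet (σ \ {a, b}) ⊆ t ∧ t.encard = d} := by
        intro x hx hxab
        refine ⟨newSet_mem.2 (Set.sdiff_singleton_ssubset.2 hx), oldSet_subset_newSet.2 ?_, by
          rw [encard_newSet, Set.encard_sdiff_singleton_add_one hx, hσd]⟩
        exact fun y hy => ⟨hy.1, fun e => hy.2 (by rwa [show y = x from e])⟩
      rintro (⟨t, ⟨⟨h1, h2, h3⟩, h4⟩, rfl⟩ | rfl | rfl)
      · exact ⟨oldSet_mem.2 ⟨h1, h4⟩, oldSet_subset_oldSet.2 h2, by rw [encard_oldSet, h3]⟩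
      · exact key a ha (by simp)
      · exact key b hb (by simp)
  have hne : newSet (σ \ {a}) ≠ newSet (σ \ {b}) := by
    intro e
    have : a ∈ σ \ {b} := ⟨ha, hab⟩
    rw [← newSet_injective e] at this
    exact this.2 rfl
  have hdisj : Disjoint (oldSet '' ({t | t ∈ C ∧ σ \ {a, b} ⊆ t ∧ t.encard = d} \ {σ}))
      {newSet (σ \ {a}), newSet (σ \ {b})} := by
    rw [Set.disjoint_left]
    rintro _ ⟨t, -, rfl⟩ (e | e)
    · exact oldSet_ne_newSet e
    · exact oldSet_ne_newSet e
  have hmem : σ ∈ {t | t ∈ C ∧ σ \ {a, b} ⊆ t ∧ t.encard = d} := ⟨hσ, Set.sdiff_subset, hσd⟩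
  rw [facetDegree, e1, Set.encard_union_eq hdisj, oldSet_injective.encard_image,
    Set.encard_pair hne, add_right_comm, Set.encard_sdiff_singleton_add_one hmem, facetDegree]

end Stellar

section

variable {L : Type u} [PartialOrder L] {m : ℕ} (hL : IsPolytope L m) (Φ : Flag L)
include hL

theorem IsPolytope.isSimplicialManifold_subdivided (hm : m ≠ 0) :
    IsSimplicialManifold (stellarSubdivision (orderComplex L) (flagSimplex Φ)) m :=
  isSimplicialManifold_stellarSubdivision hL.orderComplex_isSimplicialManifold
    (hL.flagSimplex_mem Φ) (hL.flagSimplex_encard Φ) hm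

theorem IsPolytope.le_facetDegree_oldSet (hm : 3 ≤ m) {F : L} (h1 : 1 ≤ rk F) (h2 : rk F ≤ m) :
    (m + 1 : ℕ∞) ≤
      facetDegree (stellarSubdivision (orderComplex L) (flagSimplex Φ)) m (oldSet {F}) := by
  classical
  obtain ⟨x, hx, hxF⟩ : ∃ x ∈ flagSimplex Φ, x ≠ F := by
    by_cases e : rk F = 1
    · obtain ⟨x, hx, hxr⟩ := hL.ranked.exists_mem_flag Φ (k := 2) (by omega)
      exact ⟨x, hL.mem_flagSimplex.2 ⟨hx, by omega⟩, by rintro rfl; omega⟩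
    · obtain ⟨x, hx, hxr⟩ := hL.ranked.exists_mem_flag Φ (k := 1) (by omega)
      exact ⟨x, hL.mem_flagSimplex.2 ⟨hx, by omega⟩, by rintro rfl; omega⟩
  refine (hL.le_encard_flags hm h1 h2).trans ?_
  -- The facet of `Φ` is gone; it is replaced by a cone that omits a vertex `x ≠ F` and therefore
  -- still contains `F` if `Φ` did.
  let f : Flag L → Set (Option L) := fun Ψ =>
    if Ψ = Φ then newSet (flagSimplex Φ \ {x}) else oldSet (flagSimplex Ψ)
  have hinj : Function.Injective f := by
    intro Ψ Ξ e
    simp only [f] at e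
    split_ifs at e with e1 e2 e2
    · rw [e1, e2]
    · exact absurd e.symm oldSet_ne_newSet
    · exact absurd e oldSet_ne_newSet
    · exact flagSimplex_injective (oldSet_injective e)
  rw [← hinj.encard_image]
  apply Set.encard_le_encard
  rintro _ ⟨Ψ, hΨ, rfl⟩
  have hF : F ∈ flagSimplex Ψ := hL.mem_flagSimplex.2 ⟨hΨ, h1, h2⟩
  simp only [f]
  split_ifs with e
  · subst e
    exact ⟨newSet_mem.2 (Set.sdiff_singleton_ssubset.2 hx),
      oldSet_subset_newSet.2 (Set.singleton_subset_iff.2 ⟨hF, hxF.symm⟩), by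
      rw [encard_newSet, Set.encard_sdiff_singleton_add_one hx, hL.flagSimplex_encard]⟩
  · exact ⟨oldSet_mem.2 ⟨hL.flagSimplex_mem Ψ, fun e' => e (flagSimplex_injective e')⟩,
      oldSet_subset_oldSet.2 (Set.singleton_subset_iff.2 hF), by
        rw [encard_oldSet, hL.flagSimplex_encard]⟩

/-- Facets of the order complex containing a simplex with two missing ranks. -/
theorem IsPolytope.facetDegree_pairs {a b : L} (ha : a ∈ flagSimplex Φ) (hb : b ∈ flagSimplex Φ)
    (hab : rk a < rk b) :
    facetDegree (orderComplex L) m (flagSimplex Φ \ {a, b}) =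
      {T : L × L | insert T.1 (insert T.2 (flagSimplex Φ \ {a, b})) ∈ orderComplex L ∧
        rk T.1 = rk a ∧ rk T.2 = rk b}.encard := by
  set τ := flagSimplex Φ \ {a, b} with hτ
  obtain ⟨haΦ, ha1, ham⟩ := hL.mem_flagSimplex.1 ha
  obtain ⟨hbΦ, hb1, hbm⟩ := hL.mem_flagSimplex.1 hb
  have hrk : ∀ E ∈ τ, rk E ≠ rk a ∧ rk E ≠ rk b := by
    rintro E ⟨hE, hEab⟩
    constructor
    · intro e
      exact hEab (Or.inl (flag_eq_of_rank_eq hL.rk_strictMono hE.1 haΦ e))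
    · intro e
      exact hEab (Or.inr (flag_eq_of_rank_eq hL.rk_strictMono hE.1 hbΦ e))
  have hcard : ∀ H H', rk H = rk a → rk H' = rk b → (insert H (insert H' τ)).encard = m := by
    intro H H' h1 h2
    have hab' : a ≠ b := by rintro rfl; omega
    have e1 : insert a (insert b τ) = flagSimplex Φ := by
      ext E
      simp only [hτ, Set.mem_insert_iff, Set.mem_sdiff, Set.mem_singleton_iff]
      constructor
      · rintro (rfl | rfl | h)
        exacts [ha, hb, h.1]
      · tauto
    have key : ∀ H H', rk H = rk a → rk H' = rk b →
        (insert H (insert H' τ)).encard = τ.encard + 1 + 1 := by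
      intro H H' h1 h2
      rw [Set.encard_insert_of_notMem, Set.encard_insert_of_notMem]
      · exact fun h => (hrk H' h).2 h2
      · rintro (rfl | h)
        · omega
        · exact (hrk H h).1 h1
    rw [key H H' h1 h2, ← key a b rfl rfl, e1, hL.flagSimplex_encard]
  have hinj : Set.InjOn (fun T : L × L => insert T.1 (insert T.2 τ)) {T : L × L |
      insert T.1 (insert T.2 τ) ∈ orderComplex L ∧ rk T.1 = rk a ∧ rk T.2 = rk b} := by
    rintro ⟨H, H'⟩ ⟨-, h1, h2⟩ ⟨G, G'⟩ ⟨-, h3, h4⟩ e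
    simp only at h1 h2 h3 h4 e
    have m1 : H ∈ insert G (insert G' τ) := e ▸ Set.mem_insert _ _
    have m2 : H' ∈ insert G (insert G' τ) := e ▸ Set.mem_insert_of_mem _ (Set.mem_insert _ _)
    have e1 : H = G := by
      rcases m1 with h | rfl | h
      · exact h
      · omega
      · exact absurd h1 (hrk H h).1
    have e2 : H' = G' := by
      rcases m2 with rfl | h | h
      · omega
      · exact h
      · exact absurd h2 (hrk H' h).2
    rw [e1, e2]
  rw [← hinj.encard_image, facetDegree]
  congr 1
  ext t
  constructor
  · rintro ⟨htC, hτt, htm⟩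
    obtain ⟨Ψ, rfl⟩ := hL.exists_eq_flagSimplex htC htm
    obtain ⟨H, hH, hHr⟩ := hL.ranked.exists_mem_flag Ψ (k := rk a) (by omega)
    obtain ⟨H', hH', hHr'⟩ := hL.ranked.exists_mem_flag Ψ (k := rk b) (by omega)
    have e : insert H (insert H' τ) = flagSimplex Ψ := by
      refine (hL.flagSimplex_finite Ψ).eq_of_subset_of_encard_le' (Set.insert_subset
        (hL.mem_flagSimplex.2 ⟨hH, by omega⟩) (Set.insert_subset
        (hL.mem_flagSimplex.2 ⟨hH', by omega⟩) hτt)) ?_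
      rw [hcard H H' hHr hHr', htm]
    exact ⟨(H, H'), ⟨by rw [e]; exact htC, hHr, hHr'⟩, e⟩
  · rintro ⟨⟨H, H'⟩, ⟨h1, h2, h3⟩, rfl⟩
    exact ⟨h1, (Set.subset_insert _ _).trans (Set.subset_insert _ _), hcard H H' h2 h3⟩

/-- The ranks decide the direction of every comparison, so being a chain splits into separate
conditions on `H` and on `H'`, linked only by `H ≤ H'`. -/
theorem IsPolytope.mem_orderComplex_insert_pair {a b H H' : L} (ha : a ∈ flagSimplex Φ)
    (hb : b ∈ flagSimplex Φ) (hab : rk a < rk b) (hH : rk H = rk a) (hH' : rk H' = rk b) :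
    insert H (insert H' (flagSimplex Φ \ {a, b})) ∈ orderComplex L ↔
      H ≤ H' ∧ (∀ E ∈ Φ, rk E ≠ rk a → rk E ≠ rk b → (rk E < rk a → E ≤ H) ∧
        (rk a < rk E → H ≤ E) ∧ (rk E < rk b → E ≤ H') ∧ (rk b < rk E → H' ≤ E)) := by
  obtain ⟨haΦ, ha1, ham⟩ := hL.mem_flagSimplex.1 ha
  obtain ⟨hbΦ, hb1, hbm⟩ := hL.mem_flagSimplex.1 hb
  rw [hL.mem_orderComplex]
  have lt_of : ∀ {X Y : L}, (X ≤ Y ∨ Y ≤ X) → rk X < rk Y → X ≤ Y := by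
    intro X Y h hr
    rcases h with h | h
    · exact h
    · exact absurd (hL.rk_strictMono.monotone h) (by omega)
  constructor
  · rintro ⟨hc, -⟩
    have hm1 : H ∈ insert H (insert H' (flagSimplex Φ \ {a, b})) := Or.inl rfl
    have hm2 : H' ∈ insert H (insert H' (flagSimplex Φ \ {a, b})) := Or.inr (Or.inl rfl)
    refine ⟨lt_of (hc.total hm1 hm2) (by omega), fun E hE hEa hEb => ?_⟩
    by_cases hp : 1 ≤ rk E ∧ rk E ≤ m
    · have hm3 : E ∈ insert H (insert H' (flagSimplex Φ \ {a, b})) :=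
        Or.inr (Or.inr ⟨hL.mem_flagSimplex.2 ⟨hE, hp⟩, by
          rintro (rfl | rfl)
          · exact hEa rfl
          · exact hEb rfl⟩)
      exact ⟨fun h => lt_of (hc.total hm3 hm1) (by omega),
        fun h => lt_of (hc.total hm1 hm3) (by omega),
        fun h => lt_of (hc.total hm3 hm2) (by omega),
        fun h => lt_of (hc.total hm2 hm3) (by omega)⟩
    · have := hL.rk_le E
      by_cases h0 : rk E = 0
      · have hb := hL.ranked.isBot_of_rank h0
        exact ⟨fun _ => hb _, by omega, fun _ => hb _, by omega⟩
      · have ht := hL.ranked.isTop_of_rank (F := E) (by omega)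
        exact ⟨by omega, fun _ => ht _, by omega, fun _ => ht _⟩
  · rintro ⟨h1, h2⟩
    have hrk : ∀ E ∈ flagSimplex Φ \ {a, b}, rk E ≠ rk a ∧ rk E ≠ rk b := by
      rintro E ⟨hE, hEab⟩
      constructor
      · intro e
        exact hEab (Or.inl (flag_eq_of_rank_eq hL.rk_strictMono hE.1 haΦ e))
      · intro e
        exact hEab (Or.inr (flag_eq_of_rank_eq hL.rk_strictMono hE.1 hbΦ e))
    constructor
    · refine IsChain.insert (IsChain.insert ?_ ?_) ?_
      · exact Φ.chain_le.mono fun E hE => hE.1.1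
      · intro E hE _
        obtain ⟨r1, r2⟩ := hrk E hE
        obtain ⟨-, -, c3, c4⟩ := h2 E hE.1.1 r1 r2
        rcases lt_or_gt_of_ne r2 with h | h
        · exact Or.inr (c3 h)
        · exact Or.inl (c4 h)
      · rintro E (rfl | hE) _
        · exact Or.inl h1
        obtain ⟨r1, r2⟩ := hrk E hE
        obtain ⟨c1, c2, -, -⟩ := h2 E hE.1.1 r1 r2
        rcases lt_or_gt_of_ne r1 with h | h
        · exact Or.inr (c1 h)
        · exact Or.inl (c2 h)
    · rintro E (rfl | rfl | hE)
      · omega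
      · omega
      · exact (hL.mem_flagSimplex.1 hE.1).2

/-- A face of the flag separates the two missing ranks, so they are filled independently, each by
one of the two middle faces of a diamond. -/
theorem IsPolytope.facetDegree_nonconsecutive {a b : L} (ha : a ∈ flagSimplex Φ)
    (hb : b ∈ flagSimplex Φ) (hab : rk a + 1 < rk b) :
    facetDegree (orderComplex L) m (flagSimplex Φ \ {a, b}) = 4 := by
  rw [hL.facetDegree_pairs Φ ha hb (by omega)]
  obtain ⟨haΦ, ha1, ham⟩ := hL.mem_flagSimplex.1 ha
  obtain ⟨hbΦ, hb1, hbm⟩ := hL.mem_flagSimplex.1 hb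
  obtain ⟨F, hF, hFr⟩ := hL.ranked.exists_mem_flag Φ (k := rk a - 1) (by omega)
  obtain ⟨G, hG, hGr⟩ := hL.ranked.exists_mem_flag Φ (k := rk a + 1) (by omega)
  obtain ⟨F', hF', hFr'⟩ := hL.ranked.exists_mem_flag Φ (k := rk b - 1) (by omega)
  obtain ⟨G', hG', hGr'⟩ := hL.ranked.exists_mem_flag Φ (k := rk b + 1) (by omega)
  have le := fun {X Y : L} (hX : X ∈ Φ) (hY : Y ∈ Φ) => flag_le_of_rank_le hL.rk_strictMono hX hY
  have lt := fun {X Y : L} (hX : X ∈ Φ) (hY : Y ∈ Φ) => flag_lt_of_rank_lt hL.rk_strictMono hX hY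
  have e1 : {T : L × L | insert T.1 (insert T.2 (flagSimplex Φ \ {a, b})) ∈ orderComplex L ∧
      rk T.1 = rk a ∧ rk T.2 = rk b} = {H | F < H ∧ H < G} ×ˢ {H | F' < H ∧ H < G'} := by
    ext ⟨H, H'⟩
    constructor
    · rintro ⟨h1, h2, h3⟩
      simp only at h1 h2 h3
      rw [hL.mem_orderComplex_insert_pair Φ ha hb (by omega) h2 h3] at h1
      have ne : ∀ {X Y : L}, X ≤ Y → rk X ≠ rk Y → X < Y := fun h hr =>
        h.lt_of_ne fun e => hr (by rw [e])
      refine ⟨⟨ne ((h1.2 F hF ?_ ?_).1 ?_) ?_, ne ((h1.2 G hG ?_ ?_).2.1 ?_) ?_⟩,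
        ⟨ne ((h1.2 F' hF' ?_ ?_).2.2.1 ?_) ?_, ne ((h1.2 G' hG' ?_ ?_).2.2.2 ?_) ?_⟩⟩ <;>
        (try simp only) <;> omega
    · rintro ⟨⟨h1, h2⟩, h3, h4⟩
      simp only at h1 h2 h3 h4
      have r1 := hL.rk_strictMono h1
      have r2 := hL.rk_strictMono h2
      have r3 := hL.rk_strictMono h3
      have r4 := hL.rk_strictMono h4
      have hHr : rk H = rk a := by omega
      have hHr' : rk H' = rk b := by omega
      refine ⟨?_, hHr, hHr'⟩
      rw [hL.mem_orderComplex_insert_pair Φ ha hb (by omega) hHr hHr']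
      refine ⟨h2.le.trans ((le hG hF' (by omega)).trans h3.le), fun E hE hEa hEb =>
        ⟨fun h => (le hE hF (by omega)).trans h1.le, fun h => h2.le.trans (le hG hE (by omega)),
          fun h => (le hE hF' (by omega)).trans h3.le,
          fun h => h4.le.trans (le hG' hE (by omega))⟩⟩
  rw [e1, Set.encard_prod, hL.thin F G (lt hF hG (by omega)) (by omega),
    hL.thin F' G' (lt hF' hG' (by omega)) (by omega)]
  norm_num

/-- The completions are the flags of the polygon between `F` and `G`: each of its `p (rk a)`
vertices lies on two edges. -/
theorem IsPolytope.facetDegree_consecutive [Finite L] {p : ℕ → ℕ} (hp : IsEquivelar L m p) {a b : L}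
    (ha : a ∈ flagSimplex Φ) (hb : b ∈ flagSimplex Φ) (hab : rk b = rk a + 1) :
    facetDegree (orderComplex L) m (flagSimplex Φ \ {a, b}) = (p (rk a) * 2 : ℕ) := by
  rw [hL.facetDegree_pairs Φ ha hb (by omega)]
  obtain ⟨haΦ, ha1, ham⟩ := hL.mem_flagSimplex.1 ha
  obtain ⟨hbΦ, hb1, hbm⟩ := hL.mem_flagSimplex.1 hb
  obtain ⟨F, hF, hFr⟩ := hL.ranked.exists_mem_flag Φ (k := rk a - 1) (by omega)
  obtain ⟨G, hG, hGr⟩ := hL.ranked.exists_mem_flag Φ (k := rk b + 1) (by omega)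
  have le := fun {X Y : L} (hX : X ∈ Φ) (hY : Y ∈ Φ) => flag_le_of_rank_le hL.rk_strictMono hX hY
  let A : Set L := {H | F ≤ H ∧ H ≤ G ∧ rk H = rk a}
  have hA : Nat.card A = p (rk a) := by
    have := hp (rk a) ha1 (by omega) Φ F hF G hG (by rw [faceRank_eq_rk]; omega)
      (by rw [faceRank_eq_rk]; omega)
    have hA' : A = {H : L | F ≤ H ∧ H ≤ G ∧ faceRank H = (rk a : ℤ) - 1} := by
      ext H
      simp only [A, faceRank_eq_rk, Set.mem_ofPred_eq]
      refine and_congr_right fun _ => and_congr_right fun _ => ?_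
      omega
    rw [← hA', ← A.toFinite.cast_ncard_eq] at this
    rw [Nat.card_coe_set_eq]
    exact_mod_cast this
  have hfib : ∀ H : A, Nat.card {H' | H.1 < H' ∧ H' < G} = 2 := by
    rintro ⟨H, h1, h2, h3⟩
    have := hL.thin H G (h2.lt_of_ne (by rintro rfl; omega)) (by omega)
    rw [← (Set.toFinite _).cast_ncard_eq] at this
    rw [Nat.card_coe_set_eq]
    exact_mod_cast this
  let e : {T : L × L | insert T.1 (insert T.2 (flagSimplex Φ \ {a, b})) ∈ orderComplex L ∧
      rk T.1 = rk a ∧ rk T.2 = rk b} ≃ Σ H : A, {H' | H.1 < H' ∧ H' < G} :=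
    { toFun := fun T => ⟨⟨T.1.1, by
        obtain ⟨⟨H, H'⟩, h1, h2, h3⟩ := T
        simp only at h1 h2 h3
        rw [hL.mem_orderComplex_insert_pair Φ ha hb (by omega) h2 h3] at h1
        refine ⟨(h1.2 F hF ?_ ?_).1 ?_, (h1.2 G hG ?_ ?_).2.1 ?_, h2⟩ <;> omega⟩, T.1.2, by
        obtain ⟨⟨H, H'⟩, h1, h2, h3⟩ := T
        simp only at h1 h2 h3
        rw [hL.mem_orderComplex_insert_pair Φ ha hb (by omega) h2 h3] at h1
        have h4 : H' ≤ G := by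
          refine (h1.2 G hG ?_ ?_).2.2.2 ?_ <;> omega
        exact ⟨h1.1.lt_of_ne (by rintro rfl; omega), h4.lt_of_ne (by rintro rfl; omega)⟩⟩
      invFun := fun T => ⟨(T.1.1, T.2.1), by
        obtain ⟨⟨H, h1, h2, h3⟩, ⟨H', h4, h5⟩⟩ := T
        have r1 : rk H < rk H' := hL.rk_strictMono h4
        have r2 : rk H' < rk G := hL.rk_strictMono h5
        have hHr' : rk H' = rk b := by omega
        refine ⟨?_, h3, hHr'⟩
        simp only
        rw [hL.mem_orderComplex_insert_pair Φ ha hb (by omega) h3 hHr']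
        exact ⟨h4.le, fun E hE hEa hEb => ⟨fun h => (le hE hF (by omega)).trans h1,
          fun h => h2.trans (le hG hE (by omega)),
          fun h => (le hE hF (by omega)).trans (h1.trans h4.le),
          fun h => h5.le.trans (le hG hE (by omega))⟩⟩⟩
      left_inv := fun T => rfl
      right_inv := fun T => rfl }
  have := Fintype.ofFinite A
  rw [← (Set.toFinite _).cast_ncard_eq, ← Nat.card_coe_set_eq, Nat.card_congr e, Nat.card_sigma,
    Finset.sum_congr rfl fun H _ => hfib H, Finset.sum_const, Finset.card_univ,
    ← Nat.card_eq_fintype_card, hA, smul_eq_mul]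

end

end AbstractPolytope

/-! ### Asymmetry of the subdivided order complex -/

namespace AbstractPolytope

/-- If each edge of the path `1, ..., m` is mapped to itself, the common vertex of two consecutive
edges is fixed, and then so are their other ends. With a single edge (`m = 2`) a flip would be
possible. -/
theorem forall_fixed_of_pairs_fixed {m : ℕ} (hm : 3 ≤ m) (κ : ℕ → ℕ)
    (h : ∀ k, 1 ≤ k → k + 1 ≤ m → (κ k = k ∧ κ (k + 1) = k + 1) ∨ (κ k = k + 1 ∧ κ (k + 1) = k)) :
    ∀ k, 1 ≤ k → k ≤ m → κ k = k := by
  have h1 : ∀ k, 1 ≤ k → k + 2 ≤ m → κ k = k ∧ κ (k + 1) = k + 1 ∧ κ (k + 2) = k + 2 := by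
    intro k hk hkm
    have a := h k hk (by omega)
    have b := h (k + 1) (by omega) hkm
    rw [add_assoc, one_add_one_eq_two] at b
    omega
  intro k hk hkm
  by_cases e : k + 2 ≤ m
  · exact (h1 k hk e).1
  · have := h1 (m - 2) (by omega) (by omega)
    rw [show m - 2 + 1 = m - 1 by omega, show m - 2 + 2 = m by omega] at this
    have : k = m - 1 ∨ k = m := by omega
    rcases this with rfl | rfl <;> omega

section

variable {L : Type u} [PartialOrder L] {m : ℕ} (hL : IsPolytope L m) (Φ : Flag L)
include hL

/-- The numbers of facets around the ridges of a flag distinguish the pairs of adjacent ranks. -/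
theorem IsPolytope.rank_eq_of_facetDegree_eq [Finite L] {p : ℕ → ℕ} (hp : IsEquivelar L m p)
    (hp3 : ∀ j ∈ Set.Icc 1 (m - 1), 3 ≤ p j) (hpinj : Set.InjOn p (Set.Icc 1 (m - 1)))
    {a b c d : L} (ha : a ∈ flagSimplex Φ) (hb : b ∈ flagSimplex Φ) (hc : c ∈ flagSimplex Φ)
    (hd : d ∈ flagSimplex Φ) (hab : rk b = rk a + 1) (hcd : c ≠ d)
    (hdeg : facetDegree (orderComplex L) m (flagSimplex Φ \ {a, b}) =
      facetDegree (orderComplex L) m (flagSimplex Φ \ {c, d})) :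
    (rk c = rk a ∧ rk d = rk b) ∨ (rk c = rk b ∧ rk d = rk a) := by
  have ha' := (hL.mem_flagSimplex.1 ha).2
  have hb' := (hL.mem_flagSimplex.1 hb).2
  have key : ∀ c d : L, c ∈ flagSimplex Φ → d ∈ flagSimplex Φ → rk c < rk d →
      facetDegree (orderComplex L) m (flagSimplex Φ \ {a, b}) =
      facetDegree (orderComplex L) m (flagSimplex Φ \ {c, d}) → rk c = rk a ∧ rk d = rk b := by
    intro c d hc hd hlt hdeg
    have hc' := (hL.mem_flagSimplex.1 hc).2
    have hd' := (hL.mem_flagSimplex.1 hd).2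
    have h3 := hp3 (rk a) ⟨ha'.1, by omega⟩
    rw [hL.facetDegree_consecutive Φ hp ha hb hab] at hdeg
    by_cases e : rk d = rk c + 1
    · rw [hL.facetDegree_consecutive Φ hp hc hd e] at hdeg
      have : p (rk a) * 2 = p (rk c) * 2 := by exact_mod_cast hdeg
      have := hpinj (x₁ := rk a) ⟨ha'.1, by omega⟩ (x₂ := rk c) ⟨hc'.1, by omega⟩ (by omega)
      omega
    · rw [hL.facetDegree_nonconsecutive Φ hc hd (by omega)] at hdeg
      have : p (rk a) * 2 = 4 := by exact_mod_cast hdeg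
      omega
  have hne : rk c ≠ rk d := fun e => hcd (flag_eq_of_rank_eq hL.rk_strictMono hc.1 hd.1 e)
  rcases lt_or_gt_of_ne hne with h | h
  · exact Or.inl (key c d hc hd h hdeg)
  · have := key d c hd hc h (by rw [hdeg, Set.pair_comm])
    exact Or.inr this.symm

theorem isAsymmetric_subdivided [Finite L] (hm : 3 ≤ m) {p : ℕ → ℕ} (hp : IsEquivelar L m p)
    (hp3 : ∀ j ∈ Set.Icc 1 (m - 1), 3 ≤ p j) (hpinj : Set.InjOn p (Set.Icc 1 (m - 1))) :
    IsAsymmetric (SubdividedOrderComplex Φ) := by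
  classical
  intro g
  set σ := flagSimplex Φ with hσ
  have hσm : σ.encard = m := hL.flagSimplex_encard Φ
  have hσC : σ ∈ orderComplex L := hL.flagSimplex_mem Φ
  have hσf : σ.Finite := hL.flagSimplex_finite Φ
  have hO := hL.orderComplex_isSimplicialManifold
  have M := hL.isSimplicialManifold_subdivided Φ (by omega)
  have hsing : ∀ x ∈ σ, {x} ⊂ σ := fun x hx =>
    (Set.singleton_subset_iff.2 hx).ssubset_of_ne fun e => by
      rw [← e, Set.encard_singleton] at hσm
      have : 1 = m := by exact_mod_cast hσm
      omega
  have hz0 : {none} ∈ stellarSubdivision (orderComplex L) σ := by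
    have : newSet (∅ : Set L) ∈ stellarSubdivision (orderComplex L) σ := by
      refine newSet_mem.2 ((Set.empty_subset σ).ssubset_of_ne ?_)
      rintro e
      rw [← e, Set.encard_empty] at hσm
      have : 0 = m := by exact_mod_cast hσm
      omega
    simpa [newSet] using this
  have hx0 : ∀ x ∈ σ, {some x} ∈ stellarSubdivision (orderComplex L) σ := fun x hx => by
    have : oldSet {x} ∈ stellarSubdivision (orderComplex L) σ :=
      oldSet_mem.2 ⟨hO.down σ hσC _ (hsing x hx).subset, (hsing x hx).ne⟩
    simpa [oldSet] using this
  -- The new vertex is the only one contained in exactly `m` facets.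
  have hz : g (simplexFace {none} hz0) = simplexFace {none} hz0 := by
    obtain ⟨y, hy, e⟩ := M.map_vertex g hz0
    have hdeg := M.facetDegree_map g hz0 hy e
    rw [show ({none} : Set (Option L)) = newSet ∅ by simp [newSet],
      facetDegree_newSet_empty hσm] at hdeg
    rcases y with _ | F
    · exact e
    · rw [show ({some F} : Set (Option L)) = oldSet {F} by simp [oldSet]] at hdeg hy
      have hF := (hL.mem_orderComplex.1 (oldSet_mem.1 hy).1).2 F rfl
      have := hL.le_facetDegree_oldSet Φ hm hF.1 hF.2
      rw [← hdeg] at this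
      have : m + 1 ≤ m := by exact_mod_cast this
      omega
  -- The vertices of `σ` are the neighbours of the new vertex, so `g` permutes them.
  have hπ : ∀ x ∈ σ, ∃ y ∈ σ, ∃ (hx : {some x} ∈ stellarSubdivision (orderComplex L) σ)
      (hy : {some y} ∈ stellarSubdivision (orderComplex L) σ),
      g (simplexFace {some x} hx) = simplexFace {some y} hy := by
    intro x hx
    obtain ⟨y, hy, e⟩ := M.map_vertex g (hx0 x hx)
    have hpair : newSet {x} ∈ stellarSubdivision (orderComplex L) σ := newSet_mem.2 (hsing x hx)
    obtain ⟨t, ht, et, -⟩ := M.map_simplexFace g hpair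
    have h1 : g (simplexFace {none} hz0) ≤ g (simplexFace _ hpair) :=
      g.le_iff_le.2 (simplexFace_le.2 (by simp))
    have h2 : g (simplexFace {some x} (hx0 x hx)) ≤ g (simplexFace _ hpair) :=
      g.le_iff_le.2 (simplexFace_le.2 (by simp))
    rw [hz, et, simplexFace_le] at h1
    rw [e, et, simplexFace_le] at h2
    rcases y with _ | y
    · rw [← hz] at e
      have := simplexFace_inj.1 (g.injective e)
      simp at this
    · refine ⟨y, ?_, hx0 x hx, hy, e⟩
      rcases eq_oldSet_or_newSet t with ⟨t, rfl⟩ | ⟨t, rfl⟩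
      · exact absurd (h1 rfl) none_notMem_oldSet
      · exact (newSet_mem.1 ht).subset (some_mem_newSet.1 (h2 rfl))
  choose! f hfσ hf using hπ
  have hfinj : Set.InjOn f σ := by
    intro x hx y hy e
    obtain ⟨h1, h2, h3⟩ := hf x hx
    obtain ⟨h4, h5, h6⟩ := hf y hy
    have : g (simplexFace {some x} h1) = g (simplexFace {some y} h4) := by
      rw [h3, h6, simplexFace_inj, e]
    have := simplexFace_inj.1 (g.injective this)
    simpa using this
  have hfimg : f '' σ = σ := by
    refine (hσf.image f).eq_of_subset_of_encard_le ?_ (hfinj.encard_image).ge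
    rintro _ ⟨x, hx, rfl⟩
    exact hfσ x hx
  -- Degrees are invariant in the subdivision, where they exceed those in the order complex by one.
  have hdeg : ∀ a ∈ σ, ∀ b ∈ σ, a ≠ b → facetDegree (orderComplex L) m (σ \ {a, b}) =
      facetDegree (orderComplex L) m (σ \ {f a, f b}) := by
    intro a ha b hb hab
    have hτ : oldSet (σ \ {a, b}) ∈ stellarSubdivision (orderComplex L) σ :=
      oldSet_mem.2 ⟨hO.down σ hσC _ Set.sdiff_subset, fun e => by
        rw [← e] at ha
        exact ha.2 (Or.inl rfl)⟩
    obtain ⟨ht, e⟩ := M.map_eq_image g hτ (Option.map f) (by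
        rintro _ ⟨x, hx, rfl⟩ _ ⟨y, hy, rfl⟩ e
        rw [hfinj hx.1 hy.1 (by simpa using e)]) (by
        rintro _ ⟨x, hx, rfl⟩
        exact hf x hx.1)
    have himg : Option.map f '' oldSet (σ \ {a, b}) = oldSet (σ \ {f a, f b}) := by
      ext y
      constructor
      · rintro ⟨_, ⟨x, ⟨hx, hxab⟩, rfl⟩, rfl⟩
        refine ⟨f x, ⟨hfσ x hx, ?_⟩, rfl⟩
        rintro (e | e)
        · exact hxab (Or.inl (hfinj hx ha e))
        · exact hxab (Or.inr (hfinj hx hb e))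
      · rintro ⟨y, ⟨hy, hyab⟩, rfl⟩
        rw [← hfimg] at hy
        obtain ⟨x, hx, rfl⟩ := hy
        refine ⟨some x, ⟨x, ⟨hx, ?_⟩, rfl⟩, rfl⟩
        rintro (rfl | rfl)
        · exact hyab (Or.inl rfl)
        · exact hyab (Or.inr rfl)
    have h1 := M.facetDegree_map g hτ ht e
    rw [himg] at h1
    have h2 := facetDegree_oldSet_sdiff_pair hσC hσm ha hb hab
    have h3 := facetDegree_oldSet_sdiff_pair hσC hσm (hfσ a ha) (hfσ b hb)
      fun e => hab (hfinj ha hb e)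
    rw [h1, h3] at h2
    exact (ENat.add_left_injective_of_ne_top (by simp) h2).symm
  have hface : ∀ k, ∃ x, 1 ≤ k → k ≤ m → x ∈ σ ∧ rk x = k := by
    intro k
    by_cases hk : 1 ≤ k ∧ k ≤ m
    · obtain ⟨x, hx, hxr⟩ := hL.ranked.exists_mem_flag Φ (k := k) (by omega)
      exact ⟨x, fun _ _ => ⟨hL.mem_flagSimplex.2 ⟨hx, by omega⟩, hxr⟩⟩
    · obtain ⟨b, -⟩ := hL.exists_least
      exact ⟨b, fun h1 h2 => absurd ⟨h1, h2⟩ hk⟩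
  choose x hx using hface
  -- As the entries of the type are distinct and differ from 2, the degrees force each pair of
  -- consecutive ranks to be mapped to itself.
  have hκ : ∀ k, 1 ≤ k → k ≤ m → rk (f (x k)) = k := by
    refine forall_fixed_of_pairs_fixed hm (fun k => rk (f (x k))) fun k hk hkm => ?_
    obtain ⟨h1, h2⟩ := hx k hk (by omega)
    obtain ⟨h3, h4⟩ := hx (k + 1) (by omega) hkm
    have hne : x k ≠ x (k + 1) := fun e => by rw [e] at h2; omega
    have := hL.rank_eq_of_facetDegree_eq Φ hp hp3 hpinj h1 h3 (hfσ _ h1) (hfσ _ h3) (by omega)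
      (fun e => hne (hfinj h1 h3 e)) (hdeg _ h1 _ h3 hne)
    rwa [h2, h4] at this
  have hfix : ∀ y ∈ σ, f y = y := by
    intro y hy
    obtain ⟨-, h1, h2⟩ := hL.mem_flagSimplex.1 hy
    obtain ⟨h3, h4⟩ := hx (rk y) h1 h2
    have e : x (rk y) = y := flag_eq_of_rank_eq hL.rk_strictMono h3.1 hy.1 h4
    have := hκ (rk y) h1 h2
    rw [e] at this
    exact flag_eq_of_rank_eq hL.rk_strictMono (hfσ y hy).1 hy.1 this
  obtain ⟨h1, h2⟩ := hx 1 le_rfl (by omega)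
  have hT : newSet (σ \ {x 1}) ∈ stellarSubdivision (orderComplex L) σ :=
    newSet_mem.2 (Set.sdiff_singleton_ssubset.2 h1)
  have hTm : (newSet (σ \ {x 1})).encard = m := by
    rw [encard_newSet, Set.encard_sdiff_singleton_add_one h1, hσm]
  -- All vertices of one new facet are now fixed, hence all its faces, and with them a flag.
  have hsub : ∀ S (hS : S ∈ stellarSubdivision (orderComplex L) σ), S ⊆ newSet (σ \ {x 1}) →
      g (simplexFace S hS) = simplexFace S hS := by
    intro S hS hST
    obtain ⟨ht, e⟩ := M.map_eq_image g hS id Function.injective_id.injOn (by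
      rintro (_ | y) hy
      · exact ⟨hz0, hz0, hz⟩
      · have hyσ := (some_mem_newSet.1 (hST hy)).1
        obtain ⟨h1, h2, h3⟩ := hf y hyσ
        refine ⟨h1, h1, ?_⟩
        rw [h3, simplexFace_inj, hfix y hyσ]
        rfl)
    rw [e, simplexFace_inj, Set.image_id]
  obtain ⟨Ψ, hΨ⟩ := Flag.exists_mem (simplexFace _ hT)
  refine M.isPolytope.eq_refl_of_fixes_flag g Ψ fun F hF => ?_
  rcases eq_top_or_simplexFace F with rfl | ⟨S, hS, rfl⟩
  · exact top_le_iff.1 (by rw [← g.symm_apply_le]; exact le_top)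
  · apply hsub
    have := flag_le_of_rank_le M.isPolytope.rk_strictMono hF hΨ (by
      rw [M.rk_simplexFace, M.rk_simplexFace, (M.encard_eq_iff hT).1 hTm]
      exact M.ncard_le hS)
    exact simplexFace_le.1 this

end

end AbstractPolytope

/-! ### Equivelar polytopes from coset geometries -/

namespace AbstractPolytope

open ClassPoset

namespace ClassSystem

variable {K : Type u} [PartialOrder K] {X : Type v} {cls : K → X → Set X} (h : ClassSystem cls)
  [Nonempty X] {m : ℕ} (hK : IsPolytope K m)
include h hK

theorem isVertexDescribable : IsVertexDescribable (ClassPoset cls) := by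
  obtain ⟨b, hb, hb0⟩ := hK.ranked.exists_bot
  have hvert : ∀ y, face cls b y ∈ Face (ClassPoset cls) 0 := fun y => by
    rw [mem_face_iff, h.rk_face hK, hb0]
    rfl
  have hle : ∀ y (S : ClassPoset cls), face cls b y ≤ S ↔ y ∈ S.1 := fun y S => by
    change cls b y ⊆ S.1 ↔ _
    rw [h.of_isBot b y hb, Set.singleton_subset_iff]
  intro S T
  constructor
  · exact fun hST v hv => ⟨hv.1, hv.2.trans hST⟩
  · intro hST y hy
    exact (hle y T).1 (hST ⟨hvert y, (hle y S).2 hy⟩).2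

/-- The 2-faces are the classes of edges of `K`, with `c` points as vertices. All other sections
avoid the empty set and come from `K` with ranks shifted by one. -/
theorem isEquivelar {p : ℕ → ℕ} (hp : IsEquivelar K m p) {c : ℕ}
    (hc : ∀ E x, rk E = 2 → (cls E x).encard = c) :
    IsEquivelar (ClassPoset cls) (m + 1) (fun j => if j = 1 then c else p (j - 1)) := by
  obtain ⟨b, hb, hb0⟩ := hK.ranked.exists_bot
  intro j hj1 hjm Ψ S hS T hT hSr hTr
  rw [faceRank_eq_rk] at hSr hTr
  have hST := flag_le_of_rank_le (h.isPolytope hK).rk_strictMono hS hT (by omega)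
  rcases T.eq_emp_or with rfl | ⟨G, y, rfl⟩
  · rw [h.rk_emp hK] at hTr
    omega
  rw [h.rk_face hK] at hTr
  rcases S.eq_emp_or with rfl | ⟨F, x, rfl⟩
  · rw [h.rk_emp hK] at hSr
    have : j = 1 := by omega
    subst this
    have hinj : Function.Injective (face cls b) := fun x y e => (h.face_bot hb x y).1 e
    change _ = (((if (1 : ℕ) = 1 then c else p (1 - 1)) : ℕ) : ℕ∞)
    rw [if_pos rfl, ← hc G y (by omega), ← hinj.encard_image]
    congr 1
    ext H
    constructor
    · rintro ⟨-, h2, h3⟩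
      rw [faceRank_eq_rk] at h3
      rcases H.eq_emp_or with rfl | ⟨E, z, rfl⟩
      · rw [h.rk_emp hK] at h3
        omega
      · rw [h.rk_face hK] at h3
        have : E = b := le_antisymm (hK.ranked.isBot_of_rank (by omega) b) (hb E)
        exact ⟨z, (h.face_le_iff.1 h2).2, by rw [this]⟩
    · rintro ⟨z, hz, rfl⟩
      refine ⟨emp_le _, h.face_le_iff.2 ⟨hb G, hz⟩, ?_⟩
      rw [faceRank_eq_rk, h.rk_face hK, hb0]
  · rw [h.rk_face hK] at hSr
    obtain ⟨hFG, hx⟩ := h.face_le_iff.1 hST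
    obtain ⟨φ, hF, hG⟩ := Flag.exists_mem_mem hFG
    have hinj : Function.Injective (fun H => face cls H x) := fun A B e => (h.face_eq_iff.1 e).1
    have hj : j ≠ 1 := by omega
    change _ = (((if j = 1 then c else p (j - 1)) : ℕ) : ℕ∞)
    rw [if_neg hj, ← hp (j - 1) (by omega) (by omega) φ F hF G hG
      (by rw [faceRank_eq_rk]; omega) (by rw [faceRank_eq_rk]; omega), ← hinj.encard_image]
    congr 1
    ext H
    constructor
    · rintro ⟨h1, h2, h3⟩
      rw [faceRank_eq_rk] at h3
      rcases H.eq_emp_or with rfl | ⟨E, z, rfl⟩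
      · exact absurd h1 (h.not_face_le_emp _ _)
      · rw [h.rk_face hK] at h3
        obtain ⟨h4, h5⟩ := h.face_le_iff.1 h1
        exact ⟨E, ⟨h4, (h.face_le_iff.1 h2).1, by rw [faceRank_eq_rk]; omega⟩, h.face_eq_face h5⟩
    · rintro ⟨E, ⟨h1, h2, h3⟩, rfl⟩
      rw [faceRank_eq_rk] at h3
      refine ⟨h.face_le_iff.2 ⟨h1, h.mem_self _ _⟩, h.face_le_iff.2 ⟨h2, hx⟩, ?_⟩
      rw [faceRank_eq_rk, h.rk_face hK]
      omega

end ClassSystem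

/-! ### A finite group generated by involutions that can be killed independently -/

section KillableGroup

variable (V : Type u) (D : Type v) [Group D]

/-- The elements of order at most two. -/
abbrev Involutions : Type v := {a : D // a * a = 1}

variable {V D}

/-- The universal choice of an involution for each element of `V`. -/
def gen (v : V) : (V → Involutions D) → D := fun f => (f v).1

theorem gen_mul_self (v : V) : (gen v : (V → Involutions D) → D) * gen v = 1 := by
  funext f
  exact (f v).2

theorem gen_inv (v : V) : (gen v : (V → Involutions D) → D)⁻¹ = gen v :=
  inv_eq_of_mul_eq_one_left (gen_mul_self v)

/-- The subgroup generated by the involutions of a subset of `V`. -/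
def genSubgroup (D : Type v) [Group D] (S : Set V) : Subgroup ((V → Involutions D) → D) :=
  Subgroup.closure (gen '' S)

theorem genSubgroup_mono {S T : Set V} (h : S ⊆ T) : genSubgroup D S ≤ genSubgroup D T :=
  Subgroup.closure_mono (Set.image_mono h)

theorem genSubgroup_empty : genSubgroup D (∅ : Set V) = ⊥ := by
  rw [genSubgroup, Set.image_empty, Subgroup.closure_empty]

theorem gen_mem {S : Set V} {v : V} (hv : v ∈ S) : gen v ∈ genSubgroup D S :=
  Subgroup.subset_closure ⟨v, hv, rfl⟩

/-- Words in the generators of `S` do not see the involution chosen for `v`, so it can be replaced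
by the identity. -/
theorem apply_update_of_mem [DecidableEq V] {S : Set V} {v : V} (hv : v ∉ S)
    {w : (V → Involutions D) → D} (hw : w ∈ genSubgroup D S) (f : V → Involutions D) :
    w (Function.update f v ⟨1, one_mul 1⟩) = w f := by
  induction hw using Subgroup.closure_induction with
  | mem x hx =>
    obtain ⟨u, hu, rfl⟩ := hx
    rw [gen, gen, Function.update_of_ne]
    rintro rfl
    exact hv hu
  | one => rfl
  | mul x y _ _ hx hy => rw [Pi.mul_apply, Pi.mul_apply, hx, hy]
  | inv x _ hx => rw [Pi.inv_apply, Pi.inv_apply, hx]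

/-- Setting the value at `v` to 1 leaves the elements generated by `S` unchanged if `v ∉ S`, but
changes the generator of `v`. This independence makes distinct faces of `K` give distinct subgroups.
-/
theorem gen_mem_iff {a : D} (ha : a * a = 1) (ha1 : a ≠ 1) {S : Set V} {v : V} :
    gen v ∈ genSubgroup D S ↔ v ∈ S := by
  classical
  refine ⟨fun h => ?_, gen_mem⟩
  by_contra hv
  have := apply_update_of_mem hv h (fun _ => ⟨a, ha⟩)
  rw [gen, Function.update_self] at this
  exact ha1 this.symm

theorem mem_genSubgroup_singleton {v : V} {w : (V → Involutions D) → D} :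
    w ∈ genSubgroup D {v} ↔ w = 1 ∨ w = gen v := by
  rw [genSubgroup, Set.image_singleton, Subgroup.mem_closure_singleton]
  constructor
  · rintro ⟨n, rfl⟩
    have h2 : (gen v : (V → Involutions D) → D) ^ (2 : ℤ) = 1 := by
      rw [zpow_two, gen_mul_self]
    rcases Int.even_or_odd' n with ⟨k, rfl | rfl⟩
    · left
      rw [zpow_mul, h2, one_zpow]
    · right
      rw [zpow_add, zpow_mul, h2, one_zpow, one_mul, zpow_one]
  · rintro (rfl | rfl)
    · exact ⟨0, zpow_zero _⟩
    · exact ⟨1, zpow_one _⟩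

theorem card_genSubgroup_image (π : Equiv.Perm V) (S : Set V) :
    Nat.card (genSubgroup D (π '' S)) = Nat.card (genSubgroup D S) := by
  let φ : ((V → Involutions D) → D) →* ((V → Involutions D) → D) :=
    { toFun := fun w f => w (f ∘ π)
      map_one' := rfl
      map_mul' := fun _ _ => rfl }
  have hφ : Function.Injective φ := by
    intro w w' h
    funext f
    have := congrFun h (f ∘ π.symm)
    have e : (f ∘ π.symm) ∘ π = f := by
      funext i
      simp
    change w ((f ∘ π.symm) ∘ π) = w' ((f ∘ π.symm) ∘ π) at this
    rwa [e] at this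
  have hmap : (genSubgroup D S).map φ = genSubgroup D (π '' S) := by
    rw [genSubgroup, MonoidHom.map_closure, genSubgroup, Set.image_image, Set.image_image]
    rfl
  rw [← hmap]
  exact Nat.card_congr ((genSubgroup D S).equivMapOfInjective φ hφ).toEquiv.symm

/-- Every permutation of `V` acts on the whole construction, so all pairs look alike. Hence all
2-faces of the coset geometry have equally many vertices. -/
theorem card_genSubgroup_pair {u v u' v' : V} (h : u ≠ v) (h' : u' ≠ v') :
    Nat.card (genSubgroup D {u, v}) = Nat.card (genSubgroup D {u', v'}) := by
  classical
  obtain ⟨π, h1, h2⟩ : ∃ π : Equiv.Perm V, π u = u' ∧ π v = v' := by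
    refine ⟨(Equiv.swap u u').trans (Equiv.swap (Equiv.swap u u' v) v'), ?_, ?_⟩
    · rw [Equiv.trans_apply, Equiv.swap_apply_left, Equiv.swap_apply_of_ne_of_ne _ h']
      intro e
      have := (Equiv.swap u u').injective ((Equiv.swap_apply_left u u').trans e)
      exact h this
    · rw [Equiv.trans_apply, Equiv.swap_apply_left]
  rw [← card_genSubgroup_image π, Set.image_pair, h1, h2]

/-- Evaluation at a choice with values `a` at `u` and `b` at `v` maps the product of the two
generators to `a * b`. -/
theorem le_card_genSubgroup_pair [Finite V] [Finite D] {u v : V} (h : u ≠ v) {a b : D}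
    (ha : a * a = 1) (hb : b * b = 1) : orderOf (a * b) ≤ Nat.card (genSubgroup D {u, v}) := by
  classical
  let f : V → Involutions D := Function.update (fun _ => ⟨a, ha⟩) v ⟨b, hb⟩
  let x : genSubgroup D {u, v} :=
    ⟨gen u, gen_mem (Or.inl rfl)⟩ * ⟨gen v, gen_mem (Or.inr rfl)⟩
  let ψ : genSubgroup D {u, v} →* D := 
    (Pi.evalMonoidHom (fun _ : V → Involutions D => D) f).comp (genSubgroup D {u, v}).subtype
  have hx : ψ x = a * b := by
    change (f u).1 * (f v).1 = a * b
    simp only [f]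
    rw [Function.update_self, Function.update_of_ne h]
  rw [← hx]
  exact (Nat.le_of_dvd (orderOf_pos x) (orderOf_map_dvd ψ x)).trans (orderOf_le_card)

end KillableGroup

section GroupPolytope

variable {K : Type u} [PartialOrder K] (D : Type v) [Group D]

/-- The left cosets of the subgroups of the group generated by the vertices of `K` that belong to
the faces of `K`. -/
def groupClass (F : K) (x : genSubgroup D (Set.univ : Set (Face K 0))) :
    Set (genSubgroup D (Set.univ : Set (Face K 0))) :=
  {y | (x⁻¹ * y).1 ∈ genSubgroup D {v : Face K 0 | (v : K) ≤ F}}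

variable {D}

theorem encard_groupClass (F : K) (x : genSubgroup D (Set.univ : Set (Face K 0))) :
    (groupClass D F x).encard =
      (genSubgroup D {v : Face K 0 | (v : K) ≤ F} : Set ((Face K 0 → Involutions D) → D)).encard := by
  have hinj : Function.Injective (fun y : genSubgroup D (Set.univ : Set (Face K 0)) =>
      (x⁻¹ * y).1) := fun y z e => mul_left_cancel (Subtype.ext e)
  rw [← hinj.encard_image]
  congr 1
  ext w
  constructor
  · rintro ⟨y, hy, rfl⟩
    exact hy
  · intro hw
    have hw' := genSubgroup_mono (Set.subset_univ _) hw
    refine ⟨x * ⟨w, hw'⟩, ?_, by simp⟩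
    change (x⁻¹ * (x * ⟨w, hw'⟩)).1 ∈ genSubgroup D {v : Face K 0 | (v : K) ≤ F}
    rwa [inv_mul_cancel_left]

/-- The partition axioms hold for cosets of any subgroups. That inclusion of cosets reflects the
order of `K` is `gen_mem_iff`; `path` spells an element of the subgroup as a word in its generators,
one letter at a time. -/
theorem classSystem_groupClass {m : ℕ} (hK : IsPolytope K m) (hv : IsVertexDescribable K) {a : D}
    (ha : a * a = 1) (ha1 : a ≠ 1) : ClassSystem (groupClass (K := K) D) := by
  have hgen : ∀ v : Face K 0, gen v ∈ genSubgroup D (Set.univ : Set (Face K 0)) :=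
    fun v => gen_mem (Set.mem_univ v)
  refine ⟨?_, ?_, ?_, ?_, ?_, ?_, ?_⟩
  · intro F x
    simp [groupClass, one_mem]
  · intro F x y hy
    ext z
    simp only [groupClass, Set.mem_ofPred_eq] at hy ⊢
    constructor
    · intro hz
      have := mul_mem hy hz
      simpa [mul_assoc] using this
    · intro hz
      have := mul_mem (inv_mem hy) hz
      simpa [mul_assoc] using this
  · intro F G x
    rw [hv.le_iff]
    constructor
    · intro hsub v hvF
      have : x * ⟨gen v, hgen v⟩ ∈ groupClass D F x := by
        simp only [groupClass, Set.mem_ofPred_eq, inv_mul_cancel_left]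
        exact gen_mem hvF
      have := hsub this
      simp only [groupClass, Set.mem_ofPred_eq, inv_mul_cancel_left] at this
      have hmem : v ∈ {v : Face K 0 | (v : K) ≤ G} := (gen_mem_iff ha ha1).1 this
      exact hmem
    · intro h y hy
      exact genSubgroup_mono h hy
  · intro F x hF
    have : {v : Face K 0 | (v : K) ≤ F} = ∅ := by
      ext v
      simp only [Set.mem_ofPred_eq, Set.mem_empty_iff_false, iff_false]
      intro hvF
      have := hK.ranked.rank_of_isBot fun b => hvF.trans (hF b)
      rw [rk_vertex] at this
      omega
    ext y
    change (x⁻¹ * y).1 ∈ genSubgroup D {v : Face K 0 | (v : K) ≤ F} ↔ y = x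
    rw [this, genSubgroup_empty, Subgroup.mem_bot, OneMemClass.coe_eq_one, inv_mul_eq_one, eq_comm]
  · intro F x hF
    ext y
    simp only [groupClass, Set.mem_ofPred_eq, Set.mem_univ, iff_true]
    exact genSubgroup_mono (T := {v : Face K 0 | (v : K) ≤ F}) (fun v _ => hF v) (x⁻¹ * y).2
  · intro F x hF
    have hFv : F ∈ Face K 0 := by rw [mem_face_iff]; omega
    have : {v : Face K 0 | (v : K) ≤ F} = {⟨F, hFv⟩} := by
      ext v
      constructor
      · intro h
        rcases (show (v : K) ≤ F from h).eq_or_lt with h | h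
        · exact Subtype.ext h
        · have := hK.rk_strictMono h
          rw [rk_vertex, hF] at this
          omega
      · rintro rfl
        exact le_rfl
    rw [encard_groupClass, this, Set.encard_eq_two]
    refine ⟨1, gen ⟨F, hFv⟩, fun e => ?_, ?_⟩
    · have := congrFun e fun _ => ⟨a, ha⟩
      exact ha1 this.symm
    · ext w
      exact mem_genSubgroup_singleton
  · intro F x y hy
    have key : ∀ w ∈ genSubgroup D {v : Face K 0 | (v : K) ≤ F},
        ∃ hw : w ∈ genSubgroup D (Set.univ : Set (Face K 0)),
        Relation.ReflTransGen (fun a b => ∃ v ≤ F, rk v = 1 ∧ b ∈ groupClass D v a)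
          x (x * ⟨w, hw⟩) := by
      intro w hw
      have step : ∀ (w : (Face K 0 → Involutions D) → D) (v : Face K 0), (v : K) ≤ F →
          (∃ hw : w ∈ genSubgroup D (Set.univ : Set (Face K 0)), Relation.ReflTransGen
            (fun a b => ∃ v ≤ F, rk v = 1 ∧ b ∈ groupClass D v a) x (x * ⟨w, hw⟩)) →
          ∃ hw : w * gen v ∈ genSubgroup D (Set.univ : Set (Face K 0)), Relation.ReflTransGen
            (fun a b => ∃ v ≤ F, rk v = 1 ∧ b ∈ groupClass D v a) x (x * ⟨w * gen v, hw⟩) := by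
        rintro w v hvF ⟨hw, hp⟩
        refine ⟨mul_mem hw (hgen v), hp.tail ⟨v, hvF, rk_vertex v, ?_⟩⟩
        have : (x * ⟨w, hw⟩)⁻¹ * (x * ⟨w * gen v, mul_mem hw (hgen v)⟩) = ⟨gen v, hgen v⟩ := by
          rw [mul_inv_rev, mul_assoc, inv_mul_cancel_left, inv_mul_eq_iff_eq_mul]
          rfl
        simp only [groupClass, Set.mem_ofPred_eq, this]
        exact gen_mem (le_refl (v : K))
      induction hw using Subgroup.closure_induction_right with
      | one => exact ⟨one_mem _, by
          rw [show (⟨1, one_mem _⟩ : genSubgroup D (Set.univ : Set (Face K 0))) = 1 from rfl,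
            mul_one]⟩
      | mul_right w hw z hz ih =>
        obtain ⟨v, hvF, rfl⟩ := hz
        exact step w v hvF ih
      | mul_inv_cancel w hw z hz ih =>
        obtain ⟨v, hvF, rfl⟩ := hz
        rw [gen_inv]
        exact step w v hvF ih
    obtain ⟨hw, hp⟩ := key _ hy
    have : x * ⟨(x⁻¹ * y).1, hw⟩ = y := mul_inv_cancel_left x y
    rwa [this] at hp

theorem IsPolytope.exists_edge_vertices {n : ℕ} (hK : IsPolytope K n) {E : K} (hE : rk E = 2) :
    ∃ u v : Face K 0, u ≠ v ∧ {i : Face K 0 | (i : K) ≤ E} = {u, v} := by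
  obtain ⟨b, hb, hb0⟩ := hK.ranked.exists_bot
  have hbE : b < E := (hb E).lt_of_ne (by rintro rfl; omega)
  have := hK.thin b E hbE (by omega)
  rw [← Set.encard_eq_two, ← this, ← Subtype.val_injective.encard_image]
  congr 1
  ext H
  constructor
  · rintro ⟨i, hi, rfl⟩
    have := rk_vertex i
    exact ⟨(hb i).lt_of_ne fun e => by rw [← e] at this; omega,
      (show (i : K) ≤ E from hi).lt_of_ne fun e => by rw [e] at this; omega⟩
  · rintro ⟨h1, h2⟩
    have r1 := hK.rk_strictMono h1
    have r2 := hK.rk_strictMono h2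
    exact ⟨⟨H, mem_face_iff.2 (by omega)⟩, h2.le, rfl⟩

/-- Each finite vertex-describable equivelar polytope is the vertex-figure of another one with an
arbitrarily large first entry of the type. -/
theorem exists_equivelar_extension {K : Type} [PartialOrder K] [Finite K] {m : ℕ}
    (hK : IsPolytope K m) (hv : IsVertexDescribable K) {p : ℕ → ℕ} (hp : IsEquivelar K m p)
    (s : ℕ) : ∃ (L : Type) (_ : PartialOrder L) (c : ℕ), Finite L ∧ IsPolytope L (m + 1) ∧
      IsVertexDescribable L ∧ s ≤ c ∧
      IsEquivelar L (m + 1) (fun j => if j = 1 then c else p (j - 1)) := by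
  have hsr : ∀ i : ZMod (s + 1), (DihedralGroup.sr i : DihedralGroup (s + 1)) * DihedralGroup.sr i = 1 :=
    fun i => DihedralGroup.sr_mul_self i
  have hC : ClassSystem (groupClass (K := K) (DihedralGroup (s + 1))) :=
    classSystem_groupClass hK hv (hsr 0) (by rintro ⟨⟩)
  -- Two reflections of the dihedral group whose product has order `s + 1` make `c` large. If `K`
  -- has at most one vertex it has no edges, and any `c` will do.
  obtain ⟨c, hsc, hc⟩ : ∃ c, s ≤ c ∧
      ∀ u v : Face K 0, u ≠ v → Nat.card (genSubgroup (DihedralGroup (s + 1)) {u, v}) = c := by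
    by_cases h : ∃ u v : Face K 0, u ≠ v
    · obtain ⟨u, v, huv⟩ := h
      refine ⟨Nat.card (genSubgroup (DihedralGroup (s + 1)) {u, v}), ?_, fun u' v' h' => card_genSubgroup_pair h' huv⟩
      have := le_card_genSubgroup_pair huv (hsr 0) (hsr 1)
      rw [DihedralGroup.sr_mul_sr, sub_zero, DihedralGroup.orderOf_r_one] at this
      omega
    · push Not at h
      exact ⟨s, le_rfl, fun u v huv => absurd (h u v) huv⟩
  refine ⟨ClassPoset (groupClass (K := K) (DihedralGroup (s + 1))), inferInstance, c, inferInstance, hC.isPolytope hK,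
    hC.isVertexDescribable hK, hsc, hC.isEquivelar hK hp fun E x hE => ?_⟩
  obtain ⟨u, v, huv, huvE⟩ := hK.exists_edge_vertices hE
  rw [encard_groupClass, huvE, ← hc u v huv, ← (Set.toFinite _).cast_ncard_eq,
    ← Nat.card_coe_set_eq]
  rfl

theorem isPolytope_bool : IsPolytope Bool 0 ∧ IsVertexDescribable Bool := by
  have hR : Ranked (fun b : Bool => b.toNat) 1 := by
    refine ⟨⟨false, fun b => Bool.false_le b, rfl⟩, ⟨true, fun b => Bool.le_true b, rfl⟩, ?_, ?_⟩
    · intro a b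
      revert a b
      decide
    · decide
  have hle : ∀ b : Bool, b.toNat ≤ 1 := by decide
  constructor
  · refine hR.isPolytope (fun F G _ hr => ?_) fun F G _ hr => ?_
    · have := hle G
      simp only at hr
      omega
    · have := hle G
      simp only at hr
      omega
  · have htrue : true ∈ Face Bool 0 := by
      rw [mem_face_iff, hR.rk_eq]
      rfl
    intro F G
    constructor
    · exact fun hFG v hv => ⟨hv.1, hv.2.trans hFG⟩
    · intro h
      cases F
      · exact Bool.false_le G
      · exact (h ⟨htrue, le_rfl⟩).2

/-- Induction on the rank, starting with a single vertex. Vertex-describability is carried along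
because the extension step needs it. -/
theorem exists_equivelar (m N : ℕ) : ∃ (L : Type) (_ : PartialOrder L) (p : ℕ → ℕ), Finite L ∧
    IsPolytope L m ∧ IsVertexDescribable L ∧ IsEquivelar L m p ∧
    (∀ j ∈ Set.Icc 1 (m - 1), N ≤ p j) ∧ Set.InjOn p (Set.Icc 1 (m - 1)) := by
  induction m with
  | zero =>
    refine ⟨Bool, inferInstance, id, inferInstance, isPolytope_bool.1, isPolytope_bool.2,
      fun j h1 h2 => by omega, ?_, Function.injective_id.injOn⟩
    rintro j ⟨h1, h2⟩
    omega
  | succ m ih =>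
    obtain ⟨K, _, p, _, hK, hv, hp, hpN, hpinj⟩ := ih
    -- The new first entry exceeds `N` and, through the sum, every old entry, so the entries remain
    -- distinct.
    obtain ⟨L, _, c, hL1, hL2, hL3, hsc, hL4⟩ := exists_equivelar_extension hK hv hp
      (N + 1 + ∑ j ∈ Finset.range m, p j)
    have hlt : ∀ j ∈ Set.Icc 1 (m - 1), p j < c := by
      rintro j ⟨h1, h2⟩
      have := Finset.single_le_sum (f := p) (fun i _ => Nat.zero_le _)
        (Finset.mem_range.2 (show j < m by omega))
      omega
    refine ⟨L, _, _, hL1, hL2, hL3, hL4, ?_, ?_⟩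
    · rintro j ⟨h1, h2⟩
      by_cases e : j = 1
      · simp only [e, if_true]
        omega
      · simp only [e, if_false]
        exact hpN (j - 1) ⟨by omega, by omega⟩
    · rintro i ⟨hi1, hi2⟩ j ⟨hj1, hj2⟩ e
      by_cases ei : i = 1 <;> by_cases ej : j = 1 <;> simp only [ei, ej, if_true, if_false] at e
      · omega
      · have := hlt (j - 1) ⟨by omega, by omega⟩
        omega
      · have := hlt (i - 1) ⟨by omega, by omega⟩
        omega
      · have := hpinj ⟨by omega, by omega⟩ ⟨by omega, by omega⟩ e
        omega

end GroupPolytope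

end AbstractPolytope

/-! ### Lower bounds for the numbers of faces and flags -/

namespace AbstractPolytope

theorem IsSimplicialManifold.ncard_face {V : Type u} {C : Set (Set V)} {d : ℕ}
    (h : IsSimplicialManifold C d) {j : ℕ} (hj : j < d) :
    (Face (FacePoset C) j).ncard = {s | s ∈ C ∧ s.ncard = j + 1}.ncard := by
  have e1 : Face (FacePoset C) j =
      (fun a : C => (a : WithTop C)) '' {a | a.1.ncard = j + 1} := by
    ext F
    rw [h.mem_face_iff hj]
    constructor
    · rintro ⟨s, hs, rfl, hc⟩
      exact ⟨⟨s, hs⟩, hc, rfl⟩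
    · rintro ⟨⟨s, hs⟩, hc, rfl⟩
      exact ⟨s, hs, rfl, hc⟩
  have e2 : {s | s ∈ C ∧ s.ncard = j + 1} = Subtype.val '' {a : C | a.1.ncard = j + 1} := by
    ext s
    constructor
    · rintro ⟨hs, hc⟩
      exact ⟨⟨s, hs⟩, hc, rfl⟩
    · rintro ⟨⟨s, hs⟩, hc, rfl⟩
      exact ⟨hs, hc⟩
  rw [e1, e2, Set.ncard_image_of_injective _ WithTop.coe_injective,
    Set.ncard_image_of_injective _ Subtype.val_injective]

section

variable {L : Type u} [PartialOrder L] {m : ℕ} (hL : IsPolytope L m) [Finite L]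
include hL

/-- For each vertex `u` of `L`, the faces of ranks `1, ..., j + 1` in a flag through `u` form a
`j`-simplex that determines `u`. At most one of these simplices is the subdivided facet, hence `N +
1` in the hypothesis. -/
theorem IsPolytope.le_ncard_face_subdivided (Φ : Flag L) {N : ℕ}
    (hN : N + 1 ≤ (Face L 0).ncard) {j : ℕ} (hj : j < m) :
    N ≤ (Face (SubdividedOrderComplex Φ) j).ncard := by
  classical
  have M := hL.isSimplicialManifold_subdivided Φ (by omega)
  rw [M.ncard_face hj]
  choose Ψ hΨ using fun u : L => Flag.exists_mem u
  let s : L → Set L := fun u => {H | H ∈ Ψ u ∧ 1 ≤ rk H ∧ rk H ≤ j + 1}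
  have hs : ∀ u, s u ∈ orderComplex L := fun u =>
    hL.mem_orderComplex.2 ⟨(Ψ u).chain_le.mono fun _ h => h.1, fun F hF => ⟨hF.2.1, by
      have := hF.2.2
      omega⟩⟩
  have hcard : ∀ u, (s u).ncard = j + 1 := by
    intro u
    have hinj : Set.InjOn rk (s u) := fun F hF G hG e =>
      flag_eq_of_rank_eq hL.rk_strictMono hF.1 hG.1 e
    have himg : rk '' s u = Set.Icc 1 (j + 1) := by
      ext k
      constructor
      · rintro ⟨F, hF, rfl⟩
        exact hF.2
      · intro hk
        obtain ⟨F, hF, e⟩ := hL.ranked.exists_mem_flag (Ψ u) (k := k) (by have := hk.2; omega)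
        exact ⟨F, ⟨hF, by rw [e]; exact hk⟩, e⟩
    rw [← hinj.ncard_image, himg, Set.ncard_eq_toFinset_card']
    simp
  have hsinj : Set.InjOn s (Face L 0) := by
    intro u hu v hv e
    rw [mem_face_iff] at hu hv
    have hmem : u ∈ s v := e ▸ ⟨hΨ u, by omega, by omega⟩
    exact flag_eq_of_rank_eq hL.rk_strictMono hmem.1 (hΨ v) (by omega)
  have hinj : Set.InjOn (fun u => oldSet (s u)) (Face L 0) :=
    fun u hu v hv e => hsinj hu hv (oldSet_injective e)
  have hbad : {u ∈ Face L 0 | s u = flagSimplex Φ}.ncard ≤ 1 := by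
    rw [Set.ncard_le_one]
    rintro u ⟨hu, hu'⟩ v ⟨hv, hv'⟩
    exact hsinj hu hv (hu'.trans hv'.symm)
  calc N ≤ (Face L 0).ncard - {u ∈ Face L 0 | s u = flagSimplex Φ}.ncard := by omega
    _ ≤ (Face L 0 \ {u ∈ Face L 0 | s u = flagSimplex Φ}).ncard := Set.le_ncard_sdiff _ _
    _ = ((fun u => oldSet (s u)) '' (Face L 0 \ {u ∈ Face L 0 | s u = flagSimplex Φ})).ncard :=
      ((hinj.mono Set.sdiff_subset).ncard_image).symm
    _ ≤ _ := by
      refine Set.ncard_le_ncard ?_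
      rintro _ ⟨u, ⟨hu, hu'⟩, rfl⟩
      refine ⟨oldSet_mem.2 ⟨hs u, fun e => hu' ⟨hu, e⟩⟩, ?_⟩
      rw [Set.ncard_image_of_injective _ (Option.some_injective L), hcard]

end

theorem IsPolytope.ncard_face_le_card_flag {K : Type u} [PartialOrder K] [Finite K] {m : ℕ}
    (hK : IsPolytope K m) (j : ℤ) : (Face K j).ncard ≤ Nat.card (Flag K) := by
  have : Finite (Flag K) := Finite.of_injective (fun Φ : Flag K => (Φ : Set K)) SetLike.coe_injective
  choose Ψ hΨ using fun F : Face K j => Flag.exists_mem (F : K)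
  rw [← Nat.card_coe_set_eq]
  refine Nat.card_le_card_of_injective Ψ fun F G e => Subtype.ext ?_
  have h1 := mem_face_iff.1 F.2
  have h2 := mem_face_iff.1 G.2
  exact flag_eq_of_rank_eq hK.rk_strictMono (hΨ F) (e ▸ hΨ G) (by omega)

/-- The first entry of the type bounds the number of vertices. -/
theorem IsEquivelar.le_ncard_vertices {L : Type u} [PartialOrder L] [Finite L] {m : ℕ}
    (hL : IsPolytope L m) {p : ℕ → ℕ} (hp : IsEquivelar L m p) (hm : 2 ≤ m) :
    p 1 ≤ (Face L 0).ncard := by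
  obtain ⟨b, hb⟩ := hL.exists_least
  obtain ⟨Φ, hΦ⟩ := Flag.exists_mem b
  obtain ⟨G, hG, hG3⟩ := hL.ranked.exists_mem_flag Φ (k := 3) (by omega)
  have := hp 1 le_rfl (by omega) Φ b hΦ G hG (by
    rw [faceRank_eq_rk, hL.ranked.rank_of_isBot hb]
    rfl) (by
    rw [faceRank_eq_rk, hG3]
    rfl)
  rw [← (Set.toFinite _).cast_ncard_eq, Nat.cast_inj] at this
  rw [← this]
  exact Set.ncard_le_ncard fun H hH => hH.2.2

end AbstractPolytope

/-! ### Triangulations from hexagonal directions in an abelian group -/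

namespace AbstractPolytope

/-- Six directions in an abelian group that behave like the unit vectors of the triangular
lattice in cyclic order. -/
structure IsHexagonal {A : Type u} [AddCommGroup A] (d : ZMod 6 → A) : Prop where
  neg : ∀ i, d (i + 3) = -d i
  add : ∀ i, d i + d (i + 2) = d (i + 1)
  inj : Function.Injective d
  generate : AddSubmonoid.closure (Set.range d) = ⊤

/-- The triangle spanned by a point and two consecutive directions. -/
def hexTriangle {A : Type u} [AddCommGroup A] (d : ZMod 6 → A) (v : A) (i : ZMod 6) : Set A :=
  {v, v + d i, v + d (i + 1)}

/-- The simplicial complex of the triangles spanned by consecutive directions. -/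
def hexComplex {A : Type u} [AddCommGroup A] (d : ZMod 6 → A) : Set (Set A) :=
  {s | ∃ v i, s ⊆ hexTriangle d v i}

theorem zmod_six_add_ne (i : ZMod 6) :
    i + 1 ≠ i ∧ i + 2 ≠ i ∧ i + 3 ≠ i ∧ i + 3 + 3 = i ∧ i + 3 + 1 ≠ i := by
  revert i
  decide

theorem zmod_six_eq_of_pairs (i j : ZMod 6) (h1 : i = j ∨ i = j + 1)
    (h2 : i + 1 = j ∨ i + 1 = j + 1) : i = j := by
  revert i j
  decide

namespace IsHexagonal

variable {A : Type u} [AddCommGroup A] {d : ZMod 6 → A} (h : IsHexagonal d)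

theorem self_mem (v : A) (i : ZMod 6) : v ∈ hexTriangle d v i := Or.inl rfl

theorem fst_mem (v : A) (i : ZMod 6) : v + d i ∈ hexTriangle d v i := Or.inr (Or.inl rfl)

theorem snd_mem (v : A) (i : ZMod 6) : v + d (i + 1) ∈ hexTriangle d v i := Or.inr (Or.inr rfl)

theorem triangle_mem (v : A) (i : ZMod 6) : hexTriangle d v i ∈ hexComplex d :=
  ⟨v, i, subset_rfl⟩

include h

theorem ne_zero (i : ZMod 6) : d i ≠ 0 := fun e => by
  have := h.neg i
  rw [e, neg_zero, ← e] at this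
  exact (zmod_six_add_ne i).2.2.1 (h.inj this)

theorem add_ne (v : A) (i : ZMod 6) : v + d i ≠ v := fun e =>
  h.ne_zero i (add_eq_left.1 e)

theorem add_right_inj {v : A} {i j : ZMod 6} : v + d i = v + d j ↔ i = j :=
  ⟨fun e => h.inj (add_left_cancel e), fun e => by rw [e]⟩

/-- The same triangle described from its next vertex. With `rotate_two`, every triangle can be
described from any of its vertices, so all questions become local to one point. -/
theorem rotate (v : A) (i : ZMod 6) :
    hexTriangle d (v + d i) (i + 2) = hexTriangle d v i := by
  have e1 : v + d i + d (i + 2) = v + d (i + 1) := by rw [add_assoc, h.add]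
  have e2 : v + d i + d (i + 2 + 1) = v := by
    rw [show i + 2 + 1 = i + 3 by ring, h.neg, add_neg_cancel_right]
  rw [hexTriangle, e1, e2, hexTriangle]
  ext x
  simp only [Set.mem_insert_iff, Set.mem_singleton_iff]
  tauto

theorem rotate_two (v : A) (i : ZMod 6) :
    hexTriangle d (v + d (i + 1)) (i + 4) = hexTriangle d v i := by
  rw [← h.rotate v i, ← h.rotate (v + d i) (i + 2), add_assoc v, h.add,
    show i + 2 + 2 = i + 4 by ring]

theorem exists_eq_of_mem {u v : A} {i : ZMod 6} (hu : u ∈ hexTriangle d v i) :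
    ∃ k, hexTriangle d v i = hexTriangle d u k := by
  rcases hu with rfl | rfl | rfl
  · exact ⟨i, rfl⟩
  · exact ⟨_, (h.rotate v i).symm⟩
  · exact ⟨_, (h.rotate_two v i).symm⟩

theorem add_mem_iff {v : A} {i k : ZMod 6} :
    v + d k ∈ hexTriangle d v i ↔ k = i ∨ k = i + 1 := by
  simp only [hexTriangle, Set.mem_insert_iff, Set.mem_singleton_iff, h.add_right_inj, h.add_ne,
    false_or]

theorem triangle_inj {v : A} {i j : ZMod 6} :
    hexTriangle d v i = hexTriangle d v j ↔ i = j := by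
  refine ⟨fun e => ?_, fun e => by rw [e]⟩
  have h1 := h.add_mem_iff.1 (e ▸ fst_mem v i)
  have h2 := h.add_mem_iff.1 (e ▸ snd_mem v i)
  exact zmod_six_eq_of_pairs i j h1 h2

theorem encard_triangle (v : A) (i : ZMod 6) : (hexTriangle d v i).encard = 3 := by
  rw [hexTriangle, Set.encard_eq_three]
  exact ⟨_, _, _, (h.add_ne v i).symm, (h.add_ne v _).symm,
    fun e => (zmod_six_add_ne i).1 (h.add_right_inj.1 e).symm, rfl⟩

theorem eq_triangle {t : Set A} (ht : t ∈ hexComplex d) (hc : t.encard = 3) {v : A} (hv : v ∈ t) :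
    ∃ i, t = hexTriangle d v i := by
  obtain ⟨w, j, hwj⟩ := ht
  obtain ⟨i, hi⟩ := h.exists_eq_of_mem (hwj hv)
  refine ⟨i, hi ▸ Set.Finite.eq_of_subset_of_encard_le' ?_ hwj ?_⟩
  · rw [← Set.encard_lt_top_iff, h.encard_triangle]
    exact ENat.natCast_lt_top 3
  · rw [h.encard_triangle, hc]

theorem eq_edge {s : Set A} (hs : s ∈ hexComplex d) (hc : s.encard = 2) {v : A} (hv : v ∈ s) :
    ∃ i, s = {v, v + d i} := by
  obtain ⟨w, j, hwj⟩ := hs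
  obtain ⟨i, hi⟩ := h.exists_eq_of_mem (hwj hv)
  rw [hi] at hwj
  obtain ⟨x, hx⟩ := Set.encard_eq_one.1 (show (s \ {v}).encard = 1 by
    have := Set.encard_sdiff_singleton_add_one hv
    rw [hc] at this
    exact ENat.add_left_injective_of_ne_top ENat.one_ne_top this)
  have hxs : x ∈ s \ {v} := hx ▸ rfl
  have hs : s = {v, x} := by rw [← hx, Set.insert_sdiff_singleton, Set.insert_eq_of_mem hv]
  rcases hwj hxs.1 with e | e | e
  · exact absurd e hxs.2
  · exact ⟨i, by rw [hs, e]⟩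
  · exact ⟨i + 1, by rw [hs, e]⟩

omit h in
theorem edge_mem (v : A) (i : ZMod 6) : {v, v + d i} ∈ hexComplex d :=
  ⟨v, i, Set.insert_subset (self_mem v i) (Set.singleton_subset_iff.2 (fst_mem v i))⟩

omit h in
theorem vertex_mem (v : A) : {v} ∈ hexComplex d :=
  ⟨v, 0, Set.singleton_subset_iff.2 (self_mem v 0)⟩

theorem encard_edge (v : A) (i : ZMod 6) : ({v, v + d i} : Set A).encard = 2 :=
  Set.encard_pair (h.add_ne v i).symm

theorem star_connected (v : A) (i j : ZMod 6) :
    Relation.ReflTransGen (FacetStep (hexComplex d) 3 {v}) (hexTriangle d v i)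
      (hexTriangle d v j) := by
  have key : ∀ n : ℕ, Relation.ReflTransGen (FacetStep (hexComplex d) 3 {v}) (hexTriangle d v i)
      (hexTriangle d v (i + n)) := by
    intro n
    induction n with
    | zero => rw [Nat.cast_zero, add_zero]
    | succ n ih =>
      rw [Nat.cast_succ, ← add_assoc]
      refine ih.tail ⟨triangle_mem _ _, h.encard_triangle _ _,
        Set.singleton_subset_iff.2 (self_mem _ _), ?_⟩
      have : ({v, v + d (i + n + 1)} : Set A) ⊆
          hexTriangle d v (i + n) ∩ hexTriangle d v (i + n + 1) :=
        Set.insert_subset ⟨self_mem _ _, self_mem _ _⟩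
          (Set.singleton_subset_iff.2 ⟨snd_mem _ _, fst_mem _ _⟩)
      have := Set.encard_le_encard this
      rw [h.encard_edge] at this
      calc ((3 : ℕ) : ℕ∞) = 2 + 1 := rfl
        _ ≤ _ := by gcongr
  have := key (j - i).val
  rwa [ZMod.natCast_zmod_val, add_sub_cancel] at this

/-- Turning around a point reaches all triangles at it, and a triangle containing `v + x + d k`
moves the base point along `d k`; the directions generate the group. -/
theorem connected (v w : A) (i j : ZMod 6) :
    Relation.ReflTransGen (FacetStep (hexComplex d) 3 ∅) (hexTriangle d v i)
      (hexTriangle d w j) := by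
  have star : ∀ v i j, Relation.ReflTransGen (FacetStep (hexComplex d) 3 ∅) (hexTriangle d v i)
      (hexTriangle d v j) := fun v i j =>
    Relation.ReflTransGen.mono (fun _ _ hab => ⟨hab.1, hab.2.1, Set.empty_subset _, hab.2.2.2⟩) _ _
      (h.star_connected v i j)
  have key : ∀ x ∈ AddSubmonoid.closure (Set.range d), ∀ j,
      Relation.ReflTransGen (FacetStep (hexComplex d) 3 ∅) (hexTriangle d v i)
      (hexTriangle d (v + x) j) := by
    intro x hx
    induction hx using AddSubmonoid.closure_induction_right with
    | zero =>
      intro j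
      rw [add_zero]
      exact star v i j
    | add_right x _ y hy ih =>
      obtain ⟨k, rfl⟩ := hy
      intro j
      refine (ih k).trans ?_
      rw [← h.rotate, ← add_assoc]
      exact star _ _ _
  have := key (w - v) (h.generate ▸ AddSubmonoid.mem_top _) j
  rwa [add_sub_cancel] at this

theorem facets_of_edge (v : A) (i : ZMod 6) :
    {t | t ∈ hexComplex d ∧ {v, v + d (i + 1)} ⊆ t ∧ t.encard = 3} =
      {hexTriangle d v i, hexTriangle d v (i + 1)} := by
  ext t
  constructor
  · rintro ⟨ht, hsub, hc⟩
    obtain ⟨k, rfl⟩ := h.eq_triangle ht hc (hsub (Or.inl rfl))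
    rcases h.add_mem_iff.1 (hsub (Or.inr rfl)) with e | e
    · exact Or.inr (by rw [e]; rfl)
    · exact Or.inl (by rw [add_right_cancel e])
  · rintro (rfl | rfl)
    · exact ⟨triangle_mem _ _, Set.insert_subset (self_mem _ _)
        (Set.singleton_subset_iff.2 (snd_mem _ _)), h.encard_triangle _ _⟩
    · exact ⟨triangle_mem _ _, Set.insert_subset (self_mem _ _)
        (Set.singleton_subset_iff.2 (fst_mem _ _)), h.encard_triangle _ _⟩

theorem isSimplicialManifold : IsSimplicialManifold (hexComplex d) 3 where
  down := fun s ⟨v, i, hs⟩ t hts => ⟨v, i, hts.trans hs⟩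
  empty_mem := ⟨0, 0, Set.empty_subset _⟩
  pure := fun s ⟨v, i, hs⟩ => ⟨_, triangle_mem v i, hs, h.encard_triangle v i⟩
  ridge := fun s hs hc => by
    have hc2 : s.encard = 2 := ENat.add_left_injective_of_ne_top ENat.one_ne_top hc
    obtain ⟨v, hv⟩ : s.Nonempty := Set.encard_ne_zero.1 (by rw [hc2]; norm_num)
    obtain ⟨i, rfl⟩ := h.eq_edge hs hc2 hv
    have := h.facets_of_edge v (i - 1)
    rw [sub_add_cancel] at this
    refine (congrArg Set.encard this).trans (Set.encard_pair fun e => ?_)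
    have := h.triangle_inj.1 e
    exact (zmod_six_add_ne (i - 1)).1 (by rw [sub_add_cancel, this])
  connected := fun s hs hc a ha b hb hsa hsb hac hbc => by
    have hc1 : s.encard ≤ 1 := by
      have : s.encard + 2 ≤ 1 + 2 := hc
      exact (ENat.add_le_add_iff_right (by norm_num)).1 this
    rcases s.eq_empty_or_nonempty with rfl | ⟨v, hv⟩
    · obtain ⟨v, hv⟩ : a.Nonempty := Set.encard_ne_zero.1 (by rw [hac]; norm_num)
      obtain ⟨w, hw⟩ : b.Nonempty := Set.encard_ne_zero.1 (by rw [hbc]; norm_num)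
      obtain ⟨i, rfl⟩ := h.eq_triangle ha hac hv
      obtain ⟨j, rfl⟩ := h.eq_triangle hb hbc hw
      exact h.connected v w i j
    · obtain rfl : s = {v} := Set.eq_singleton_iff_unique_mem.2
        ⟨hv, fun x hx => Set.encard_le_one_iff.1 hc1 x v hx hv⟩
      obtain ⟨i, rfl⟩ := h.eq_triangle ha hac (hsa rfl)
      obtain ⟨j, rfl⟩ := h.eq_triangle hb hbc (hsb rfl)
      exact h.star_connected v i j

end IsHexagonal

end AbstractPolytope

/-! ### Toroidal maps of type `{3,6}` -/

namespace AbstractPolytope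

theorem Adjacent.mem_or_mem {P : Type u} [PartialOrder P] {Φ Ψ : Flag P} (h : Adjacent Φ Ψ)
    {F G : P} (hF : F ∈ Φ) (hG : G ∈ Φ) (hne : F ≠ G) : F ∈ Ψ ∨ G ∈ Ψ := by
  obtain ⟨H, hH⟩ := h.exists_eq
  by_contra hcon
  push Not at hcon
  have h1 : F ∈ (Φ : Set P) \ Ψ := ⟨hF, hcon.1⟩
  have h2 : G ∈ (Φ : Set P) \ Ψ := ⟨hG, hcon.2⟩
  rw [hH] at h1 h2
  exact hne (h1.trans h2.symm)

/-- Adjacent flags of a 3-polytope differ in exactly one proper face. -/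
theorem IsPolytope.adjacent_three {P : Type u} [PartialOrder P] (hP : IsPolytope P 3)
    {Φ Ψ : Flag P} (h : Adjacent Φ Ψ) {x y z : P} (hx : x ∈ Φ) (hy : y ∈ Φ) (hz : z ∈ Φ)
    (hx1 : rk x = 1) (hy2 : rk y = 2) (hz3 : rk z = 3) :
    (x ∈ Ψ ∧ y ∈ Ψ ∧ z ∉ Ψ) ∨ (x ∈ Ψ ∧ y ∉ Ψ ∧ z ∈ Ψ) ∨ (x ∉ Ψ ∧ y ∈ Ψ ∧ z ∈ Ψ) := by
  have hxy := h.mem_or_mem hx hy (by rintro rfl; omega)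
  have hxz := h.mem_or_mem hx hz (by rintro rfl; omega)
  have hyz := h.mem_or_mem hy hz (by rintro rfl; omega)
  have hall : ¬ (x ∈ Ψ ∧ y ∈ Ψ ∧ z ∈ Ψ) := by
    rintro ⟨h1, h2, h3⟩
    obtain ⟨H, hH⟩ := h.exists_eq
    have hH' : H ∈ (Φ : Set P) \ Ψ := hH ▸ rfl
    have heq : ∀ F ∈ Φ, F ∈ Ψ → rk H ≠ rk F := fun F hF hF' e =>
      hH'.2 (flag_eq_of_rank_eq hP.rk_strictMono hH'.1 hF e ▸ hF')
    have e1 := heq x hx h1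
    have e2 := heq y hy h2
    have e3 := heq z hz h3
    have e0 : rk H ≠ 0 := fun e => hH'.2 (mem_flag_of_isBot (hP.ranked.isBot_of_rank e) Ψ)
    have e4 : rk H ≠ 3 + 1 := fun e => hH'.2 (mem_flag_of_isTop (hP.ranked.isTop_of_rank e) Ψ)
    have := hP.rk_le H
    omega
  tauto

namespace IsHexagonal

variable {A : Type u} [AddCommGroup A] {d : ZMod 6 → A} (h : IsHexagonal d)

/-- A point, as a face. -/
def vertexFace (d : ZMod 6 → A) (v : A) : FacePoset (hexComplex d) := simplexFace _ (vertex_mem v)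

/-- The edge from a point in one of the directions. -/
def edgeFace (d : ZMod 6 → A) (v : A) (i : ZMod 6) : FacePoset (hexComplex d) :=
  simplexFace _ (edge_mem v i)

/-- The triangle spanned by a point and two consecutive directions, as a face. -/
def triangleFace (d : ZMod 6 → A) (v : A) (i : ZMod 6) : FacePoset (hexComplex d) :=
  simplexFace _ (triangle_mem v i)

theorem vertexFace_inj {v w : A} : vertexFace d v = vertexFace d w ↔ v = w := by
  rw [vertexFace, vertexFace, simplexFace_inj, Set.singleton_eq_singleton_iff]

theorem vertexFace_le_edgeFace (v : A) (i : ZMod 6) : vertexFace d v ≤ edgeFace d v i :=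
  simplexFace_le.2 (Set.singleton_subset_iff.2 (Or.inl rfl))

include h

theorem rk_vertexFace (v : A) : rk (vertexFace d v) = 1 := by
  rw [vertexFace, h.isSimplicialManifold.rk_simplexFace, Set.ncard_singleton]

theorem rk_edgeFace (v : A) (i : ZMod 6) : rk (edgeFace d v i) = 2 := by
  rw [edgeFace, h.isSimplicialManifold.rk_simplexFace, Set.ncard_pair (h.add_ne v i).symm]

theorem rk_triangleFace (v : A) (i : ZMod 6) : rk (triangleFace d v i) = 3 := by
  rw [triangleFace, h.isSimplicialManifold.rk_simplexFace,
    ← h.isSimplicialManifold.encard_eq_iff (triangle_mem v i)]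
  exact h.encard_triangle v i

theorem edgeFace_inj {v w : A} {i j : ZMod 6} :
    edgeFace d v i = edgeFace d w j ↔ (v = w ∧ i = j) ∨ (w = v + d i ∧ j = i + 3) := by
  rw [edgeFace, edgeFace, simplexFace_inj]
  constructor
  · intro e
    have hw : w ∈ ({v, v + d i} : Set A) := e ▸ Or.inl rfl
    rcases hw with rfl | rfl
    · have : w + d i ∈ ({w, w + d j} : Set A) := e ▸ Or.inr rfl
      exact Or.inl ⟨rfl, this.elim (fun e => absurd e (h.add_ne _ _)) h.add_right_inj.1⟩
    · have : v ∈ ({v + d i, v + d i + d j} : Set A) := e ▸ Or.inl rfl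
      refine Or.inr ⟨rfl, h.inj ?_⟩
      rcases this with e | e
      · exact absurd e.symm (h.add_ne _ _)
      · rw [h.neg]
        have e' : v + d i + d j = v := e.symm
        rw [add_assoc, add_eq_left] at e'
        exact (neg_eq_of_add_eq_zero_right e').symm
  · rintro (⟨rfl, rfl⟩ | ⟨rfl, rfl⟩)
    · rfl
    · rw [h.neg, add_neg_cancel_right, Set.pair_comm]

theorem triangleFace_inj {v : A} {i j : ZMod 6} :
    triangleFace d v i = triangleFace d v j ↔ i = j := by
  rw [triangleFace, triangleFace, simplexFace_inj, h.triangle_inj]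

theorem exists_vertexFace {F : FacePoset (hexComplex d)} (hF : rk F = 1) :
    ∃ v, F = vertexFace d v := by
  rcases eq_top_or_simplexFace F with rfl | ⟨s, hs, rfl⟩
  · rw [h.isSimplicialManifold.rk_top] at hF
    omega
  · rw [h.isSimplicialManifold.rk_simplexFace] at hF
    obtain ⟨v, rfl⟩ := Set.ncard_eq_one.1 hF
    exact ⟨v, rfl⟩

theorem exists_edgeFace {F : FacePoset (hexComplex d)} (hF : rk F = 2) {v : A}
    (hv : vertexFace d v ≤ F) : ∃ i, F = edgeFace d v i := by
  rcases eq_top_or_simplexFace F with rfl | ⟨s, hs, rfl⟩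
  · rw [h.isSimplicialManifold.rk_top] at hF
    omega
  · rw [h.isSimplicialManifold.rk_simplexFace,
      ← h.isSimplicialManifold.encard_eq_iff hs] at hF
    obtain ⟨i, rfl⟩ := h.eq_edge hs hF (simplexFace_le.1 hv rfl)
    exact ⟨i, rfl⟩

theorem exists_triangleFace {F : FacePoset (hexComplex d)} (hF : rk F = 3) {v : A}
    (hv : vertexFace d v ≤ F) : ∃ i, F = triangleFace d v i := by
  rcases eq_top_or_simplexFace F with rfl | ⟨s, hs, rfl⟩
  · rw [h.isSimplicialManifold.rk_top] at hF
    omega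
  · rw [h.isSimplicialManifold.rk_simplexFace,
      ← h.isSimplicialManifold.encard_eq_iff hs] at hF
    obtain ⟨i, rfl⟩ := h.eq_triangle hs hF (simplexFace_le.1 hv rfl)
    exact ⟨i, rfl⟩

theorem edgeFace_le_triangleFace {v : A} {i k : ZMod 6} :
    edgeFace d v k ≤ triangleFace d v i ↔ k = i ∨ k = i + 1 := by
  rw [edgeFace, triangleFace, simplexFace_le, Set.insert_subset_iff, Set.singleton_subset_iff,
    h.add_mem_iff]
  exact and_iff_right (self_mem v i)

theorem exists_mem_flag (Φ : Flag (FacePoset (hexComplex d))) :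
    ∃ v i, vertexFace d v ∈ Φ ∧ triangleFace d v i ∈ Φ ∧
      (edgeFace d v i ∈ Φ ∨ edgeFace d v (i + 1) ∈ Φ) := by
  have hP := h.isSimplicialManifold.isPolytope
  obtain ⟨x, hx, hx1⟩ := hP.ranked.exists_mem_flag Φ (k := 1) (by omega)
  obtain ⟨y, hy, hy2⟩ := hP.ranked.exists_mem_flag Φ (k := 2) (by omega)
  obtain ⟨z, hz, hz3⟩ := hP.ranked.exists_mem_flag Φ (k := 3) (by omega)
  have hxy := flag_le_of_rank_le hP.rk_strictMono hx hy (by omega)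
  have hyz := flag_le_of_rank_le hP.rk_strictMono hy hz (by omega)
  obtain ⟨v, rfl⟩ := h.exists_vertexFace hx1
  obtain ⟨i, rfl⟩ := h.exists_edgeFace hy2 hxy
  obtain ⟨j, rfl⟩ := h.exists_triangleFace hz3 (hxy.trans hyz)
  refine ⟨v, j, hx, hz, ?_⟩
  rcases h.edgeFace_le_triangleFace.1 hyz with rfl | rfl
  · exact Or.inl hy
  · exact Or.inr hy

/-- The function `3 * j` encodes the type `{3,6}`: triangles have three vertices, and six directions
leave each point. -/
theorem isEquivelar : IsEquivelar (FacePoset (hexComplex d)) 3 fun j => 3 * j := by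
  have M := h.isSimplicialManifold
  have hP := M.isPolytope
  intro j h1 h2 Φ F hF G hG hFr hGr
  have hFG := flag_le_of_rank_le hP.rk_strictMono hF hG (by
    rw [faceRank_eq_rk] at hFr hGr
    omega)
  rw [faceRank_eq_rk] at hFr hGr
  obtain rfl | rfl : j = 1 ∨ j = 2 := by omega
  · have hG3 : rk G = 3 := by omega
    rcases eq_top_or_simplexFace G with rfl | ⟨t, ht, rfl⟩
    · rw [M.rk_top] at hG3
      omega
    rw [M.rk_simplexFace, ← M.encard_eq_iff ht] at hG3
    have hinj : Function.Injective (vertexFace d) := fun v w => vertexFace_inj.1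
    refine Eq.trans ?_ (hinj.encard_image t |>.trans hG3)
    congr 1
    ext H
    constructor
    · rintro ⟨-, hH, hr⟩
      rw [faceRank_eq_rk] at hr
      obtain ⟨v, rfl⟩ := h.exists_vertexFace (F := H) (by omega)
      exact ⟨v, simplexFace_le.1 hH rfl, rfl⟩
    · rintro ⟨v, hv, rfl⟩
      refine ⟨hP.ranked.isBot_of_rank (by omega) _,
        simplexFace_le.2 (Set.singleton_subset_iff.2 hv), ?_⟩
      rw [faceRank_eq_rk, h.rk_vertexFace]
  · obtain ⟨v, rfl⟩ := h.exists_vertexFace (F := F) (by omega)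
    have hinj : Function.Injective (edgeFace d v) := fun i j e =>
      (h.edgeFace_inj.1 e).elim And.right fun h' => absurd h'.1.symm (h.add_ne _ _)
    have hcard : (Set.univ : Set (ZMod 6)).encard = 6 := by
      rw [Set.encard_univ, ENat.card_eq_coe_fintype_card, ZMod.card]
      rfl
    refine Eq.trans ?_ (hinj.encard_image Set.univ |>.trans hcard)
    congr 1
    ext H
    constructor
    · rintro ⟨hH, -, hr⟩
      rw [faceRank_eq_rk] at hr
      obtain ⟨i, rfl⟩ := h.exists_edgeFace (F := H) (by omega) hH
      exact ⟨i, trivial, rfl⟩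
    · rintro ⟨i, -, rfl⟩
      refine ⟨vertexFace_le_edgeFace v i, hP.ranked.isTop_of_rank (by omega) _, ?_⟩
      rw [faceRank_eq_rk, h.rk_edgeFace]

omit h in
/-- The flags whose edge precedes their triangle in the cyclic order around their vertex. -/
def IsPositive (Φ : Flag (FacePoset (hexComplex d))) : Prop :=
  ∃ v i, vertexFace d v ∈ Φ ∧ edgeFace d v i ∈ Φ ∧ triangleFace d v i ∈ Φ

theorem exists_of_not_isPositive {Φ : Flag (FacePoset (hexComplex d))} (hΦ : ¬ IsPositive Φ) :
    ∃ v i, vertexFace d v ∈ Φ ∧ edgeFace d v (i + 1) ∈ Φ ∧ triangleFace d v i ∈ Φ := by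
  obtain ⟨v, i, h1, h2, h3 | h3⟩ := h.exists_mem_flag Φ
  · exact absurd ⟨v, i, h1, h3, h2⟩ hΦ
  · exact ⟨v, i, h1, h3, h2⟩

/-- Changing the edge or the triangle at a fixed vertex moves one of them past the other in the
cyclic order. Changing the vertex turns edge `i` and triangle `i` into edge `i + 3` and triangle `i
+ 2`, so the edge now follows the triangle. -/
theorem isPositive_adjacent {Φ Ψ : Flag (FacePoset (hexComplex d))} (ha : Adjacent Φ Ψ) :
    ¬ (IsPositive Φ ↔ IsPositive Ψ) := by
  have hP := h.isSimplicialManifold.isPolytope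
  have eqv : ∀ {v w}, vertexFace d v ∈ Ψ → vertexFace d w ∈ Ψ → v = w := fun {v w} h1 h2 =>
    vertexFace_inj.1 (flag_eq_of_rank_eq hP.rk_strictMono h1 h2
      (by rw [h.rk_vertexFace, h.rk_vertexFace]))
  have eqe : ∀ {v w i j}, edgeFace d v i ∈ Ψ → edgeFace d w j ∈ Ψ →
      edgeFace d v i = edgeFace d w j := fun {v w i j} h1 h2 =>
    flag_eq_of_rank_eq hP.rk_strictMono h1 h2 (by rw [h.rk_edgeFace, h.rk_edgeFace])
  have eqt : ∀ {v w i j}, triangleFace d v i ∈ Ψ → triangleFace d w j ∈ Ψ →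
      triangleFace d v i = triangleFace d w j := fun {v w i j} h1 h2 =>
    flag_eq_of_rank_eq hP.rk_strictMono h1 h2 (by rw [h.rk_triangleFace, h.rk_triangleFace])
  intro hiff
  by_cases hpos : IsPositive Φ
  · obtain ⟨w, j, hw1, hw2, hw3⟩ := hiff.1 hpos
    obtain ⟨v, i, hv1, hv2, hv3⟩ := hpos
    rcases hP.adjacent_three ha hv1 hv2 hv3 (h.rk_vertexFace _) (h.rk_edgeFace _ _)
      (h.rk_triangleFace _ _) with ⟨h1, h2, h3⟩ | ⟨h1, h2, h3⟩ | ⟨h1, h2, h3⟩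
    · obtain rfl := eqv h1 hw1
      rcases h.edgeFace_inj.1 (eqe h2 hw2) with ⟨-, rfl⟩ | ⟨e, -⟩
      · exact h3 hw3
      · exact h.add_ne _ _ e.symm
    · obtain rfl := eqv h1 hw1
      obtain rfl := h.triangleFace_inj.1 (eqt h3 hw3)
      exact h2 hw2
    · rcases h.edgeFace_inj.1 (eqe h2 hw2) with ⟨rfl, -⟩ | ⟨rfl, rfl⟩
      · exact h1 hw1
      · have e := simplexFace_inj.1 (eqt h3 hw3)
        rw [← h.rotate v i, h.triangle_inj] at e
        exact absurd (add_left_cancel e) (by decide)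
  · obtain ⟨w, j, hw1, hw2, hw3⟩ := h.exists_of_not_isPositive fun h' => hpos (hiff.2 h')
    obtain ⟨v, i, hv1, hv2, hv3⟩ := h.exists_of_not_isPositive hpos
    rcases hP.adjacent_three ha hv1 hv2 hv3 (h.rk_vertexFace _) (h.rk_edgeFace _ _)
      (h.rk_triangleFace _ _) with ⟨h1, h2, h3⟩ | ⟨h1, h2, h3⟩ | ⟨h1, h2, h3⟩
    · obtain rfl := eqv h1 hw1
      rcases h.edgeFace_inj.1 (eqe h2 hw2) with ⟨-, e⟩ | ⟨e, -⟩
      · obtain rfl := add_right_cancel e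
        exact h3 hw3
      · exact h.add_ne _ _ e.symm
    · obtain rfl := eqv h1 hw1
      obtain rfl := h.triangleFace_inj.1 (eqt h3 hw3)
      exact h2 hw2
    · rcases h.edgeFace_inj.1 (eqe h2 hw2) with ⟨rfl, -⟩ | ⟨rfl, e'⟩
      · exact h1 hw1
      · have e := simplexFace_inj.1 (eqt h3 hw3)
        rw [← h.rotate_two v i, h.triangle_inj] at e
        rw [← e, add_assoc, add_assoc] at e'
        exact absurd (add_left_cancel e') (by decide)

theorem ncard_face_zero : (Face (FacePoset (hexComplex d)) 0).ncard = Nat.card A := by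
  rw [← Set.ncard_univ, ← Set.ncard_image_of_injective Set.univ
    (f := vertexFace d) fun v w => vertexFace_inj.1]
  congr 1
  ext F
  rw [mem_face_iff, Set.image_univ]
  constructor
  · intro hF
    obtain ⟨v, rfl⟩ := h.exists_vertexFace (F := F) (by omega)
    exact ⟨v, rfl⟩
  · rintro ⟨v, rfl⟩
    rw [h.rk_vertexFace]
    rfl

theorem exists_vertexFace_le {F : FacePoset (hexComplex d)} (hF : 1 ≤ rk F) :
    ∃ v, vertexFace d v ≤ F := by
  have hP := h.isSimplicialManifold.isPolytope
  obtain ⟨b, hb, hb0⟩ := hP.ranked.exists_bot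
  obtain ⟨H, -, hHF, hH⟩ := hP.ranked.exists_between_rank (hb F) (k := 1) (by omega) hF
  obtain ⟨v, rfl⟩ := h.exists_vertexFace hH
  exact ⟨v, hHF⟩

/-- From its two ends an edge has directions `k` and `k + 3`, exactly one of which is 0, 1 or 2. -/
theorem ncard_face_one : (Face (FacePoset (hexComplex d)) 1).ncard = Nat.card A * 3 := by
  have hdec : (∀ i j : Fin 3, ((i : ℕ) : ZMod 6) = (j : ℕ) → i = j) ∧
      (∀ i j : Fin 3, ((j : ℕ) : ZMod 6) ≠ (i : ℕ) + 3) ∧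
      ∀ k : ZMod 6, ∃ i : Fin 3, k = (i : ℕ) ∨ (i : ℕ) = k + 3 := by decide
  have hinj : Function.Injective (fun x : A × Fin 3 => edgeFace d x.1 (x.2 : ℕ)) := by
    rintro ⟨v, i⟩ ⟨w, j⟩ e
    rcases h.edgeFace_inj.1 e with ⟨h1, h2⟩ | ⟨-, h2⟩
    · exact Prod.ext h1 (hdec.1 i j h2)
    · exact absurd h2 (hdec.2.1 i j)
  have := Set.ncard_image_of_injective Set.univ hinj
  rw [Set.ncard_univ, Nat.card_prod, Nat.card_fin] at this
  rw [← this]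
  congr 1
  ext F
  rw [mem_face_iff, Set.image_univ]
  constructor
  · intro hF
    obtain ⟨v, hv⟩ := h.exists_vertexFace_le (F := F) (by omega)
    obtain ⟨k, rfl⟩ := h.exists_edgeFace (by omega) hv
    obtain ⟨i, hi | hi⟩ := hdec.2.2 k
    · exact ⟨(v, i), by rw [hi]⟩
    · exact ⟨(v + d k, i), (h.edgeFace_inj.2 (Or.inr ⟨rfl, hi⟩)).symm⟩
  · rintro ⟨x, rfl⟩
    rw [h.rk_edgeFace]
    rfl

/-- From its three vertices a triangle has indices `k`, `k + 2` and `k + 4`, exactly one of which is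
0 or 1. -/
theorem ncard_face_two : (Face (FacePoset (hexComplex d)) 2).ncard = Nat.card A * 2 := by
  have hdec : (∀ i j : Fin 2, ((i : ℕ) : ZMod 6) = (j : ℕ) → i = j) ∧
      (∀ i j : Fin 2, ((i : ℕ) : ZMod 6) + 2 ≠ (j : ℕ) ∧ ((i : ℕ) : ZMod 6) + 4 ≠ (j : ℕ)) ∧
      ∀ k : ZMod 6, ∃ i : Fin 2, (i : ℕ) = k ∨ (i : ℕ) = k + 2 ∨ (i : ℕ) = k + 4 := by decide
  have hinj : Function.Injective (fun x : A × Fin 2 => triangleFace d x.1 (x.2 : ℕ)) := by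
    rintro ⟨v, i⟩ ⟨w, j⟩ e
    have e' : hexTriangle d v (i : ℕ) = hexTriangle d w (j : ℕ) := simplexFace_inj.1 e
    have hw : w ∈ hexTriangle d v (i : ℕ) := e' ▸ self_mem w _
    rcases hw with rfl | rfl | rfl
    · exact Prod.ext rfl (hdec.1 i j (h.triangle_inj.1 e'))
    · rw [← h.rotate, h.triangle_inj] at e'
      exact absurd e' (hdec.2.1 i j).1
    · rw [← h.rotate_two, h.triangle_inj] at e'
      exact absurd e' (hdec.2.1 i j).2
  have := Set.ncard_image_of_injective Set.univ hinj
  rw [Set.ncard_univ, Nat.card_prod, Nat.card_fin] at this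
  rw [← this]
  congr 1
  ext F
  rw [mem_face_iff, Set.image_univ]
  constructor
  · intro hF
    obtain ⟨v, hv⟩ := h.exists_vertexFace_le (F := F) (by omega)
    obtain ⟨k, rfl⟩ := h.exists_triangleFace (by omega) hv
    obtain ⟨i, hi | hi | hi⟩ := hdec.2.2 k
    · exact ⟨(v, i), congrArg (triangleFace d v) hi⟩
    · exact ⟨(v + d k, i), simplexFace_inj.2 (by rw [hi, h.rotate])⟩
    · exact ⟨(v + d (k + 1), i), simplexFace_inj.2 (by rw [hi, h.rotate_two])⟩
  · rintro ⟨x, rfl⟩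
    rw [h.rk_triangleFace]
    rfl

theorem isToroidalMap [Finite A] : IsToroidalMap (FacePoset (hexComplex d)) := by
  classical
  refine ⟨inferInstance, h.isSimplicialManifold.isPolytope,
    ⟨fun Φ => decide (IsPositive Φ), fun Φ Ψ ha e => h.isPositive_adjacent ha ?_⟩, ?_⟩
  · simpa using e
  · rw [h.ncard_face_zero, h.ncard_face_one, h.ncard_face_two]
    push_cast
    ring

end IsHexagonal

/-- The directions `1, 3, 2, -1, -3, -2` in a cyclic group. -/
def cyclicDirections (N : ℕ) (i : ZMod 6) : ZMod N :=
  ((![1, 3, 2, -1, -3, -2] : Fin 6 → ℤ) i : ℤ)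

theorem isHexagonal_cyclicDirections {N : ℕ} (hN : 7 ≤ N) : IsHexagonal (cyclicDirections N) where
  neg := fun i => by
    rw [cyclicDirections, cyclicDirections, ← Int.cast_neg]
    congr 1
    revert i
    decide
  add := fun i => by
    rw [cyclicDirections, cyclicDirections, cyclicDirections, ← Int.cast_add]
    congr 1
    revert i
    decide
  inj := fun i j e => by
    rw [cyclicDirections, cyclicDirections, ZMod.intCast_eq_intCast_iff_dvd_sub] at e
    have hb : ∀ i j : Fin 6, (![1, 3, 2, -1, -3, -2] : Fin 6 → ℤ) j -
        (![1, 3, 2, -1, -3, -2] : Fin 6 → ℤ) i = 0 → i = j := by decide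
    -- The entries lie between -3 and 3, so two of them differ by at most 6 and stay distinct modulo
    -- `N ≥ 7`.
    have hs : ∀ i j : Fin 6, |(![1, 3, 2, -1, -3, -2] : Fin 6 → ℤ) j -
        (![1, 3, 2, -1, -3, -2] : Fin 6 → ℤ) i| < 7 := by decide
    refine hb i j (Int.eq_zero_of_abs_lt_dvd e ((hs i j).trans_le ?_))
    exact_mod_cast hN
  generate := by
    refine eq_top_iff.2 fun x _ => ?_
    have : NeZero N := ⟨by omega⟩
    have h1 : (1 : ZMod N) ∈ AddSubmonoid.closure (Set.range (cyclicDirections N)) :=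
      AddSubmonoid.subset_closure ⟨0, by simp [cyclicDirections]⟩
    have := nsmul_mem h1 x.val
    rwa [nsmul_one, ZMod.natCast_zmod_val] at this

/-- There are arbitrarily large toroidal maps of type `{3,6}`. -/
theorem exists_toroidalMap (N : ℕ) : ∃ (L : Type) (_ : PartialOrder L), IsToroidalMap L ∧
    IsEquivelar L 3 (fun j => 3 * j) ∧ N ≤ (Face L 0).ncard := by
  have h := isHexagonal_cyclicDirections (show 7 ≤ N + 7 by omega)
  refine ⟨FacePoset (hexComplex (cyclicDirections (N + 7))), inferInstance, h.isToroidalMap,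
    h.isEquivelar, ?_⟩
  rw [h.ncard_face_zero, Nat.card_zmod]
  omega

end AbstractPolytope

/-! ### Assembly of the theorem -/

namespace AbstractPolytope

theorem twoPow_subdivided {L : Type u} [PartialOrder L] [Finite L] {m : ℕ} (hm : 3 ≤ m)
    {p : ℕ → ℕ} (hL : IsPolytope L m) (hp : IsEquivelar L m p)
    (hp3 : ∀ j ∈ Set.Icc 1 (m - 1), 3 ≤ p j) (hpinj : Set.InjOn p (Set.Icc 1 (m - 1)))
    (Φ : Flag L) :
    (IsPolytope (SubdividedOrderComplex Φ) m ∧ IsSimplicial (SubdividedOrderComplex Φ) m ∧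
      IsVertexDescribable (SubdividedOrderComplex Φ) ∧
      IsAsymmetric (SubdividedOrderComplex Φ)) ∧
    (IsPolytope (TwoPow (SubdividedOrderComplex Φ)) (m + 1) ∧
      IsEquifacetted (TwoPow (SubdividedOrderComplex Φ)) (m + 1) ∧
      IsSemiregular (TwoPow (SubdividedOrderComplex Φ)) (m + 1) ∧
      numFlagOrbits (TwoPow (SubdividedOrderComplex Φ)) =
        Nat.card (Flag (SubdividedOrderComplex Φ)) ∧
      ∀ j : ℕ, numFaceOrbits (TwoPow (SubdividedOrderComplex Φ)) j =
        (Face (SubdividedOrderComplex Φ) ((j : ℤ) - 1)).ncard) := by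
  have hm0 : m ≠ 0 := by omega
  have M := hL.isSimplicialManifold_subdivided Φ hm0
  have hK := M.isPolytope
  have hs := M.isSimplicial hm0
  have hv := M.isVertexDescribable hm0
  have ha := isAsymmetric_subdivided hL Φ hm hp hp3 hpinj
  have : Finite (SubdividedOrderComplex Φ) := inferInstance
  exact ⟨⟨hK, hs, hv, ha⟩, (classSystem_cubeFace hK hv).isPolytope hK,
    isEquifacetted_cubeFace hK hv hm0 hs, isSemiregular_cubeFace hK hv hm0 hs,
    numFlagOrbits_cubeFace hK hv ha, numFaceOrbits_cubeFace hK hv ha⟩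

theorem exists_equivelar_large {m : ℕ} (hm : 3 ≤ m) (N : ℕ) :
    ∃ (L : Type) (_ : PartialOrder L) (p : ℕ → ℕ), Finite L ∧ IsPolytope L m ∧
      IsEquivelar L m p ∧ (∀ j ∈ Set.Icc 1 (m - 1), 3 ≤ p j) ∧
      Set.InjOn p (Set.Icc 1 (m - 1)) ∧ (m = 3 → IsToroidalMap L ∧ p 1 = 3 ∧ p 2 = 6) ∧
      N ≤ (Face L 0).ncard := by
  by_cases h3 : m = 3
  · subst h3
    obtain ⟨L, _, hL, hp, hN⟩ := exists_toroidalMap N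
    exact ⟨L, _, _, hL.1, hL.2.1, hp, fun j hj => by have := hj.1; omega,
      fun i _ j _ e => Nat.eq_of_mul_eq_mul_left (by norm_num) e, fun _ => ⟨hL, rfl, rfl⟩, hN⟩
  -- The bound `N + 3` makes all entries at least 3 and, since a 2-face already has `p 1` vertices,
  -- provides at least `N` vertices.
  · obtain ⟨L, _, p, hf, hL, -, hp, hpN, hinj⟩ := exists_equivelar m (N + 3)
    have h1 := hpN 1 ⟨le_rfl, by omega⟩
    have h2 := hp.le_ncard_vertices hL (by omega)
    exact ⟨L, _, p, hf, hL, hp, fun j hj => by have := hpN j hj; omega, hinj,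
      fun h => absurd h h3, by omega⟩

theorem IsPolytope.le_card_subdivided {L : Type u} [PartialOrder L] [Finite L] {m : ℕ}
    (hL : IsPolytope L m) (hm : m ≠ 0) {N : ℕ} (hN : N + 1 ≤ (Face L 0).ncard) (Φ : Flag L) :
    N ≤ Nat.card (Flag (SubdividedOrderComplex Φ)) ∧
      ∀ j : ℕ, j ≤ m - 1 → N ≤ (Face (SubdividedOrderComplex Φ) j).ncard :=
  ⟨(hL.le_ncard_face_subdivided Φ hN (j := 0) (by omega)).trans
    ((hL.isSimplicialManifold_subdivided Φ hm).isPolytope.ncard_face_le_card_flag _),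
    fun j hj => hL.le_ncard_face_subdivided Φ hN (by omega)⟩

end AbstractPolytope

open AbstractPolytope
theorem mainTheorem4 (n : ℕ) (hn : 4 ≤ n) :
    -- equifacetted semi-regular n-polytopes with many flag orbits and many face orbits
    (∀ N : ℕ, ∃ (P : Type) (_ : PartialOrder P), Finite P ∧
      IsPolytope P n ∧ IsEquifacetted P n ∧ IsSemiregular P n ∧
      N ≤ numFlagOrbits P ∧
      ∀ j : ℕ, 1 ≤ j → j ≤ n - 1 → N ≤ numFaceOrbits P j) ∧
    -- the construction of asymmetric simplicial polytopes K, and the polytopes 2^K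
    (∀ (L : Type u) [PartialOrder L] [Finite L] (p : ℕ → ℕ),
      IsPolytope L (n - 1) → IsEquivelar L (n - 1) p →
      (∀ j ∈ Set.Icc 1 (n - 2), 3 ≤ p j) → Set.InjOn p (Set.Icc 1 (n - 2)) →
      ∀ Φ : Flag L,
        (IsPolytope (SubdividedOrderComplex Φ) (n - 1) ∧
          IsSimplicial (SubdividedOrderComplex Φ) (n - 1) ∧
          IsVertexDescribable (SubdividedOrderComplex Φ) ∧
          IsAsymmetric (SubdividedOrderComplex Φ)) ∧
        (IsPolytope (TwoPow (SubdividedOrderComplex Φ)) n ∧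
          IsEquifacetted (TwoPow (SubdividedOrderComplex Φ)) n ∧
          IsSemiregular (TwoPow (SubdividedOrderComplex Φ)) n ∧
          numFlagOrbits (TwoPow (SubdividedOrderComplex Φ)) =
            Nat.card (Flag (SubdividedOrderComplex Φ)) ∧
          ∀ j : ℕ, 1 ≤ j → j ≤ n - 1 →
            numFaceOrbits (TwoPow (SubdividedOrderComplex Φ)) j =
              (Face (SubdividedOrderComplex Φ) ((j : ℤ) - 1)).ncard)) ∧
    -- the construction yields arbitrarily many flags and faces
    (∀ N : ℕ, ∃ (L : Type) (_ : PartialOrder L) (p : ℕ → ℕ), Finite L ∧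
      IsPolytope L (n - 1) ∧ IsEquivelar L (n - 1) p ∧
      (∀ j ∈ Set.Icc 1 (n - 2), 3 ≤ p j) ∧ Set.InjOn p (Set.Icc 1 (n - 2)) ∧
      (n = 4 → IsToroidalMap L ∧ p 1 = 3 ∧ p 2 = 6) ∧
      ∀ Φ : Flag L,
        N ≤ Nat.card (Flag (SubdividedOrderComplex Φ)) ∧
        ∀ j : ℕ, j ≤ n - 2 → N ≤ (Face (SubdividedOrderComplex Φ) j).ncard) := by
  obtain ⟨m, rfl⟩ : ∃ m, n = m + 1 := ⟨n - 1, by omega⟩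
  have hm : 3 ≤ m := by omega
  simp only [Nat.add_sub_cancel, show m + 1 - 2 = m - 1 by omega]
  refine ⟨fun N => ?_, fun L _ _ p hL hp hp3 hpinj Φ => ?_, fun N => ?_⟩
  -- One vertex more than `N` is requested because the subdivision may cost one simplex.
  · obtain ⟨L, _, p, _, hL, hp, hp3, hpinj, -, hN⟩ := exists_equivelar_large hm (N + 1)
    obtain ⟨b, -⟩ := hL.exists_least
    obtain ⟨Φ, -⟩ := Flag.exists_mem b
    obtain ⟨-, h1, h2, h3, h4, h5⟩ := twoPow_subdivided hm hL hp hp3 hpinj Φ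
    obtain ⟨h6, h7⟩ := hL.le_card_subdivided (by omega) hN Φ
    refine ⟨TwoPow (SubdividedOrderComplex Φ), inferInstance, inferInstance, h1, h2, h3,
      h6.trans_eq h4.symm, fun j hj1 hj2 => ?_⟩
    have := h7 (j - 1) (by omega)
    rwa [Nat.cast_sub hj1, Nat.cast_one, ← h5] at this
  · obtain ⟨h1, h2, h3, h4, h5, h6⟩ := twoPow_subdivided hm hL hp hp3 hpinj Φ
    exact ⟨h1, h2, h3, h4, h5, fun j _ _ => h6 j⟩
  · obtain ⟨L, hO, p, hf, hL, hp, hp3, hpinj, ht, hN⟩ := exists_equivelar_large hm (N + 1)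
    exact ⟨L, hO, p, hf, hL, hp, hp3, hpinj, fun h => ht (by omega),
      hL.le_card_subdivided (by omega) hN⟩
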